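/- Let $N\ge 2$ and let $\Omega\subset\mathbb R^N$ be open and bounded with Lipschitz boundary (near each boundary point, after a rigid motion, $\Omega$ is the strict epigraph of a Lipschitz function), let $\lambda$ be Lebesgue measure on $\Omega$, and let $\sigma$ be the surface measure on $\partial\Omega$, i.e. the $(N-1)$-dimensional Hausdorff measure. Let $a_{ij},c_i,d\in L^\infty(\Omega)$ and $\beta\in L^\infty(\partial\Omega)$ be real-valued ($1\le i,j\le N$), let $\alpha>0$ be such that $\sum_{i,j}a_{ij}(x)\xi_i\xi_j\ge\alpha|\xi|^2$ for almost every $x\in\Omega$ and all $\xi\in\mathbb R^N$, and let $b_j\in W^{1,\infty}(\Omega)$ be real-valued for $j=1,\dots,N$. Let $\mathcal H=L^2(\Omega)\oplus L^2(\partial\Omega)$ (real Hilbert space), $\mathcal V=\{(u,u|_{\partial\Omega}):u\in H^1(\Omega)\}\subset\mathcal H$, where $u|_{\partial\Omega}$ denotes the trace, and for $(u,u|_{\partial\Omega}),(v,v|_{\partial\Omega})\in\mathcal V$ put $$\mathfrak a\bigl((u,u|_{\partial\Omega}),(v,v|_{\partial\Omega})\bigr)=\sum_{i,j}\int_\Omega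 a_{ij}D_iu\,D_jv\,d\lambda+\sum_j\int_\Omega b_j u\,D_jv\,d\lambda+\sum_i\int_\Omega c_i\,D_iu\,v\,d\lambda+\int_\Omega d\,uv\,d\lambda+\int_{\partial\Omega}\beta uv\,d\sigma .$$ Let $A$ be the operator on $\mathcal H$ associated with $\mathfrak a$: $x\in D(A)$ and $Ax=f$ if and only if $x\in\mathcal V$ and $\mathfrak a(x,y)=\langle f,y\rangle_{\mathcal H}$ for all $y\in\mathcal V$. Then there is exactly one $C_0$-semigroup $(T(t))_{t\ge0}$ on $\mathcal H$ with generator $-A$ (the Wentzell–Robin semigroup), and it is quasi-submarkovian: there is $\omega\in\mathbb R$ such that for every $t\ge0$ the operator $S=e^{-\omega t}T(t)$ is positive ($f\ge0$ and $g\ge0$ almost everywhere imply that both components of $S(f,g)$ are $\ge0$ almost everywhere) and $L^\infty$-contractive ($\|S(f,g)\|_\infty\le\|(f,g)\|_\infty$ for all $(f,g)\in\mathcal H$ that lie in $L^\infty(\Omega)\oplus L^\infty(\partial\Omega)$, where $\|(f,g)\|_\infty=\max\{\|f\|_{L^\infty(\Omega)},\|g\|_{L^\infty(\partial\Omega)}\}$).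 -/

import Mathlib

open MeasureTheory Filter Topology
open scoped ENNReal NNReal

noncomputable section

namespace WentzellRobin

/-- Euclidean space `ℝᴺ`. -/
abbrev E (N : ℕ) : Type := EuclideanSpace ℝ (Fin N)

/-- `Ω ⊆ ℝᴺ` is open, bounded, and near each boundary point `z` it is, after a rigid motion that
sends `z` to `0`, the strict epigraph of a Lipschitz function `ψ : ℝᴺ⁻¹ → ℝ`.  The map `O` is an
orthogonal map followed by the identification `ℝᴺ = ℝᴺ⁻¹ × ℝ` (Euclidean norms); `ψ 0 = 0` says
that the boundary point `z` itself lies on the graph. -/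
def IsLipschitzRegular {N : ℕ} (Ω : Set (E N)) : Prop :=
  IsOpen Ω ∧ Bornology.IsBounded Ω ∧
    ∀ z ∈ frontier Ω, ∃ (O : E N ≃ₗᵢ[ℝ] WithLp 2 (E (N - 1) × ℝ)) (r : ℝ)
      (ψ : E (N - 1) → ℝ) (K : ℝ≥0), 0 < r ∧ LipschitzWith K ψ ∧ ψ 0 = 0 ∧
        ∀ (y : E (N - 1)) (s : ℝ), ‖y‖ < r → |s| < r →
          (z + O.symm (WithLp.toLp 2 (y, ψ y + s)) ∈ Ω ↔ 0 < s)

/-- Lebesgue measure on `Ω`. -/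
abbrev vol {N : ℕ} (Ω : Set (E N)) : Measure (E N) := volume.restrict Ω

/-- Surface measure on `∂Ω`: the `(N-1)`-dimensional Hausdorff measure, normalized so that it
agrees with Lebesgue measure on `ℝᴺ⁻¹`. -/
abbrev surf {N : ℕ} (Ω : Set (E N)) : Measure (E N) := μHE[N - 1].restrict (frontier Ω)

/-- `L²(Ω)`. -/
abbrev L2Int {N : ℕ} (Ω : Set (E N)) : Type := Lp ℝ 2 (vol Ω)

/-- `L²(∂Ω)`. -/
abbrev L2Bdry {N : ℕ} (Ω : Set (E N)) : Type := Lp ℝ 2 (surf Ω)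

/-- The Hilbert space `L²(Ω) ⊕ L²(∂Ω)`. -/
abbrev H {N : ℕ} (Ω : Set (E N)) : Type := WithLp 2 (L2Int Ω × L2Bdry Ω)

/-- The classical partial derivative `Dᵢ φ`. -/
def partialDeriv {N : ℕ} (i : Fin N) (φ : E N → ℝ) (x : E N) : ℝ :=
  fderiv ℝ φ x (EuclideanSpace.single i 1)

/-- `g` is the weak partial derivative `Dᵢ u` on `Ω` (used for `u`, `g` locally integrable
on `Ω`). -/
def HasWeakPartial {N : ℕ} (Ω : Set (E N)) (i : Fin N) (u g : E N → ℝ) : Prop :=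
  ∀ φ : E N → ℝ, ContDiff ℝ (⊤ : ℕ∞) φ → HasCompactSupport φ → tsupport φ ⊆ Ω →
    ∫ x, u x * partialDeriv i φ x ∂(vol Ω) = -∫ x, g x * φ x ∂(vol Ω)

/-- The Sobolev space `W^{1,∞}(Ω)`. -/
def MemW1Infty {N : ℕ} (Ω : Set (E N)) (u : E N → ℝ) : Prop :=
  MemLp u ∞ (vol Ω) ∧ ∀ i, ∃ g : E N → ℝ, MemLp g ∞ (vol Ω) ∧ HasWeakPartial Ω i u g

/-- The Sobolev space `H¹(Ω)`. -/
def MemH1 {N : ℕ} (Ω : Set (E N)) (u : L2Int Ω) : Prop :=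
  ∀ i, ∃ g : L2Int Ω, HasWeakPartial Ω i u g

open Classical in
/-- The weak partial derivative `Dᵢ u ∈ L²(Ω)` of `u ∈ H¹(Ω)` (junk value `0` otherwise). -/
def weakPartial {N : ℕ} (Ω : Set (E N)) (i : Fin N) (u : L2Int Ω) : L2Int Ω :=
  if h : ∃ g : L2Int Ω, HasWeakPartial Ω i u g then h.choose else 0

/-- `g ∈ L²(∂Ω)` is the trace of `u ∈ H¹(Ω)`: there are functions that are `C¹` up to the boundary,
converge to `u` in `H¹(Ω)`, and whose restrictions to `∂Ω` converge to `g` in `L²(∂Ω)`. -/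
def IsTrace {N : ℕ} (Ω : Set (E N)) (u : L2Int Ω) (g : L2Bdry Ω) : Prop :=
  ∃ φ : ℕ → E N → ℝ, (∀ n, ContDiff ℝ 1 (φ n)) ∧
    Tendsto (fun n => eLpNorm (fun x => φ n x - u x) 2 (vol Ω)) atTop (𝓝 0) ∧
    (∀ i, Tendsto (fun n => eLpNorm (fun x => partialDeriv i (φ n) x - weakPartial Ω i u x) 2
      (vol Ω)) atTop (𝓝 0)) ∧
    Tendsto (fun n => eLpNorm (fun x => φ n x - g x) 2 (surf Ω)) atTop (𝓝 0)

/-- The form domain `{(u, u|_∂Ω) : u ∈ H¹(Ω)}`. -/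
def formDomain {N : ℕ} (Ω : Set (E N)) : Set (H Ω) :=
  {x | MemH1 Ω x.fst ∧ IsTrace Ω x.fst x.snd}

/-- The bilinear form of the operator
`L u = -∑ⱼ Dⱼ(∑ᵢ aᵢⱼ Dᵢ u + bⱼ u) + ∑ᵢ cᵢ Dᵢ u + d u` with boundary coefficient `β`, evaluated at
`x = (u, u|_∂Ω)` and `y = (v, v|_∂Ω)`. -/
def form {N : ℕ} (Ω : Set (E N)) (a : Fin N → Fin N → E N → ℝ) (b c : Fin N → E N → ℝ)
    (d β : E N → ℝ) (x y : H Ω) : ℝ :=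
  (∑ i, ∑ j, ∫ p, a i j p * weakPartial Ω i x.fst p * weakPartial Ω j y.fst p ∂(vol Ω))
    + (∑ j, ∫ p, b j p * x.fst p * weakPartial Ω j y.fst p ∂(vol Ω))
    + (∑ i, ∫ p, c i p * weakPartial Ω i x.fst p * y.fst p ∂(vol Ω))
    + (∫ p, d p * x.fst p * y.fst p ∂(vol Ω))
    + ∫ p, β p * x.snd p * y.snd p ∂(surf Ω)

/-- The (graph of the) operator `A` on `L²(Ω) ⊕ L²(∂Ω)` associated with the form. -/
def operatorGraph {N : ℕ} (Ω : Set (E N)) (a : Fin N → Fin N → E N → ℝ)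
    (b c : Fin N → E N → ℝ) (d β : E N → ℝ) : Set (H Ω × H Ω) :=
  {q | q.1 ∈ formDomain Ω ∧ ∀ y ∈ formDomain Ω, form Ω a b c d β q.1 y = inner ℝ q.2 y}

/-- A strongly continuous one-parameter semigroup of bounded operators. -/
structure IsC0Semigroup {X : Type*} [NormedAddCommGroup X] [NormedSpace ℝ X]
    (T : ℝ≥0 → X →L[ℝ] X) : Prop where
  map_zero : T 0 = ContinuousLinearMap.id ℝ X
  map_add : ∀ s t, T (s + t) = (T s).comp (T t)
  tendsto_zero : ∀ x, Tendsto (fun t => T t x) (𝓝 0) (𝓝 x)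

/-- The graph of the infinitesimal generator of a semigroup. -/
def generatorGraph {X : Type*} [NormedAddCommGroup X] [NormedSpace ℝ X]
    (T : ℝ≥0 → X →L[ℝ] X) : Set (X × X) :=
  {q | Tendsto (fun t : ℝ≥0 => (t : ℝ)⁻¹ • (T t q.1 - q.1)) (𝓝[>] 0) (𝓝 q.2)}

/-- `T` is the Wentzell–Robin semigroup: the `C₀`-semigroup whose generator is `-A`. -/
def IsWentzellRobinSemigroup {N : ℕ} (Ω : Set (E N)) (a : Fin N → Fin N → E N → ℝ)
    (b c : Fin N → E N → ℝ) (d β : E N → ℝ) (T : ℝ≥0 → H Ω →L[ℝ] H Ω) : Prop :=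
  IsC0Semigroup T ∧
    ∀ x f : H Ω, (x, -f) ∈ generatorGraph T ↔ (x, f) ∈ operatorGraph Ω a b c d β

/-- `x ≥ 0` almost everywhere on `Ω` and on `∂Ω`. -/
def IsNonneg {N : ℕ} {Ω : Set (E N)} (x : H Ω) : Prop := 0 ≤ x.fst ∧ 0 ≤ x.snd

/-- The norm of `L^∞(Ω) ⊕ L^∞(∂Ω)` (with value `∞` outside that space). -/
def linftyNorm {N : ℕ} {Ω : Set (E N)} (x : H Ω) : ℝ≥0∞ :=
  max (eLpNorm x.fst ∞ (vol Ω)) (eLpNorm x.snd ∞ (surf Ω))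

/-- A positive operator. -/
def IsPositiveOp {N : ℕ} {Ω : Set (E N)} (S : H Ω →L[ℝ] H Ω) : Prop :=
  ∀ x, IsNonneg x → IsNonneg (S x)

/-- An `L^∞`-contractive operator. -/
def IsLinftyContractive {N : ℕ} {Ω : Set (E N)} (S : H Ω →L[ℝ] H Ω) : Prop :=
  ∀ x, linftyNorm (S x) ≤ linftyNorm x

/-- `(e^{-ωt} T(t))` is positive and `L^∞`-contractive for some real `ω`. -/
def IsQuasiSubmarkovian {N : ℕ} {Ω : Set (E N)} (T : ℝ≥0 → H Ω →L[ℝ] H Ω) : Prop :=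
  ∃ ω : ℝ, ∀ t : ℝ≥0, IsPositiveOp (Real.exp (-ω * t) • T t) ∧
    IsLinftyContractive (Real.exp (-ω * t) • T t)

end WentzellRobin

end

/-! Let `W Ω` be L²(Ω) ⊕ L²(∂Ω) ⊕ L²(Ω)ᴺ and let V be the closure in it of the triples (φ, φ|_∂Ω,
∇φ) with φ of class C¹ (`graphSpace`). Since weak derivatives are unique, the form domain is exactly
the image of V in 𝓗 (`mem_formDomain_iff`), and 𝔞 becomes a bounded bilinear form on a Hilbert
space; neither a trace inequality nor uniqueness of the trace is needed. Ellipticity and Young's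
inequality give α/2 ‖ξ‖² ≤ 𝔞(ξ, ξ) + ω ‖ξ.fst‖² for large ω (`formW_coercive`). Lax–Milgram then
provides R(l) = (l + ω + A)⁻¹ with ‖l R(l)‖ ≤ 1 for l > 0 (`exists_resolvent_of_elliptic`), and the
Hille–Yosida theorem a contraction semigroup S generated by -(A + ω)
(`IsContractiveResolvent.exists_semigroup`). The semigroup sought is T(t) = e^{ωt} S(t). It is
unique because a densely defined generator determines its semigroup
(`IsC0Semigroup.eq_of_generatorGraph_eq`).

Positivity and L^∞-contractivity of S both follow from invariance of the closed convex sets {x ≤ M},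
M ≥ 0: the case M = 0 gives the former, all M applied to x and -x the latter. The exponentials of
the Yosida approximations are convex combinations of powers of l R(l), so invariance under l R(l)
suffices. For this the resolvent equation is tested with v = G(u - M), where G is a C¹ version of
the positive part (`mem_boundedAbove_of_formW_eq`). Ellipticity and ω absorb every term except M ∫
b·∇v, which is only linear in v.

Here the regularity of b enters, through |∫ b_j D_j v| ≤ C (∫_Ω |v| + ∫_∂Ω |v|)
(`exists_integral_grad_le`). As v ≥ 0 and as 𝓗 contains the boundary component, enlarging ω absorbs
both integrals. The estimate is proved without a divergence theorem on Ω: the weak derivative of b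
is tested with χ_ε v, where the cutoff χ_ε varies only in a boundary layer of width 5ε and has
partial derivatives at most 1/ε, and the integral of |v| over such a layer is of order ε times its
boundary integral (`IsLipschitzRegular.exists_layer_bound`). The last fact is seen in graph
coordinates: the shear that flattens the boundary preserves volume, and projection to the horizontal
plane does not increase Hausdorff measure. -/

noncomputable section

namespace WentzellRobin

/-! ### Exponentials of bounded operators and contraction estimates -/

section HilleYosida

variable {X : Type*} [NormedAddCommGroup X] [NormedSpace ℝ X]

/-- A countable convex combination of points of a closed convex set lies in the set. -/
theorem hasSum_mem_of_isClosed_convex {C : Set X} (hC : Convex ℝ C) (hcl : IsClosed C)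
    {w : ℕ → ℝ} (hw : ∀ k, 0 ≤ w k) (hsum : HasSum w 1) {z : ℕ → X} (hz : ∀ k, z k ∈ C) {x : X}
    (hx : HasSum (fun k => w k • z k) x) : x ∈ C := by
  have h1 := hsum.tendsto_sum_nat
  have h2 := hx.tendsto_sum_nat
  have h3 : Tendsto (fun n => (Finset.range n).centerMass w z) atTop (𝓝 ((1 : ℝ)⁻¹ • x)) :=
    (h1.inv₀ one_ne_zero).smul h2
  rw [inv_one, one_smul] at h3
  refine hcl.mem_of_tendsto h3 ?_
  filter_upwards [h1.eventually (lt_mem_nhds zero_lt_one)] with n hn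
  exact hC.centerMass_mem (fun i _ => hw i) hn (fun i _ => hz i)

variable [CompleteSpace X]

/-- `exp (s (P - 1))` leaves invariant every closed convex set that `P` leaves invariant. -/
theorem exp_smul_sub_one_mem {P : X →L[ℝ] X} {C : Set X} (hC : Convex ℝ C) (hcl : IsClosed C)
    (hP : ∀ x ∈ C, P x ∈ C) {s : ℝ} (hs : 0 ≤ s) {x : X} (hx : x ∈ C) :
    NormedSpace.exp (s • (P - 1)) x ∈ C := by
  let _ : NormedAlgebra ℚ (X →L[ℝ] X) := NormedAlgebra.restrictScalars ℚ ℝ _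
  -- Expanding the right-hand side exhibits the operator as a mean of the powers of `P` with the
  -- Poisson weights e^{-s} s^k / k!, whose sum is one.
  have hexp : NormedSpace.exp (s • (P - 1)) = Real.exp (-s) • NormedSpace.exp (s • P) := by
    have h1 : s • (P - 1) = algebraMap ℝ (X →L[ℝ] X) (-s) + s • P := by
      rw [Algebra.algebraMap_eq_smul_one]; module
    rw [h1, NormedSpace.exp_add_of_commute (Algebra.commutes _ _),
      ← NormedSpace.algebraMap_exp_comm (𝕂 := ℝ), ← Real.exp_eq_exp_ℝ,
      Algebra.algebraMap_eq_smul_one, smul_mul_assoc, one_mul]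
  have hpow : ∀ k : ℕ, (P ^ k) x ∈ C := by
    intro k
    induction k with
    | zero => simpa using hx
    | succ k ih => rw [pow_succ']; exact hP _ ih
  refine hasSum_mem_of_isClosed_convex hC hcl
    (w := fun k => Real.exp (-s) * ((k.factorial : ℝ)⁻¹ * s ^ k)) (fun k => by positivity) ?_ hpow ?_
  · have := (NormedSpace.exp_series_hasSum_exp' (𝕂 := ℝ) s).mul_left (Real.exp (-s))
    rw [← Real.exp_eq_exp_ℝ, ← Real.exp_add, neg_add_cancel, Real.exp_zero] at this
    simpa using this
  · have h2 := (NormedSpace.exp_series_hasSum_exp' (𝕂 := ℝ) (s • P)).const_smul (Real.exp (-s))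
    rw [← hexp] at h2
    have h3 := (ContinuousLinearMap.apply ℝ X x).hasSum h2
    convert! h3 using 1
    ext k
    simp [smul_pow, mul_smul]

theorem norm_exp_smul_sub_one_apply_le {P : X →L[ℝ] X} (hP : ∀ x, ‖P x‖ ≤ ‖x‖) {s : ℝ}
    (hs : 0 ≤ s) (x : X) : ‖NormedSpace.exp (s • (P - 1)) x‖ ≤ ‖x‖ := by
  have := exp_smul_sub_one_mem (convex_closedBall (0 : X) ‖x‖) Metric.isClosed_closedBall
    (P := P) (fun y hy => by
      simp only [mem_closedBall_zero_iff] at hy ⊢; exact (hP y).trans hy) hs (x := x) (by simp)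
  simpa using this

theorem hasDerivAt_exp_smul_apply (A : X →L[ℝ] X) (x : X) (t : ℝ) :
    HasDerivAt (fun t : ℝ => NormedSpace.exp (t • A) x) (NormedSpace.exp (t • A) (A x)) t := by
  have h := hasDerivAt_exp_smul_const (𝕂 := ℝ) A t
  exact ((ContinuousLinearMap.apply ℝ X x).hasFDerivAt.comp_hasDerivAt t h)

/-- Two commuting contraction semigroups with bounded generators. -/
theorem norm_exp_smul_sub_exp_smul_le {A B : X →L[ℝ] X} (hAB : Commute A B)
    (hA : ∀ t : ℝ, 0 ≤ t → ∀ x, ‖NormedSpace.exp (t • A) x‖ ≤ ‖x‖)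
    (hB : ∀ t : ℝ, 0 ≤ t → ∀ x, ‖NormedSpace.exp (t • B) x‖ ≤ ‖x‖) {t : ℝ} (ht : 0 ≤ t) (x : X) :
    ‖NormedSpace.exp (t • A) x - NormedSpace.exp (t • B) x‖ ≤ t * ‖A x - B x‖ := by
  let _ : NormedAlgebra ℚ (X →L[ℝ] X) := NormedAlgebra.restrictScalars ℚ ℝ _
  -- The path s ↦ e^{sA} e^{(t-s)B} x joins the two values; commutativity turns its derivative into
  -- two contractions applied to `A x - B x`.
  have hd : ∀ s : ℝ, HasDerivAt
      (fun s : ℝ => (NormedSpace.exp (s • A) * NormedSpace.exp ((t - s) • B)) x)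
      (NormedSpace.exp (s • A) (NormedSpace.exp ((t - s) • B) (A x - B x))) s := by
    intro s
    have h1 := hasDerivAt_exp_smul_const (𝕂 := ℝ) A s
    have h2 : HasDerivAt (fun s : ℝ => NormedSpace.exp ((t - s) • B))
        ((-1 : ℝ) • (NormedSpace.exp ((t - s) • B) * B)) s :=
      (hasDerivAt_exp_smul_const (𝕂 := ℝ) B (t - s)).scomp s
        ((hasDerivAt_id s).const_sub t)
    have h3 := (ContinuousLinearMap.apply ℝ X x).hasFDerivAt.comp_hasDerivAt s (h1.mul h2)
    convert! h3 using 1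
    have hc : Commute A (NormedSpace.exp ((t - s) • B)) := (hAB.smul_right (t - s)).exp_right
    have e : NormedSpace.exp (s • A) * A * NormedSpace.exp ((t - s) • B) =
        NormedSpace.exp (s • A) * NormedSpace.exp ((t - s) • B) * A := by
      rw [mul_assoc, hc.eq, mul_assoc]
    rw [e]
    simp [sub_eq_add_neg]
  have := norm_image_sub_le_of_norm_deriv_le_segment' (a := 0) (b := t) (C := ‖A x - B x‖)
    (f := fun s : ℝ => (NormedSpace.exp (s • A) * NormedSpace.exp ((t - s) • B)) x)
    (fun s _ => (hd s).hasDerivWithinAt)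
    (fun s hs => (hA s hs.1 _).trans (hB (t - s) (by linarith [hs.2]) _)) t ⟨ht, le_rfl⟩
  simpa [NormedSpace.exp_zero, mul_comm] using this

theorem norm_exp_smul_sub_self_le {A : X →L[ℝ] X}
    (hA : ∀ t : ℝ, 0 ≤ t → ∀ x, ‖NormedSpace.exp (t • A) x‖ ≤ ‖x‖) {t : ℝ} (ht : 0 ≤ t) (x : X) :
    ‖NormedSpace.exp (t • A) x - x‖ ≤ t * ‖A x‖ := by
  simpa [NormedSpace.exp_zero] using
    norm_exp_smul_sub_exp_smul_le (Commute.zero_right A) hA (by simp [NormedSpace.exp_zero]) ht x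

/-- This is a first-order expansion whose error stays bounded when `A` runs through the Yosida
approximations. There `y` is the limit of `A x` and need not lie in the domain of the limit
operator, so a nearby `z` from the domain replaces it where `A` is applied a second time. -/
theorem norm_exp_smul_sub_self_sub_le {A : X →L[ℝ] X}
    (hA : ∀ t : ℝ, 0 ≤ t → ∀ x, ‖NormedSpace.exp (t • A) x‖ ≤ ‖x‖) {t : ℝ} (ht : 0 ≤ t)
    (x y z : X) :
    ‖NormedSpace.exp (t • A) x - x - t • y‖ ≤
      t * (t * ‖A z‖ + 2 * ‖y - z‖ + ‖A x - y‖) := by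
  have hd : ∀ s : ℝ, HasDerivAt (fun s : ℝ => NormedSpace.exp (s • A) x - x - s • y)
      (NormedSpace.exp (s • A) (A x) - y) s := by
    intro s
    have := ((hasDerivAt_exp_smul_apply A x s).sub_const x).sub ((hasDerivAt_id s).smul_const y)
    rw [one_smul] at this
    exact this
  have := norm_image_sub_le_of_norm_deriv_le_segment' (a := 0) (b := t)
    (C := t * ‖A z‖ + 2 * ‖y - z‖ + ‖A x - y‖)
    (f := fun s : ℝ => NormedSpace.exp (s • A) x - x - s • y)
    (fun s _ => (hd s).hasDerivWithinAt) ?_ t ⟨ht, le_rfl⟩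
  · simpa [NormedSpace.exp_zero, mul_comm] using this
  · intro s hs
    have e : NormedSpace.exp (s • A) (A x) - y = NormedSpace.exp (s • A) (A x - y)
        + NormedSpace.exp (s • A) (y - z) + (NormedSpace.exp (s • A) z - z) + (z - y) := by
      simp only [map_sub]; abel
    rw [e]
    have h1 := hA s hs.1 (A x - y)
    have h2 := hA s hs.1 (y - z)
    have h3 := norm_exp_smul_sub_self_le hA hs.1 z
    have h4 : s * ‖A z‖ ≤ t * ‖A z‖ := by gcongr; exact hs.2.le
    have h5 : ‖z - y‖ = ‖y - z‖ := norm_sub_rev _ _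
    calc _ ≤ ‖NormedSpace.exp (s • A) (A x - y)‖ + ‖NormedSpace.exp (s • A) (y - z)‖
          + ‖NormedSpace.exp (s • A) z - z‖ + ‖z - y‖ := norm_add₄_le
      _ ≤ _ := by linarith

end HilleYosida

/-! ### Resolvents, Yosida approximation and the Hille–Yosida theorem -/

section Generation

variable {X : Type*} [NormedAddCommGroup X] [NormedSpace ℝ X]

/-- `G` is the graph of a densely defined operator such that `(0, ∞)` lies in its resolvent set,
with `R l = (l - G)⁻¹` and `‖l R l‖ ≤ 1`. -/
structure IsContractiveResolvent (G : Set (X × X)) (R : ℝ → X →L[ℝ] X) : Prop where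
  mem_iff : ∀ l : ℝ, 0 < l → ∀ x y, (x, y) ∈ G ↔ R l (l • x - y) = x
  norm_le : ∀ l : ℝ, 0 < l → ∀ x, ‖(l • R l) x‖ ≤ ‖x‖
  dense : Dense {x | ∃ y, (x, y) ∈ G}

/-- The Yosida approximation `l² R l - l`. -/
def yosida (R : ℝ → X →L[ℝ] X) (l : ℝ) : X →L[ℝ] X := l • (l • R l - 1)

namespace IsContractiveResolvent

variable {G : Set (X × X)} {R : ℝ → X →L[ℝ] X}

theorem resolvent_mem (h : IsContractiveResolvent G R)
    {l : ℝ} (hl : 0 < l) (f : X) : (R l f, l • R l f - f) ∈ G := by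
  rw [h.mem_iff l hl]; simp

theorem resolvent_identity (h : IsContractiveResolvent G R)
    {l m : ℝ} (hl : 0 < l) (hm : 0 < m) (f : X) :
    R m f = (l - m) • R l (R m f) + R l f := by
  have h1 := (h.mem_iff l hl _ _).1 (h.resolvent_mem hm f)
  rw [show l • R m f - (m • R m f - f) = (l - m) • R m f + f by module, map_add, map_smul] at h1
  exact h1.symm

/-- Adding the resolvent identity to its copy with `l` and `m` interchanged leaves (l - m) times the
commutator. -/
theorem commute_resolvent (h : IsContractiveResolvent G R)
    {l m : ℝ} (hl : 0 < l) (hm : 0 < m) : Commute (R l) (R m) := by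
  rcases eq_or_ne l m with rfl | hne
  · exact Commute.refl _
  · ext f
    have h1 := h.resolvent_identity hl hm f
    have h2 := h.resolvent_identity hm hl f
    have h3 : (l - m) • (R l (R m f) - R m (R l f)) = 0 := by
      have : (l - m) • (R l (R m f) - R m (R l f)) =
        ((l - m) • R l (R m f) + R l f) - R m f + (((m - l) • R m (R l f) + R m f) - R l f) := by
        module
      rw [this, ← h1, ← h2]; simp
    exact sub_eq_zero.1 ((smul_eq_zero.1 h3).resolve_left (sub_ne_zero.2 hne))

theorem commute_yosida (h : IsContractiveResolvent G R) {l m : ℝ} (hl : 0 < l) (hm : 0 < m) :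
    Commute (yosida R l) (yosida R m) := by
  have h1 := h.commute_resolvent hl hm
  refine Commute.smul_left (Commute.smul_right ?_ _) _
  refine Commute.sub_left (Commute.sub_right ((h1.smul_left l).smul_right m) (Commute.one_right _))
    (Commute.one_left _)

theorem norm_resolvent_le (h : IsContractiveResolvent G R)
    {l : ℝ} (hl : 0 < l) (f : X) : ‖R l f‖ ≤ ‖f‖ / l := by
  have := h.norm_le l hl f
  rw [smul_apply, norm_smul, Real.norm_of_nonneg hl.le] at this
  rw [le_div_iff₀ hl]; linarith

/-- For `z` in the domain with image `y`, the error l R(l) z - z equals R(l) y, which is O(1/l).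
Density and ‖l R(l)‖ ≤ 1 extend this to all vectors. -/
theorem tendsto_smul_resolvent (h : IsContractiveResolvent G R)
    (x : X) : Tendsto (fun l => (l • R l) x) atTop (𝓝 x) := by
  rw [Metric.tendsto_atTop]
  intro ε hε
  obtain ⟨z, ⟨y, hy⟩, hz⟩ := h.dense.exists_dist_lt x (show 0 < ε / 3 by positivity)
  rw [dist_eq_norm] at hz
  refine ⟨max 1 (3 * (‖y‖ + 1) / ε), fun l hl => ?_⟩
  have hl1 : 0 < l := lt_of_lt_of_le one_pos ((le_max_left _ _).trans hl)
  have hl2 : 3 * (‖y‖ + 1) / ε ≤ l := (le_max_right _ _).trans hl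
  have e : (l • R l) z - z = R l y := by
    have := (h.mem_iff l hl1 z y).1 hy
    rw [map_sub, map_smul] at this
    nth_rewrite 2 [← this]
    simp
  have e2 : (l • R l) x - x = (l • R l) (x - z) + R l y + (z - x) := by
    rw [← e, map_sub]; abel
  have h1 := h.norm_le l hl1 (x - z)
  have h2 := h.norm_resolvent_le hl1 y
  have h3 : ‖y‖ / l < ε / 3 := by
    rw [div_le_iff₀ hε] at hl2
    rw [div_lt_iff₀ hl1]
    linarith
  rw [dist_eq_norm, e2]
  have h4 := norm_sub_rev z x
  calc _ ≤ ‖(l • R l) (x - z)‖ + ‖R l y‖ + ‖z - x‖ := norm_add₃_le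
    _ < ε := by linarith

/-- On the domain the approximation is l R(l) composed with the operator itself, so its convergence
reduces to the strong convergence of l R(l) to the identity. -/
theorem yosida_apply (h : IsContractiveResolvent G R)
    {l : ℝ} (hl : 0 < l) {x y : X} (hxy : (x, y) ∈ G) :
    yosida R l x = (l • R l) y := by
  have := (h.mem_iff l hl x y).1 hxy
  rw [map_sub, map_smul] at this
  have e : (l • R l) x - x = R l y := by
    nth_rewrite 2 [← this]; simp
  simp only [yosida, smul_apply, sub_apply,
    one_apply_eq_self] at *
  rw [e]

theorem tendsto_yosida (h : IsContractiveResolvent G R) {x y : X} (hxy : (x, y) ∈ G) :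
    Tendsto (fun l => yosida R l x) atTop (𝓝 y) := by
  refine (h.tendsto_smul_resolvent y).congr' ?_
  filter_upwards [eventually_gt_atTop 0] with l hl
  rw [h.yosida_apply hl hxy]

variable [CompleteSpace X]

theorem norm_exp_yosida_le (h : IsContractiveResolvent G R)
    {l : ℝ} (hl : 0 < l) (t : ℝ) (ht : 0 ≤ t) (x : X) :
    ‖NormedSpace.exp (t • yosida R l) x‖ ≤ ‖x‖ := by
  rw [yosida, smul_smul]
  exact norm_exp_smul_sub_one_apply_le (h.norm_le l hl) (by positivity) x

/-- The approximations commute and generate contractions, so on the domain the exponentials differ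
by at most t times the difference of the generators, which tends to zero. A three-term splitting
handles general vectors. -/
theorem cauchy_exp_yosida (h : IsContractiveResolvent G R) {t : ℝ} (ht : 0 ≤ t) (x : X) :
    ∃ y, Tendsto (fun l => NormedSpace.exp (t • yosida R l) x) atTop (𝓝 y) := by
  refine cauchy_map_iff_exists_tendsto.1 ?_
  rw [Metric.cauchy_iff]
  refine ⟨inferInstance, fun ε hε => ?_⟩
  obtain ⟨z, ⟨y, hy⟩, hz⟩ := h.dense.exists_dist_lt x (show 0 < ε / 3 by positivity)
  rw [dist_eq_norm] at hz
  have hδ : 0 < ε / (6 * (t + 1)) := by positivity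
  have hev := ((Metric.tendsto_nhds.1 (h.tendsto_yosida hy)) _ hδ).and (eventually_gt_atTop 0)
  refine ⟨_, image_mem_map hev, ?_⟩
  rintro _ ⟨l, ⟨hl, hl0⟩, rfl⟩ _ ⟨m, ⟨hm, hm0⟩, rfl⟩
  have h1 := norm_exp_smul_sub_exp_smul_le (h.commute_yosida hl0 hm0) (h.norm_exp_yosida_le hl0)
    (h.norm_exp_yosida_le hm0) ht z
  have h2 : ‖yosida R l z - yosida R m z‖ < ε / (3 * (t + 1)) := by
    rw [← dist_eq_norm]
    calc _ ≤ dist (yosida R l z) y + dist (yosida R m z) y := dist_triangle_right _ _ _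
      _ < ε / (6 * (t + 1)) + ε / (6 * (t + 1)) := add_lt_add hl hm
      _ = _ := by field_simp; norm_num
  have h3 : t * ‖yosida R l z - yosida R m z‖ ≤ ε / 3 := by
    calc _ ≤ (t + 1) * (ε / (3 * (t + 1))) := by gcongr; linarith
      _ = ε / 3 := by field_simp
  have h4 := h.norm_exp_yosida_le hl0 t ht (x - z)
  have h5 := h.norm_exp_yosida_le hm0 t ht (z - x)
  have h6 := norm_sub_rev z x
  rw [dist_eq_norm]
  have e : NormedSpace.exp (t • yosida R l) x - NormedSpace.exp (t • yosida R m) x =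
      NormedSpace.exp (t • yosida R l) (x - z) + (NormedSpace.exp (t • yosida R l) z -
        NormedSpace.exp (t • yosida R m) z) + NormedSpace.exp (t • yosida R m) (z - x) := by
    simp only [map_sub]; abel
  rw [e]
  calc _ ≤ _ := norm_add₃_le
    _ < ε := by linarith

/-- The **Hille–Yosida theorem** for contraction semigroups, together with the invariance of closed
convex sets under the semigroup. -/
theorem exists_semigroup (h : IsContractiveResolvent G R)
    : ∃ T : ℝ≥0 → X →L[ℝ] X, IsC0Semigroup T ∧ generatorGraph T = G ∧
    (∀ t x, ‖T t x‖ ≤ ‖x‖) ∧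
    ∀ C : Set X, Convex ℝ C → IsClosed C → (∀ l : ℝ, 0 < l → ∀ x ∈ C, (l • R l) x ∈ C) →
      ∀ t, ∀ x ∈ C, T t x ∈ C := by
  choose S hS using fun (t : ℝ≥0) => h.cauchy_exp_yosida t.2
  have hnorm : ∀ t x, ‖S t x‖ ≤ ‖x‖ := fun t x =>
    le_of_tendsto (hS t x).norm (by
      filter_upwards [eventually_gt_atTop 0] with l hl using h.norm_exp_yosida_le hl t t.2 x)
  let T : ℝ≥0 → X →L[ℝ] X := fun t => LinearMap.mkContinuous
    { toFun := S t
      map_add' := fun x y => tendsto_nhds_unique (hS t (x + y)) (by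
        simpa only [map_add] using (hS t x).add (hS t y))
      map_smul' := fun c x => tendsto_nhds_unique (hS t (c • x)) (by
        simpa only [map_smul, RingHom.id_apply] using (hS t x).const_smul c) } 1
    (fun x => by simpa using hnorm t x)
  have hT : ∀ (t : ℝ≥0) x, Tendsto (fun l => NormedSpace.exp ((t : ℝ) • yosida R l) x) atTop (𝓝 (T t x)) :=
    hS
  have hTn : ∀ t x, ‖T t x‖ ≤ ‖x‖ := hnorm
  -- The limit in `l` of the first-order expansion; it will give differentiability at zero once `z`
  -- is chosen close to `y`.
  have hbound : ∀ (t : ℝ≥0) {x y z w : X}, (x, y) ∈ G → (z, w) ∈ G →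
      ‖T t x - x - (t : ℝ) • y‖ ≤ t * (t * ‖w‖ + 2 * ‖y - z‖) := by
    intro t x y z w hxy hzw
    have h1 : Tendsto (fun l => (t : ℝ) * (t * ‖yosida R l z‖ + 2 * ‖y - z‖ +
        ‖yosida R l x - y‖)) atTop (𝓝 (t * (t * ‖w‖ + 2 * ‖y - z‖ + ‖y - y‖))) :=
      ((((h.tendsto_yosida hzw).norm.const_mul _).add_const _).add
        ((h.tendsto_yosida hxy).sub_const y).norm).const_mul _
    rw [sub_self, norm_zero, add_zero] at h1
    refine le_of_tendsto_of_tendsto (((hT t x).sub_const x).sub_const ((t : ℝ) • y)).norm h1 ?_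
    filter_upwards [eventually_gt_atTop 0] with l hl
    exact norm_exp_smul_sub_self_sub_le (h.norm_exp_yosida_le hl) t.2 x y z
  have hlip : ∀ (t : ℝ≥0) {x y : X}, (x, y) ∈ G → ‖T t x - x‖ ≤ t * ‖y‖ := by
    intro t x y hxy
    refine le_of_tendsto_of_tendsto ((hT t x).sub_const x).norm
      ((h.tendsto_yosida hxy).norm.const_mul (t : ℝ)) ?_
    filter_upwards [eventually_gt_atTop 0] with l hl
    exact norm_exp_smul_sub_self_le (h.norm_exp_yosida_le hl) t.2 x
  have hC0 : IsC0Semigroup T := by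
    refine ⟨?_, ?_, ?_⟩
    · ext x
      refine tendsto_nhds_unique (hT 0 x) ?_
      simp [NormedSpace.exp_zero]
    · intro s t
      ext x
      refine tendsto_nhds_unique (hT (s + t) x) ?_
      let _ : NormedAlgebra ℚ (X →L[ℝ] X) := NormedAlgebra.restrictScalars ℚ ℝ _
      -- The inner exponential is replaced by its limit first; the error vanishes because the outer
      -- exponentials are contractions for every `l` > 0.
      have e : ∀ l, NormedSpace.exp (((s + t : ℝ≥0) : ℝ) • yosida R l) x =
          NormedSpace.exp ((s : ℝ) • yosida R l) (NormedSpace.exp ((t : ℝ) • yosida R l) x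
            - T t x) + NormedSpace.exp ((s : ℝ) • yosida R l) (T t x) := by
        intro l
        rw [NNReal.coe_add, add_smul, NormedSpace.exp_add_of_commute
          (((Commute.refl _).smul_left _).smul_right _), map_sub]
        simp
      simp only [e]
      have h0 : Tendsto (fun l => NormedSpace.exp ((s : ℝ) • yosida R l)
          (NormedSpace.exp ((t : ℝ) • yosida R l) x - T t x)) atTop (𝓝 0) := by
        refine squeeze_zero_norm' ?_ (tendsto_iff_norm_sub_tendsto_zero.1 (hT t x))
        filter_upwards [eventually_gt_atTop 0] with l hl
        exact h.norm_exp_yosida_le hl s s.2 _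
      simpa using h0.add (hT s (T t x))
    · intro x
      rw [Metric.tendsto_nhds]
      intro ε hε
      obtain ⟨z, ⟨y, hy⟩, hz⟩ := h.dense.exists_dist_lt x (show 0 < ε / 3 by positivity)
      rw [dist_eq_norm] at hz
      have h1 : Tendsto (fun t : ℝ≥0 => (t : ℝ) * ‖y‖) (𝓝 0) (𝓝 0) := by
        have : Continuous (fun t : ℝ≥0 => (t : ℝ) * ‖y‖) := by fun_prop
        simpa using this.tendsto 0
      filter_upwards [h1.eventually (gt_mem_nhds (show 0 < ε / 3 by positivity))] with t ht
      rw [dist_eq_norm]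
      have e : T t x - x = T t (x - z) + (T t z - z) + (z - x) := by simp only [map_sub]; abel
      have h2 := hTn t (x - z)
      have h3 := hlip t hy
      have h4 := norm_sub_rev z x
      rw [e]
      calc _ ≤ _ := norm_add₃_le
        _ < ε := by linarith
  have hsub : ∀ x y, (x, y) ∈ G → (x, y) ∈ generatorGraph T := by
    intro x y hxy
    change Tendsto _ _ _
    rw [Metric.tendsto_nhds]
    intro ε hε
    obtain ⟨z, ⟨w, hw⟩, hz⟩ := h.dense.exists_dist_lt y (show 0 < ε / 4 by positivity)
    rw [dist_eq_norm] at hz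
    have h1 : Tendsto (fun t : ℝ≥0 => (t : ℝ) * ‖w‖) (𝓝[>] 0) (𝓝 0) := by
      have : Continuous (fun t : ℝ≥0 => (t : ℝ) * ‖w‖) := by fun_prop
      have h0 := this.tendsto 0
      simp only [NNReal.coe_zero, zero_mul] at h0
      exact h0.mono_left nhdsWithin_le_nhds
    filter_upwards [h1.eventually (gt_mem_nhds (show 0 < ε / 2 by positivity)),
      self_mem_nhdsWithin] with t ht ht0
    have ht1 : (0 : ℝ) < t := NNReal.coe_pos.2 ht0
    have e : (t : ℝ)⁻¹ • (T t x - x) - y = (t : ℝ)⁻¹ • (T t x - x - (t : ℝ) • y) := by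
      rw [smul_sub _ (T t x - x), inv_smul_smul₀ ht1.ne']
    rw [dist_eq_norm, e, norm_smul, norm_inv, Real.norm_of_nonneg ht1.le]
    calc _ ≤ (t : ℝ)⁻¹ * (t * (t * ‖w‖ + 2 * ‖y - z‖)) := by gcongr; exact hbound t hxy hw
      _ = t * ‖w‖ + 2 * ‖y - z‖ := by field_simp
      _ < ε := by linarith
  refine ⟨T, hC0, ?_, hTn, ?_⟩
  · refine Set.Subset.antisymm ?_ fun q hq => hsub q.1 q.2 hq
    rintro ⟨x, y⟩ hxy
    -- For the reverse inclusion, solve x' - G x' = x - y inside the domain of G. Then w = x - x'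
    -- has generator value `w`, that is, T t w would grow like e^t w, which a contraction semigroup
    -- allows only for w = 0.
    have hx' := h.resolvent_mem one_pos (x - y)
    set x' := R 1 (x - y)
    have hgen := hsub _ _ hx'
    have hw : Tendsto (fun t : ℝ≥0 => (t : ℝ)⁻¹ • (T t (x - x') - (x - x'))) (𝓝[>] 0)
        (𝓝 (x - x')) := by
      have := Tendsto.sub (show Tendsto _ _ _ from hxy) (show Tendsto _ _ _ from hgen)
      simp only [one_smul] at this
      rw [show y - (x' - (x - y)) = x - x' by abel] at this
      refine this.congr fun t => ?_
      rw [← smul_sub, map_sub]; congr 1; abel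
    have hzero : x - x' = 0 := by
      generalize x - x' = w at hw
      by_contra hne
      have hpos : 0 < ‖w‖ := norm_pos_iff.2 hne
      have hev := (Metric.tendsto_nhds.1 hw ‖w‖ hpos).and self_mem_nhdsWithin
      obtain ⟨t, ht, ht0⟩ := hev.exists
      have ht1 : (0 : ℝ) < t := NNReal.coe_pos.2 ht0
      rw [dist_eq_norm] at ht
      -- Up to an error smaller than t‖w‖ this says T t w = (1 + t) w, against ‖T t w‖ ≤ ‖w‖.
      have e : (1 + (t : ℝ)) • w = T t w - (t : ℝ) • ((t : ℝ)⁻¹ • (T t w - w) - w) := by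
        rw [smul_sub (t : ℝ), smul_inv_smul₀ ht1.ne']; module
      have h1 : ‖(1 + (t : ℝ)) • w‖ ≤ ‖T t w‖ + t * ‖(t : ℝ)⁻¹ • (T t w - w) - w‖ := by
        rw [e]; refine (norm_sub_le _ _).trans ?_
        rw [norm_smul, Real.norm_of_nonneg ht1.le]
      rw [norm_smul, Real.norm_of_nonneg (by positivity)] at h1
      have h2 := hTn t w
      have h3 := mul_lt_mul_of_pos_left ht ht1
      linarith
    have hxx : x' = x := (sub_eq_zero.1 hzero).symm
    rw [hxx] at hx'
    simpa using hx'
  · intro C hC hcl hinv t x hx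
    refine hcl.mem_of_tendsto (hT t x) ?_
    filter_upwards [eventually_gt_atTop 0] with l hl
    rw [yosida, smul_smul]
    exact exp_smul_sub_one_mem hC hcl (hinv l hl) (by positivity) hx

end IsContractiveResolvent

end Generation

/-! ### General C₀-semigroups: continuity, uniqueness, rescaling -/

section Semigroups

variable {X : Type*} [NormedAddCommGroup X] [NormedSpace ℝ X]

namespace IsC0Semigroup

variable {T : ℝ≥0 → X →L[ℝ] X}

/-- Otherwise there are times τ_n → 0 with unbounded operator norms, although T(τ_n) x converges for
every x; the uniform boundedness principle forbids this. -/
theorem exists_norm_le_near_zero (hT : IsC0Semigroup T) [CompleteSpace X] :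
    ∃ δ : ℝ≥0, 0 < δ ∧ ∃ M : ℝ, ∀ t ≤ δ, ‖T t‖ ≤ M := by
  by_contra! hcon
  have hpos : ∀ n : ℕ, (0 : ℝ≥0) < 1 / ((n : ℝ≥0) + 1) := fun n => by positivity
  choose τ hτ1 hτ2 using fun n : ℕ => hcon (1 / ((n : ℝ≥0) + 1)) (hpos n) n
  have hτ : Tendsto τ atTop (𝓝 0) :=
    tendsto_of_tendsto_of_tendsto_of_le_of_le tendsto_const_nhds
      tendsto_one_div_add_atTop_nhds_zero_nat (fun _ => zero_le) hτ1
  obtain ⟨C, hC⟩ := banach_steinhaus (g := fun n => T (τ n)) (fun x => by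
    obtain ⟨C, hC⟩ := ((hT.tendsto_zero x).comp hτ).norm.bddAbove_range
    exact ⟨C, fun i => hC ⟨i, rfl⟩⟩)
  obtain ⟨n, hn⟩ := exists_nat_gt C
  exact absurd (hC n) (not_le.2 (hn.trans (hτ2 n)))

theorem exists_norm_le (hT : IsC0Semigroup T)
    [CompleteSpace X] (t₀ : ℝ≥0) : ∃ M : ℝ, 0 ≤ M ∧ ∀ t ≤ t₀, ‖T t‖ ≤ M := by
  obtain ⟨δ, hδ, M, hM⟩ := hT.exists_norm_le_near_zero
  have hM0 : 0 ≤ M := (norm_nonneg _).trans (hM 0 zero_le)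
  have key : ∀ n : ℕ, ∃ C : ℝ, 0 ≤ C ∧ ∀ t ≤ (n : ℝ≥0) * δ, ‖T t‖ ≤ C := by
    intro n
    induction n with
    | zero => exact ⟨M, hM0, fun t ht => hM t (ht.trans (by simp))⟩
    | succ n ih =>
      obtain ⟨C, hC0, hC⟩ := ih
      refine ⟨max C (M * C), le_max_of_le_left hC0, fun t ht => ?_⟩
      rcases le_total t ((n : ℝ≥0) * δ) with h | h
      · exact (hC t h).trans (le_max_left _ _)
      · have e : t = (t - n * δ) + n * δ := (tsub_add_cancel_of_le h).symm
        rw [e, hT.map_add]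
        refine (ContinuousLinearMap.opNorm_comp_le _ _).trans ((mul_le_mul (hM _ ?_) (hC _ le_rfl)
          (norm_nonneg _) hM0).trans (le_max_right _ _))
        rw [tsub_le_iff_right]
        refine ht.trans (le_of_eq ?_)
        push_cast; ring
  obtain ⟨n, hn⟩ := exists_nat_gt (t₀ / δ)
  obtain ⟨C, hC0, hC⟩ := key n
  exact ⟨C, hC0, fun t ht => hC t (ht.trans ((div_le_iff₀ hδ).1 hn.le))⟩

theorem continuous_apply (hT : IsC0Semigroup T)
    [CompleteSpace X] (x : X) : Continuous fun t => T t x := by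
  rw [continuous_iff_continuousAt]
  intro t₀
  obtain ⟨M, hM0, hM⟩ := hT.exists_norm_le (t₀ + 1)
  have hle : ∀ s t : ℝ≥0, s ≤ t → s ≤ t₀ + 1 → ‖T t x - T s x‖ ≤ M * ‖T (t - s) x - x‖ := by
    intro s t hst hs
    have e : T t x - T s x = T s (T (t - s) x - x) := by
      rw [map_sub, ← ContinuousLinearMap.comp_apply, ← hT.map_add, add_tsub_cancel_of_le hst]
    rw [e]
    exact (T s).le_of_opNorm_le (hM s hs) _
  -- Using the distance |t - t₀| as the time increment treats left and right continuity by one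
  -- estimate.
  have h1 : Tendsto (fun t : ℝ≥0 => M * ‖T (nndist t t₀) x - x‖) (𝓝 t₀) (𝓝 0) := by
    have h2 : Tendsto (fun t : ℝ≥0 => nndist t t₀) (𝓝 t₀) (𝓝 0) := by
      have : Continuous fun t : ℝ≥0 => nndist t t₀ := by fun_prop
      simpa using this.tendsto t₀
    have := (((hT.tendsto_zero x).comp h2).sub_const x).norm.const_mul M
    simpa using this
  rw [ContinuousAt, tendsto_iff_norm_sub_tendsto_zero]
  refine squeeze_zero' (Eventually.of_forall fun _ => norm_nonneg _) ?_ h1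
  filter_upwards [gt_mem_nhds (show t₀ < t₀ + 1 by simp)] with t ht
  rcases le_total t t₀ with h | h
  · have e : nndist t t₀ = t₀ - t := by
      rw [NNReal.nndist_eq, tsub_eq_zero_of_le h]; simp
    rw [e, norm_sub_rev]
    exact hle t t₀ h ht.le
  · have e : nndist t t₀ = t - t₀ := by
      rw [NNReal.nndist_eq, tsub_eq_zero_of_le h]; simp
    rw [e]
    exact hle t₀ t h (by simp)

theorem continuous_uncurry (hT : IsC0Semigroup T)
    [CompleteSpace X] : Continuous fun p : ℝ≥0 × X => T p.1 p.2 := by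
  rw [continuous_iff_continuousAt]
  rintro ⟨t₀, x₀⟩
  obtain ⟨M, hM0, hM⟩ := hT.exists_norm_le (t₀ + 1)
  have h1 : Tendsto (fun p : ℝ≥0 × X => M * ‖p.2 - x₀‖ + ‖T p.1 x₀ - T t₀ x₀‖) (𝓝 (t₀, x₀))
      (𝓝 0) := by
    have : Continuous fun p : ℝ≥0 × X => M * ‖p.2 - x₀‖ + ‖T p.1 x₀ - T t₀ x₀‖ := by
      have : Continuous fun p : ℝ≥0 × X => T p.1 x₀ :=
        (hT.continuous_apply x₀).comp continuous_fst
      exact (continuous_const.mul (continuous_snd.sub continuous_const).norm).add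
        (this.sub continuous_const).norm
    simpa using this.tendsto (t₀, x₀)
  rw [ContinuousAt, tendsto_iff_norm_sub_tendsto_zero]
  refine squeeze_zero' (Eventually.of_forall fun _ => norm_nonneg _) ?_ h1
  have hev : ∀ᶠ p : ℝ≥0 × X in 𝓝 (t₀, x₀), p.1 < t₀ + 1 :=
    continuous_fst.continuousAt.eventually (gt_mem_nhds (show t₀ < t₀ + 1 by simp))
  filter_upwards [hev] with p hp
  have e : T p.1 p.2 - T t₀ x₀ = T p.1 (p.2 - x₀) + (T p.1 x₀ - T t₀ x₀) := by
    rw [map_sub]; abel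
  rw [e]
  refine (norm_add_le _ _).trans (add_le_add ?_ le_rfl)
  exact (T p.1).le_of_opNorm_le (hM p.1 hp.le) _

theorem apply_mem_generatorGraph (hT : IsC0Semigroup T)
    {x y : X} (hxy : (x, y) ∈ generatorGraph T) (s : ℝ≥0) :
    (T s x, T s y) ∈ generatorGraph T := by
  have := ((T s).continuous.tendsto y).comp (show Tendsto _ _ _ from hxy)
  refine Tendsto.congr (fun t => ?_) this
  simp only [Function.comp_apply, map_smul, map_sub]
  rw [← ContinuousLinearMap.comp_apply, ← ContinuousLinearMap.comp_apply, ← hT.map_add,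
    ← hT.map_add, add_comm]

end IsC0Semigroup

/-- A strongly continuous semigroup is determined by its generator. -/
theorem IsC0Semigroup.eq_of_generatorGraph_eq [CompleteSpace X] {S T : ℝ≥0 → X →L[ℝ] X}
    (hS : IsC0Semigroup S) (hT : IsC0Semigroup T) (hgen : generatorGraph S = generatorGraph T)
    (hd : Dense {x | ∃ y, (x, y) ∈ generatorGraph S}) : S = T := by
  funext t
  refine ContinuousLinearMap.coeFn_injective (Continuous.ext_on hd (S t).continuous (T t).continuous ?_)
  rintro x ⟨y, hxy⟩
  -- This path runs from T(t) x at s = 0 to S(t) x at s = t; it is constant because its right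
  -- derivative vanishes.
  let φ : ℝ → X := fun s => T (t - s.toNNReal) (S s.toNNReal x)
  obtain ⟨M, hM0, hM⟩ := hT.exists_norm_le t
  have hcont : ContinuousOn φ (Set.Icc 0 t) := by
    refine Continuous.continuousOn ?_
    have h1 : Continuous fun s : ℝ => S s.toNNReal x :=
      (hS.continuous_apply x).comp continuous_real_toNNReal
    have h2 : Continuous fun s : ℝ => t - s.toNNReal := by fun_prop
    exact hT.continuous_uncurry.comp (h2.prodMk h1)
  have hder : ∀ s ∈ Set.Ico (0 : ℝ) t, HasDerivWithinAt φ 0 (Set.Ici s) s := by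
    intro s hs
    rw [← hasDerivWithinAt_Ioi_iff_Ici, hasDerivWithinAt_iff_tendsto_slope' (by simp)]
    set w := S s.toNNReal x with hw
    have hwS : (w, S s.toNNReal y) ∈ generatorGraph S := hS.apply_mem_generatorGraph hxy _
    have hwT : (w, S s.toNNReal y) ∈ generatorGraph T := hgen ▸ hwS
    -- The slope of φ between s and r is T(t - r) applied to the difference of the quotients of S
    -- and T at `w`. Both quotients have the same limit, and T(t - r) is uniformly bounded.
    have hdiff : Tendsto (fun k : ℝ≥0 => M * ‖(k : ℝ)⁻¹ • (S k w - w) - (k : ℝ)⁻¹ • (T k w - w)‖)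
        (𝓝[>] 0) (𝓝 0) := by
      have := (Tendsto.sub (show Tendsto _ _ _ from hwS)
        (show Tendsto _ _ _ from hwT)).norm.const_mul M
      simpa using this
    have hk : Tendsto (fun r : ℝ => (r - s).toNNReal) (𝓝[>] s) (𝓝[>] 0) := by
      refine tendsto_nhdsWithin_iff.2 ⟨?_, ?_⟩
      · have : Continuous fun r : ℝ => (r - s).toNNReal := by fun_prop
        have h0 := this.tendsto s
        simp only [sub_self, Real.toNNReal_zero] at h0
        exact h0.mono_left nhdsWithin_le_nhds
      · filter_upwards [self_mem_nhdsWithin] with r hr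
        exact Real.toNNReal_pos.2 (sub_pos.2 hr)
    refine squeeze_zero_norm' ?_ (hdiff.comp hk)
    filter_upwards [Ioo_mem_nhdsGT hs.2] with r hr
    have hr0 : 0 ≤ r := hs.1.trans hr.1.le
    have hrs : 0 ≤ r - s := sub_nonneg.2 hr.1.le
    have hrt : r.toNNReal ≤ t := Real.toNNReal_le_iff_le_coe.2 hr.2.le
    have hst : s.toNNReal ≤ t := Real.toNNReal_le_iff_le_coe.2 hs.2.le
    have er : r.toNNReal = (r - s).toNNReal + s.toNNReal := by
      rw [← Real.toNNReal_add hrs hs.1]; congr 1; ring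
    have e1 : φ r = T (t - r.toNNReal) (S (r - s).toNNReal w) := by
      simp only [φ]
      rw [hw, ← ContinuousLinearMap.comp_apply (S _) (S _), ← hS.map_add, ← er]
    have e2 : φ s = T (t - r.toNNReal) (T (r - s).toNNReal w) := by
      simp only [φ]
      rw [← ContinuousLinearMap.comp_apply (T _) (T _), ← hT.map_add]
      congr 2
      apply NNReal.coe_injective
      rw [NNReal.coe_add, NNReal.coe_sub hrt, NNReal.coe_sub hst, Real.coe_toNNReal _ hr0,
        Real.coe_toNNReal _ hs.1, Real.coe_toNNReal _ hrs]
      ring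
    rw [slope, vsub_eq_sub, e1, e2, ← map_sub, ← map_smul]
    refine ((T _).le_of_opNorm_le (hM _ tsub_le_self) _).trans (le_of_eq ?_)
    simp only [Function.comp_apply]
    rw [← smul_sub, sub_sub_sub_cancel_right, Real.coe_toNNReal _ hrs]
  have := constant_of_has_deriv_right_zero hcont hder t ⟨t.2, le_rfl⟩
  simp only [φ] at this
  simpa [hT.map_zero, hS.map_zero] using this

/-- The rescaled semigroup `e^{ωt} T(t)`. -/
def rescale (ω : ℝ) (T : ℝ≥0 → X →L[ℝ] X) (t : ℝ≥0) : X →L[ℝ] X := Real.exp (ω * t) • T t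

theorem rescale_neg_rescale (ω : ℝ) (T : ℝ≥0 → X →L[ℝ] X) : rescale (-ω) (rescale ω T) = T := by
  funext t
  simp only [rescale, smul_smul, ← Real.exp_add]
  rw [show -ω * t + ω * t = 0 by ring, Real.exp_zero, one_smul]

theorem IsC0Semigroup.rescale {T : ℝ≥0 → X →L[ℝ] X} (hT : IsC0Semigroup T) (ω : ℝ) :
    IsC0Semigroup (rescale ω T) := by
  refine ⟨?_, ?_, ?_⟩
  · simp [WentzellRobin.rescale, hT.map_zero]
  · intro s t
    ext x
    simp only [WentzellRobin.rescale, hT.map_add, NNReal.coe_add, mul_add, Real.exp_add]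
    simp [mul_smul, smul_comm (Real.exp (ω * s))]
  · intro x
    have h1 : Tendsto (fun t : ℝ≥0 => Real.exp (ω * t)) (𝓝 0) (𝓝 1) := by
      have : Continuous fun t : ℝ≥0 => Real.exp (ω * t) := by fun_prop
      simpa using this.tendsto 0
    have h2 := h1.smul (hT.tendsto_zero x)
    rwa [one_smul] at h2

theorem mem_generatorGraph_rescale_of_mem {T : ℝ≥0 → X →L[ℝ] X} (ω : ℝ) {x y : X}
    (hxy : (x, y) ∈ generatorGraph T) : (x, y + ω • x) ∈ generatorGraph (rescale ω T) := by
  have h1 : Tendsto (fun t : ℝ≥0 => Real.exp (ω * t)) (𝓝[>] 0) (𝓝 1) := by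
    have : Continuous fun t : ℝ≥0 => Real.exp (ω * t) := by fun_prop
    have h0 := this.tendsto 0
    simp only [NNReal.coe_zero, mul_zero, Real.exp_zero] at h0
    exact h0.mono_left nhdsWithin_le_nhds
  have h2 : Tendsto (fun t : ℝ≥0 => (t : ℝ)⁻¹ * (Real.exp (ω * t) - 1)) (𝓝[>] 0) (𝓝 ω) := by
    have hd : HasDerivAt (fun t : ℝ => Real.exp (ω * t)) ω 0 := by
      have := ((hasDerivAt_id (0 : ℝ)).const_mul ω).exp
      simpa using this
    have h3 := hd.tendsto_slope_zero_right
    have h4 : Tendsto (fun t : ℝ≥0 => (t : ℝ)) (𝓝[>] 0) (𝓝[>] 0) := by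
      refine tendsto_nhdsWithin_iff.2 ⟨?_, ?_⟩
      · have h0 := NNReal.continuous_coe.tendsto 0
        simp only [NNReal.coe_zero] at h0
        exact h0.mono_left nhdsWithin_le_nhds
      · filter_upwards [self_mem_nhdsWithin] with r hr
        exact NNReal.coe_pos.2 hr
    have h5 := h3.comp h4
    simp only [zero_add, mul_zero, Real.exp_zero] at h5
    exact h5
  have h3 := (h1.smul (show Tendsto _ _ _ from hxy)).add (h2.smul_const x)
  rw [one_smul] at h3
  refine Tendsto.congr (fun t => ?_) h3
  simp only [rescale, smul_apply]
  module

theorem mem_generatorGraph_rescale {T : ℝ≥0 → X →L[ℝ] X} (ω : ℝ) {x y : X} :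
    (x, y) ∈ generatorGraph (rescale ω T) ↔ (x, y - ω • x) ∈ generatorGraph T := by
  constructor
  · intro h
    have := mem_generatorGraph_rescale_of_mem (-ω) h
    rw [rescale_neg_rescale] at this
    convert! this using 2
    module
  · intro h
    simpa using mem_generatorGraph_rescale_of_mem ω h

end Semigroups

/-! ### Elliptic forms and their resolvents -/

section Forms

variable {V K : Type*} [NormedAddCommGroup V] [InnerProductSpace ℝ V] [CompleteSpace V]
  [NormedAddCommGroup K] [InnerProductSpace ℝ K] [CompleteSpace K]

/-- The resolvent of the operator associated with a bounded elliptic form. -/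
theorem exists_resolvent_of_elliptic (j : V →L[ℝ] K) (hj : DenseRange j)
    (B : V →L[ℝ] V →L[ℝ] ℝ) {ω α : ℝ} (hα : 0 < α)
    (hB : ∀ v, α * ‖v‖ ^ 2 ≤ B v v + ω * ‖j v‖ ^ 2) :
    ∃ R : ℝ → K →L[ℝ] K, IsContractiveResolvent
      {q : K × K | ∃ v, j v = q.1 ∧ ∀ w, B v w + ω * inner ℝ q.1 (j w) = -inner ℝ q.2 (j w)} R ∧
      ∀ l : ℝ, 0 < l → ∀ f, ∃ v, j v = R l f ∧
        ∀ w, B v w + (ω + l) * inner ℝ (j v) (j w) = inner ℝ f (j w) := by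
  -- The shift by ω + l makes the form coercive. Lax–Milgram then solves the resolvent equation
  -- uniquely in `V`, which is why injectivity of `j` is not required.
  let Bl : ℝ → V →L[ℝ] V →L[ℝ] ℝ := fun l =>
    B + (ω + l) • ((isBoundedBilinearMap_inner (𝕜 := ℝ) (E := K)).toContinuousLinearMap.bilinearComp j j)
  have hBl : ∀ l v w, Bl l v w = B v w + (ω + l) * inner ℝ (j v) (j w) := by
    intro l v w; simp [Bl]
  have hco : ∀ l, 0 < l → IsCoercive (Bl l) := by
    intro l hl
    refine ⟨α, hα, fun v => ?_⟩
    rw [hBl, real_inner_self_eq_norm_sq]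
    have := hB v
    have h2 : 0 ≤ l * ‖j v‖ ^ 2 := by positivity
    nlinarith
  have hex : ∀ l, 0 < l → ∃ S : K →L[ℝ] V, (∀ f w, Bl l (S f) w = inner ℝ f (j w)) ∧
      ∀ f v, (∀ w, Bl l v w = inner ℝ f (j w)) → S f = v := by
    intro l hl
    let e := (hco l hl).continuousLinearEquivOfBilin
    refine ⟨(e.symm : V →L[ℝ] V).comp (ContinuousLinearMap.adjoint j : K →L[ℝ] V), fun f w => ?_, fun f v h => ?_⟩
    · rw [← (hco l hl).continuousLinearEquivOfBilin_apply]
      change inner ℝ (e (e.symm _)) w = _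
      rw [e.apply_symm_apply]
      exact ContinuousLinearMap.adjoint_inner_left j w f
    · have h1 := (hco l hl).unique_continuousLinearEquivOfBilin
        (v := v) (f := ContinuousLinearMap.adjoint j f) (fun w => by
          rw [h w, ContinuousLinearMap.adjoint_inner_left])
      change e.symm (ContinuousLinearMap.adjoint j f) = v
      rw [h1]
      exact e.symm_apply_apply v
  classical
  choose S hS1 hS2 using hex
  let R : ℝ → K →L[ℝ] K := fun l => if hl : 0 < l then j.comp (S l hl) else 0
  have hR : ∀ l (hl : 0 < l) f, R l f = j (S l hl f) := by
    intro l hl f; simp [R, hl]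
  have hmem : ∀ l : ℝ, 0 < l → ∀ x y : K, (∃ v, j v = x ∧
      ∀ w, B v w + ω * inner ℝ x (j w) = -inner ℝ y (j w)) ↔ R l (l • x - y) = x := by
    intro l hl x y
    rw [hR l hl]
    constructor
    · rintro ⟨v, rfl, hv⟩
      rw [hS2 l hl _ v]
      intro w
      rw [hBl, inner_sub_left, inner_smul_left]
      simp only [conj_trivial]
      linarith [hv w]
    · intro hx
      refine ⟨_, hx, fun w => ?_⟩
      have := hS1 l hl (l • x - y) w
      rw [hBl, inner_sub_left, inner_smul_left, hx] at this
      simp only [conj_trivial] at this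
      linarith
  refine ⟨R, ⟨hmem, ?_, ?_⟩, ?_⟩
  -- Testing with the solution itself and discarding the nonnegative coercive part gives l‖j v‖² ≤
  -- ‖f‖‖j v‖.
  · intro l hl f
    rw [smul_apply, hR l hl, norm_smul, Real.norm_of_nonneg hl.le]
    set v := S l hl f
    have h1 := hS1 l hl f v
    rw [hBl, real_inner_self_eq_norm_sq] at h1
    have h2 := hB v
    have h3 := real_inner_le_norm f (j v)
    have h4 : 0 ≤ α * ‖v‖ ^ 2 := by positivity
    rcases (norm_nonneg (j v)).eq_or_lt with h0 | h0
    · rw [← h0]; simp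
    · refine le_of_mul_le_mul_right ?_ h0
      nlinarith
  · have hsub : Set.range (R 1) ⊆ {x | ∃ y, (x, y) ∈ {q : K × K | ∃ v, j v = q.1 ∧
        ∀ w, B v w + ω * inner ℝ q.1 (j w) = -inner ℝ q.2 (j w)}} := by
      rintro _ ⟨f, rfl⟩
      refine ⟨R 1 f - f, (hmem 1 one_pos _ _).2 ?_⟩
      simp
    refine Dense.mono hsub ?_
    have : DenseRange (R 1) := by
      -- If `h` is orthogonal to the range, testing its own resolvent equation and coercivity make
      -- the solution vanish; then `h` is orthogonal to the dense range of `j`.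
      have h1 : (R 1 : K →ₗ[ℝ] K).range.topologicalClosure = ⊤ := by
        rw [Submodule.topologicalClosure_eq_top_iff, Submodule.eq_bot_iff]
        intro h hh
        rw [Submodule.mem_orthogonal] at hh
        have h2 : inner ℝ (R 1 h) h = 0 := hh _ ⟨h, rfl⟩
        rw [hR 1 one_pos, real_inner_comm, ← hS1 1 one_pos, hBl, real_inner_self_eq_norm_sq] at h2
        have h3 := hB (S 1 one_pos h)
        have h4 : S 1 one_pos h = 0 := by
          rw [← norm_eq_zero]
          have : 0 ≤ ‖j (S 1 one_pos h)‖ ^ 2 := by positivity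
          have h5 : α * ‖S 1 one_pos h‖ ^ 2 ≤ 0 := by nlinarith
          by_contra hne
          have : 0 < α * ‖S 1 one_pos h‖ ^ 2 := by positivity
          linarith
        have h5 : ∀ w, inner ℝ h (j w) = 0 := by
          intro w
          rw [← hS1 1 one_pos, h4]; simp
        refine hj.induction_on (p := fun k => inner ℝ h k = 0) h
          (isClosed_eq (by fun_prop) continuous_const) h5 |> fun h6 => ?_
        exact inner_self_eq_zero.1 h6
      rw [DenseRange, dense_iff_closure_eq]
      have := congrArg (fun s : Submodule ℝ K => (s : Set K)) h1
      simp only [Submodule.topologicalClosure_coe, Submodule.top_coe] at this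
      exact this
    exact this
  · intro l hl f
    refine ⟨S l hl f, (hR l hl f).symm, fun w => ?_⟩
    rw [← hBl, hS1]

end Forms

/-! ### Boundary charts: volume, surface measure and thin layers -/

section Charts

variable {N : ℕ}

/-- A boundary chart of `Ω` at `z`: `Ω` is near `z` the strict epigraph of `ψ`. -/
structure IsLipschitzChart (Ω : Set (E N)) (z : E N) (O : E N ≃ₗᵢ[ℝ] WithLp 2 (E (N - 1) × ℝ))
    (r : ℝ) (ψ : E (N - 1) → ℝ) (K : ℝ≥0) : Prop where
  pos : 0 < r
  lipschitz : LipschitzWith K ψ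
  map_zero : ψ 0 = 0
  mem_iff : ∀ (y : E (N - 1)) (s : ℝ), ‖y‖ < r → |s| < r →
    (z + O.symm (WithLp.toLp 2 (y, ψ y + s)) ∈ Ω ↔ 0 < s)

/-- The parametrization of a neighbourhood of `z` by the height above the graph of `ψ`. -/
def chartMap (z : E N) (O : E N ≃ₗᵢ[ℝ] WithLp 2 (E (N - 1) × ℝ)) (ψ : E (N - 1) → ℝ)
    (p : E (N - 1) × ℝ) : E N :=
  z + O.symm (WithLp.toLp 2 (p.1, ψ p.1 + p.2))

/-- The horizontal coordinate. -/
def chartHor (z : E N) (O : E N ≃ₗᵢ[ℝ] WithLp 2 (E (N - 1) × ℝ)) (x : E N) : E (N - 1) :=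
  (O (x - z)).fst

/-- The height above the graph of `ψ`. -/
def chartHeight (z : E N) (O : E N ≃ₗᵢ[ℝ] WithLp 2 (E (N - 1) × ℝ)) (ψ : E (N - 1) → ℝ)
    (x : E N) : ℝ :=
  (O (x - z)).snd - ψ (chartHor z O x)

variable (z : E N) (O : E N ≃ₗᵢ[ℝ] WithLp 2 (E (N - 1) × ℝ)) (ψ : E (N - 1) → ℝ)

theorem chartMap_hor_height (x : E N) :
    chartMap z O ψ (chartHor z O x, chartHeight z O ψ x) = x := by
  simp only [chartMap, chartHeight, add_sub_cancel]
  have : WithLp.toLp 2 (chartHor z O x, (O (x - z)).snd) = O (x - z) := rfl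
  rw [this]; simp

theorem chartHor_chartMap (p : E (N - 1) × ℝ) : chartHor z O (chartMap z O ψ p) = p.1 := by
  simp [chartHor, chartMap]

theorem chartHeight_chartMap (p : E (N - 1) × ℝ) : chartHeight z O ψ (chartMap z O ψ p) = p.2 := by
  rw [chartHeight, chartHor_chartMap]; simp [chartMap]

theorem chartHor_lipschitz : LipschitzWith 1 (chartHor z O) := by
  refine LipschitzWith.of_dist_le_mul fun x y => ?_
  have h := WithLp.norm_fst_le (p := 2) _ (O (x - z) - O (y - z))
  rw [← map_sub, LinearIsometryEquiv.norm_map] at h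
  simp only [NNReal.coe_one, one_mul, dist_eq_norm, chartHor]
  rw [← WithLp.sub_fst, ← map_sub]
  simpa using h

theorem chartHeight_lipschitz {ψ : E (N - 1) → ℝ} {K : ℝ≥0} (hψ : LipschitzWith K ψ) :
    LipschitzWith (1 + K) (chartHeight z O ψ) := by
  have h1 : LipschitzWith 1 (fun x => (O (x - z)).snd) := by
    refine LipschitzWith.of_dist_le_mul fun x y => ?_
    have h := WithLp.norm_snd_le (p := 2) _ (O (x - z) - O (y - z))
    rw [← map_sub, LinearIsometryEquiv.norm_map] at h
    simp only [NNReal.coe_one, one_mul, dist_eq_norm]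
    rw [← WithLp.sub_snd, ← map_sub]
    simpa using h
  have h2 := hψ.comp (chartHor_lipschitz z O)
  rw [mul_one] at h2
  exact h1.sub h2

theorem chartMap_lipschitz {ψ : E (N - 1) → ℝ} {K : ℝ≥0} (hψ : LipschitzWith K ψ) :
    LipschitzWith (1 + K) (fun y => chartMap z O ψ (y, 0)) := by
  refine LipschitzWith.of_dist_le_mul fun x y => ?_
  simp only [chartMap, add_zero, dist_add_left]
  rw [LinearIsometryEquiv.dist_map, dist_eq_norm, ← WithLp.toLp_sub]
  have e : WithLp.toLp 2 ((x, ψ x) - (y, ψ y)) =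
      WithLp.toLp 2 ((x - y, 0) : E (N - 1) × ℝ) + WithLp.toLp 2 (0, ψ x - ψ y) := by
    rw [← WithLp.toLp_add]; simp
  rw [e]
  refine (norm_add_le _ _).trans ?_
  rw [WithLp.norm_toLp_fst, WithLp.norm_toLp_snd, NNReal.coe_add, NNReal.coe_one, add_mul, one_mul,
    dist_eq_norm]
  gcongr
  rw [← dist_eq_norm, ← dist_eq_norm]
  exact hψ.dist_le_mul x y

theorem continuous_chartMap {ψ : E (N - 1) → ℝ} (hψ : Continuous ψ) :
    Continuous (chartMap z O ψ) := by
  unfold chartMap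
  refine continuous_const.add (O.symm.continuous.comp ?_)
  exact (WithLp.prod_continuous_toLp 2 _ _).comp (by fun_prop)

/-- On each vertical line the map is a translation, so Fubini suffices and no derivative of ψ is
used; the rest is an isometry and a translation. -/
theorem measurePreserving_chartMap {ψ : E (N - 1) → ℝ} (hψ : Continuous ψ) :
    MeasurePreserving (chartMap z O ψ) (volume.prod volume) volume := by
  have h1 : MeasurePreserving (fun p : E (N - 1) × ℝ => (p.1, ψ p.1 + p.2))
      (volume.prod volume) (volume.prod volume) :=
    MeasurePreserving.skew_product (g := fun y s => ψ y + s) (MeasurePreserving.id volume)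
      (by
        have : Continuous (fun p : E (N - 1) × ℝ => ψ p.1 + p.2) := by fun_prop
        exact this.measurable)
      (ae_of_all _ fun y => (measurePreserving_add_left volume (ψ y)).map_eq)
  have h2 : MeasurePreserving (WithLp.toLp 2 : E (N - 1) × ℝ → _) (volume.prod volume) volume :=
    WithLp.volume_preserving_toLp _ _
  exact (measurePreserving_add_left volume z).comp (O.symm.measurePreserving.comp (h2.comp h1))

/-- Lipschitz maps and the normalized Hausdorff measure. -/
theorem euclideanHausdorffMeasure_image_le {X Y : Type*} [EMetricSpace X] [MeasurableSpace X]
    [BorelSpace X] [EMetricSpace Y] [MeasurableSpace Y] [BorelSpace Y] {f : X → Y} {L : ℝ≥0}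
    (hf : LipschitzWith L f) (d : ℕ) (s : Set X) :
    μHE[d] (f '' s) ≤ (L : ℝ≥0∞) ^ d * μHE[d] s := by
  rw [Measure.euclideanHausdorffMeasure_def, Measure.euclideanHausdorffMeasure_def,
    Measure.smul_apply, Measure.smul_apply, ENNReal.smul_def, ENNReal.smul_def, smul_eq_mul,
    smul_eq_mul, mul_left_comm]
  gcongr
  simpa using hf.hausdorffMeasure_image_le (d := d) (by positivity) s

namespace IsLipschitzChart

variable {z O ψ} {Ω : Set (E N)} {r : ℝ} {K : ℝ≥0}

theorem mem_iff_height_pos (h : IsLipschitzChart Ω z O r ψ K)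
    {x : E N} (h1 : ‖chartHor z O x‖ < r) (h2 : |chartHeight z O ψ x| < r) :
    x ∈ Ω ↔ 0 < chartHeight z O ψ x := by
  have := h.mem_iff _ _ h1 h2
  rwa [show z + O.symm (WithLp.toLp 2 (chartHor z O x, ψ (chartHor z O x) + chartHeight z O ψ x))
    = x from chartMap_hor_height z O ψ x] at this

theorem continuous_height (h : IsLipschitzChart Ω z O r ψ K) : Continuous (chartHeight z O ψ) :=
  (chartHeight_lipschitz z O h.lipschitz).continuous

theorem isOpen_nhd (h : IsLipschitzChart Ω z O r ψ K) (ρ : ℝ) :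
    IsOpen {x | ‖chartHor z O x‖ < ρ ∧ |chartHeight z O ψ x| < ρ} := by
  have h1 := (chartHor_lipschitz z O).continuous
  have h2 := h.continuous_height
  exact (isOpen_lt h1.norm continuous_const).inter (isOpen_lt h2.abs continuous_const)

theorem self_mem_nhd (h : IsLipschitzChart Ω z O r ψ K) {ρ : ℝ} (hρ : 0 < ρ) :
    z ∈ {x | ‖chartHor z O x‖ < ρ ∧ |chartHeight z O ψ x| < ρ} := by
  have h0 : chartHor z O z = 0 := by simp [chartHor]
  simp [chartHeight, h0, h.map_zero, hρ]

theorem notMem (h : IsLipschitzChart Ω z O r ψ K) : z ∉ Ω := by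
  have h1 := h.self_mem_nhd h.pos
  rw [h.mem_iff_height_pos h1.1 h1.2]
  have h0 : chartHor z O z = 0 := by simp [chartHor]
  simp [chartHeight, h0, h.map_zero]

/-- A frontier point of negative height would have a neighbourhood of points below the graph, hence
outside Ω; positive height would put it into the open set Ω. -/
theorem height_eq_zero (h : IsLipschitzChart Ω z O r ψ K)
    (hΩ : IsOpen Ω) {x : E N} (hx : x ∈ frontier Ω)
    (h1 : ‖chartHor z O x‖ < r) (h2 : |chartHeight z O ψ x| < r) : chartHeight z O ψ x = 0 := by
  rw [hΩ.frontier_eq] at hx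
  have h3 := hx.2
  rw [h.mem_iff_height_pos h1 h2] at h3
  refine le_antisymm (not_lt.1 h3) (not_lt.1 fun h4 => ?_)
  have hopen : IsOpen ({x | ‖chartHor z O x‖ < r ∧ |chartHeight z O ψ x| < r} ∩
      {x | chartHeight z O ψ x < 0}) :=
    (h.isOpen_nhd r).inter (isOpen_lt h.continuous_height continuous_const)
  obtain ⟨y, ⟨⟨hy1, hy2⟩, hy3⟩, hy4⟩ := mem_closure_iff.1 hx.1 _ hopen ⟨⟨h1, h2⟩, h4⟩
  rw [h.mem_iff_height_pos hy1 hy2] at hy4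
  exact lt_asymm hy4 hy3

theorem chartMap_zero_mem_frontier (h : IsLipschitzChart Ω z O r ψ K)
    (hΩ : IsOpen Ω) {y : E (N - 1)} (hy : ‖y‖ < r) :
    chartMap z O ψ (y, 0) ∈ frontier Ω := by
  rw [hΩ.frontier_eq]
  constructor
  · have hc : Tendsto (fun s : ℝ => chartMap z O ψ (y, s)) (𝓝[>] 0) (𝓝 (chartMap z O ψ (y, 0))) := by
      have : Continuous fun s : ℝ => chartMap z O ψ (y, s) :=
        (continuous_chartMap z O h.lipschitz.continuous).comp (by fun_prop)
      exact (this.tendsto 0).mono_left nhdsWithin_le_nhds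
    refine mem_closure_of_tendsto hc ?_
    filter_upwards [Ioo_mem_nhdsGT h.pos] with s hs
    exact (h.mem_iff y s hy (by rw [abs_of_pos hs.1]; exact hs.2)).2 hs.1
  · intro hmem
    exact lt_irrefl _ ((h.mem_iff y 0 hy (by simpa using h.pos)).1 hmem)

theorem measure_frontier_inter_lt_top (h : IsLipschitzChart Ω z O r ψ K) (hΩ : IsOpen Ω) :
    μHE[N - 1] (frontier Ω ∩ {x | ‖chartHor z O x‖ < r ∧ |chartHeight z O ψ x| < r}) < ∞ := by
  have hsub : frontier Ω ∩ {x | ‖chartHor z O x‖ < r ∧ |chartHeight z O ψ x| < r} ⊆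
      (fun y => chartMap z O ψ (y, 0)) '' Metric.ball 0 r := by
    rintro x ⟨hx, h1, h2⟩
    refine ⟨chartHor z O x, by simpa using h1, ?_⟩
    have := chartMap_hor_height z O ψ x
    rwa [h.height_eq_zero hΩ hx h1 h2] at this
  refine (measure_mono hsub).trans_lt ((euclideanHausdorffMeasure_image_le
    (chartMap_lipschitz z O h.lipschitz) _ _).trans_lt ?_)
  rw [EuclideanSpace.euclideanHausdorffMeasure_eq_volume]
  exact ENNReal.mul_lt_top (by finiteness) measure_ball_lt_top

/-- The horizontal projection inverts the parametrization and is 1-Lipschitz, so it cannot increase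
the (N-1)-dimensional measure. This one-sided bound takes the place of an area formula. -/
theorem map_restrict_le_surf (h : IsLipschitzChart Ω z O r ψ K)
    (hΩ : IsOpen Ω) {ρ : ℝ} (hρ : ρ ≤ r) :
    Measure.map (fun y => chartMap z O ψ (y, 0)) (volume.restrict (Metric.ball 0 ρ)) ≤ surf Ω := by
  have hm : Measurable fun y => chartMap z O ψ (y, 0) :=
    (chartMap_lipschitz z O h.lipschitz).continuous.measurable
  refine Measure.le_iff.2 fun S hS => ?_
  rw [Measure.map_apply hm hS, Measure.restrict_apply (hm hS), Measure.restrict_apply hS]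
  have hsub : (fun y => chartMap z O ψ (y, 0)) ⁻¹' S ∩ Metric.ball 0 ρ ⊆
      chartHor z O '' (S ∩ frontier Ω) := by
    rintro y ⟨hy1, hy2⟩
    refine ⟨chartMap z O ψ (y, 0), ⟨hy1, h.chartMap_zero_mem_frontier hΩ ?_⟩,
      chartHor_chartMap z O ψ _⟩
    exact lt_of_lt_of_le (by simpa using hy2) hρ
  have := euclideanHausdorffMeasure_image_le (chartHor_lipschitz z O) (N - 1) (S ∩ frontier Ω)
  rw [EuclideanSpace.euclideanHausdorffMeasure_eq_volume] at this
  simpa using (measure_mono hsub).trans this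

/-- The height is (1 + K)-Lipschitz, so if it were at least (1 + K)ε, every point within ε would
still have positive height. The margin from r/2 to r keeps a complement point at distance less than
ε inside the chart, where it would have to belong to Ω. -/
theorem layer_subset (h : IsLipschitzChart Ω z O r ψ K) {ε : ℝ} :
    {x | x ∈ Ω ∧ Metric.infDist x Ωᶜ < ε} ∩
      {x | ‖chartHor z O x‖ < r / 2 ∧ |chartHeight z O ψ x| < r / 2} ⊆
    {x | ‖chartHor z O x‖ < r / 2 ∧ chartHeight z O ψ x ∈ Set.Ioo 0 ((1 + K) * ε)} := by
  rintro x ⟨⟨hx, hd⟩, h1, h2⟩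
  have hr := h.pos
  refine ⟨h1, (h.mem_iff_height_pos (by linarith) (by linarith)).1 hx, ?_⟩
  by_contra! hge
  obtain ⟨p, hp, hxp⟩ := (Metric.infDist_lt_iff ⟨z, h.notMem⟩).1 hd
  have hε0 : 0 < ε := dist_nonneg.trans_lt hxp
  have hK : (0 : ℝ) ≤ K := K.2
  have h3 := (chartHeight_lipschitz z O h.lipschitz).dist_le_mul x p
  have h4 := (chartHor_lipschitz z O).dist_le_mul x p
  rw [Real.dist_eq] at h3
  rw [dist_eq_norm] at h4
  push_cast at h3 h4
  have h5 : (1 + (K : ℝ)) * dist x p < (1 + K) * ε := by gcongr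
  have h6 := abs_lt.1 (h3.trans_lt h5)
  have h7 := abs_lt.1 h2
  have h8 : ε ≤ (1 + K) * ε := by nlinarith
  refine hp ((h.mem_iff_height_pos ?_ ?_).2 ?_)
  · calc ‖chartHor z O p‖ ≤ ‖chartHor z O x‖ + ‖chartHor z O x - chartHor z O p‖ := by
          have := norm_sub_le (chartHor z O x) (chartHor z O x - chartHor z O p)
          simpa using this
      _ < r := by linarith
  · rw [abs_lt]; constructor <;> linarith
  · linarith

/-- The mean of `|v|` over a thin layer above the graph is controlled by its boundary integral. -/
theorem eventually_layer_le (h : IsLipschitzChart Ω z O r ψ K)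
    (hΩ : IsOpen Ω) {v : E N → ℝ} (hv : Continuous v) {η : ℝ≥0}
    (hη : 0 < η) : ∀ᶠ ε : ℝ in 𝓝[>] 0,
      ∫⁻ x in {x | x ∈ Ω ∧ Metric.infDist x Ωᶜ < ε} ∩
        {x | ‖chartHor z O x‖ < r / 2 ∧ |chartHeight z O ψ x| < r / 2}, ‖v x‖ₑ ≤
      ENNReal.ofReal ((1 + K) * ε) * (∫⁻ x, ‖v x‖ₑ ∂(surf Ω) + η) := by
  have hr := h.pos
  have hK : (0 : ℝ) ≤ K := K.2
  have hψ := h.lipschitz.continuous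
  have hΦ := continuous_chartMap z O hψ
  set m := volume (Metric.ball (0 : E (N - 1)) (r / 2)) with hm
  have hm_top : m ≠ ∞ := measure_ball_lt_top.ne
  -- The pointwise tolerance η' becomes η after integration over the base ball.
  obtain ⟨η', hη', hη'm⟩ : ∃ η' : ℝ≥0, 0 < η' ∧ (η' : ℝ≥0∞) * m ≤ η := by
    refine ⟨η / (m.toNNReal + 1), by positivity, ?_⟩
    rw [← ENNReal.coe_toNNReal hm_top]
    norm_cast
    rw [div_mul_eq_mul_div, div_le_iff₀ (by positivity)]
    gcongr
    simp
  have hcpt : IsCompact (Metric.closedBall (0 : E (N - 1)) (r / 2) ×ˢ Set.Icc (0 : ℝ) 1) :=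
    (isCompact_closedBall _ _).prod isCompact_Icc
  -- Uniform continuity lets the value of `v` at height s be replaced by its value on the graph. How
  -- thin the layer must be depends on `v`, the constant does not.
  have huc := hcpt.uniformContinuousOn_of_continuous (hv.comp hΦ).continuousOn
  rw [Metric.uniformContinuousOn_iff] at huc
  obtain ⟨δ, hδ, huc⟩ := huc η' (by exact_mod_cast hη')
  have hlim : Tendsto (fun ε : ℝ => (1 + K) * ε) (𝓝[>] 0) (𝓝 0) := by
    have : Continuous fun ε : ℝ => (1 + K) * ε := by fun_prop
    have h0 := this.tendsto 0
    simp only [mul_zero] at h0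
    exact h0.mono_left nhdsWithin_le_nhds
  filter_upwards [hlim.eventually (gt_mem_nhds (show 0 < r / 2 by positivity)),
    hlim.eventually (gt_mem_nhds hδ), hlim.eventually (gt_mem_nhds one_pos)] with ε h1 h2 h3
  refine (lintegral_mono_set h.layer_subset).trans ?_
  set κ := (1 + (K : ℝ)) * ε with hκ
  have hmp := measurePreserving_chartMap z O hψ
  have hmeas : MeasurableSet {x | ‖chartHor z O x‖ < r / 2 ∧ chartHeight z O ψ x ∈ Set.Ioo 0 κ} := by
    have c1 := (chartHor_lipschitz z O).continuous
    exact ((isOpen_lt c1.norm continuous_const).inter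
      (isOpen_Ioo.preimage h.continuous_height)).measurableSet
  rw [← hmp.setLIntegral_comp_preimage hmeas hv.measurable.enorm]
  have hpre : chartMap z O ψ ⁻¹'
      {x | ‖chartHor z O x‖ < r / 2 ∧ chartHeight z O ψ x ∈ Set.Ioo 0 κ} =
      Metric.ball 0 (r / 2) ×ˢ Set.Ioo 0 κ := by
    ext p
    simp [chartHor_chartMap, chartHeight_chartMap]
  rw [hpre, ← Measure.prod_restrict, lintegral_prod _ (by
    exact (hv.comp hΦ).measurable.enorm.aemeasurable)]
  have hγm : Measurable fun y => chartMap z O ψ (y, 0) :=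
    (chartMap_lipschitz z O h.lipschitz).continuous.measurable
  calc ∫⁻ y in Metric.ball 0 (r / 2), ∫⁻ s in Set.Ioo 0 κ, ‖v (chartMap z O ψ (y, s))‖ₑ
      ≤ ∫⁻ y in Metric.ball 0 (r / 2),
          ENNReal.ofReal κ * (‖v (chartMap z O ψ (y, 0))‖ₑ + η') := by
        refine setLIntegral_mono' measurableSet_ball fun y hy => ?_
        calc ∫⁻ s in Set.Ioo 0 κ, ‖v (chartMap z O ψ (y, s))‖ₑ
            ≤ ∫⁻ s in Set.Ioo 0 κ, (‖v (chartMap z O ψ (y, 0))‖ₑ + η') := by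
              refine setLIntegral_mono' measurableSet_Ioo fun s hs => ?_
              have hy' : y ∈ Metric.closedBall (0 : E (N - 1)) (r / 2) :=
                Metric.ball_subset_closedBall hy
              have hd := huc (y, s) ⟨hy', hs.1.le, (hs.2.trans h3).le⟩ (y, 0)
                ⟨hy', le_rfl, zero_le_one⟩ (by
                  rw [Prod.dist_eq]
                  simp only [dist_self, Real.dist_eq, sub_zero]
                  rw [abs_of_pos hs.1]
                  exact max_lt hδ (hs.2.trans h2))
              simp only [Function.comp_apply] at hd
              have hd' : ‖v (chartMap z O ψ (y, s)) - v (chartMap z O ψ (y, 0))‖ₑ ≤ η' := by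
                rw [← ofReal_norm, ← dist_eq_norm]
                exact ENNReal.ofReal_le_of_le_toReal (by simpa using hd.le)
              calc ‖v (chartMap z O ψ (y, s))‖ₑ
                  = ‖v (chartMap z O ψ (y, 0)) +
                    (v (chartMap z O ψ (y, s)) - v (chartMap z O ψ (y, 0)))‖ₑ := by
                    congr 1; ring
                _ ≤ _ := (enorm_add_le _ _).trans (by gcongr)
          _ = _ := by
              rw [setLIntegral_const, Real.volume_Ioo, sub_zero, mul_comm]
    _ = ENNReal.ofReal κ * ((∫⁻ y in Metric.ball 0 (r / 2), ‖v (chartMap z O ψ (y, 0))‖ₑ)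
          + η' * m) := by
        rw [lintegral_const_mul _ (by
          exact ((hv.measurable.comp hγm).enorm.add_const _)),
          lintegral_add_right _ measurable_const, setLIntegral_const]
    _ ≤ _ := by
        gcongr
        rw [← lintegral_map (f := fun x => ‖v x‖ₑ) hv.measurable.enorm hγm]
        exact lintegral_mono' (h.map_restrict_le_surf hΩ (by linarith)) le_rfl

end IsLipschitzChart

end Charts

/-! ### Finiteness of the surface measure and the global layer estimate -/

section Layer

variable {N : ℕ} {Ω : Set (E N)}

theorem IsLipschitzRegular.exists_chart (hΩ : IsLipschitzRegular Ω) (z : frontier Ω) :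
    ∃ (O : E N ≃ₗᵢ[ℝ] WithLp 2 (E (N - 1) × ℝ)) (r : ℝ) (ψ : E (N - 1) → ℝ) (K : ℝ≥0),
      IsLipschitzChart Ω z O r ψ K := by
  obtain ⟨O, r, ψ, K, h1, h2, h3, h4⟩ := hΩ.2.2 z z.2
  exact ⟨O, r, ψ, K, h1, h2, h3, h4⟩

theorem IsLipschitzRegular.isCompact_frontier (hΩ : IsLipschitzRegular Ω) :
    IsCompact (frontier Ω) :=
  Metric.isCompact_of_isClosed_isBounded isClosed_frontier
    (hΩ.2.1.closure.subset frontier_subset_closure)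

theorem IsLipschitzRegular.measure_frontier_lt_top (hΩ : IsLipschitzRegular Ω) :
    μHE[N - 1] (frontier Ω) < ∞ := by
  choose O r ψ K h using hΩ.exists_chart
  obtain ⟨t, ht⟩ := hΩ.isCompact_frontier.elim_finite_subcover
    (fun z : frontier Ω =>
      {x | ‖chartHor z (O z) x‖ < r z ∧ |chartHeight z (O z) (ψ z) x| < r z})
    (fun z => (h z).isOpen_nhd _)
    (fun z hz => Set.mem_iUnion.2 ⟨⟨z, hz⟩, (h ⟨z, hz⟩).self_mem_nhd (h ⟨z, hz⟩).pos⟩)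
  have hsub : frontier Ω ⊆ ⋃ z ∈ t, (frontier Ω ∩
      {x | ‖chartHor z (O z) x‖ < r z ∧ |chartHeight z (O z) (ψ z) x| < r z}) := by
    rw [← Set.inter_iUnion₂]; exact Set.subset_inter le_rfl ht
  refine (measure_mono hsub).trans_lt ((measure_biUnion_finset_le _ _).trans_lt ?_)
  exact ENNReal.sum_lt_top.2 fun z _ => (h z).measure_frontier_inter_lt_top hΩ.1

theorem IsLipschitzRegular.isFiniteMeasure_surf (hΩ : IsLipschitzRegular Ω) :
    IsFiniteMeasure (surf Ω) :=
  ⟨by rw [Measure.restrict_apply_univ]; exact hΩ.measure_frontier_lt_top⟩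

theorem IsLipschitzRegular.isFiniteMeasure_vol (hΩ : IsLipschitzRegular Ω) :
    IsFiniteMeasure (vol Ω) :=
  ⟨by rw [Measure.restrict_apply_univ]; exact hΩ.2.1.measure_lt_top⟩

theorem IsLipschitzRegular.ne_univ (hN : 2 ≤ N) (hΩ : IsLipschitzRegular Ω) : Ω ≠ Set.univ := by
  rintro rfl
  have : Nonempty (Fin N) := ⟨⟨0, by omega⟩⟩
  exact NormedSpace.unbounded_univ ℝ (E N) hΩ.2.1

/-- The integral over the boundary layer of width `ε` is at most of order `ε` times the boundary
integral. -/
theorem IsLipschitzRegular.exists_layer_bound (hN : 2 ≤ N) (hΩ : IsLipschitzRegular Ω) :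
    ∃ C : ℝ≥0, ∀ v : E N → ℝ, Continuous v → ∀ η : ℝ≥0, 0 < η → ∀ᶠ ε : ℝ in 𝓝[>] 0,
      ∫⁻ x in {x | x ∈ Ω ∧ Metric.infDist x Ωᶜ < ε}, ‖v x‖ₑ ≤
        C * ENNReal.ofReal ε * (∫⁻ x, ‖v x‖ₑ ∂(surf Ω) + η) := by
  choose O r ψ K h using hΩ.exists_chart
  let U : frontier Ω → Set (E N) := fun z =>
    {x | ‖chartHor z (O z) x‖ < r z / 2 ∧ |chartHeight z (O z) (ψ z) x| < r z / 2}
  obtain ⟨t, ht⟩ := hΩ.isCompact_frontier.elim_finite_subcover U (fun z => (h z).isOpen_nhd _)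
    (fun z hz => Set.mem_iUnion.2 ⟨⟨z, hz⟩, (h ⟨z, hz⟩).self_mem_nhd (half_pos (h ⟨z, hz⟩).pos)⟩)
  -- By compactness the finitely many half-size charts cover a whole δ-neighbourhood of the
  -- frontier, hence every layer of width less than δ.
  obtain ⟨δ, hδ, hth⟩ := hΩ.isCompact_frontier.exists_thickening_subset_open
    (isOpen_biUnion fun z _ => (h z).isOpen_nhd _) ht
  refine ⟨∑ z ∈ t, (1 + K z), fun v hv η hη => ?_⟩
  have hall := (eventually_all_finset t (l := 𝓝[>] (0 : ℝ))).2
    fun z _ => (h z).eventually_layer_le hΩ.1 hv hη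
  filter_upwards [hall, Ioo_mem_nhdsGT hδ] with ε h1 h2
  have hsub : {x | x ∈ Ω ∧ Metric.infDist x Ωᶜ < ε} ⊆
      ⋃ z : t, ({x | x ∈ Ω ∧ Metric.infDist x Ωᶜ < ε} ∩ U z) := by
    rintro x ⟨hx, hd⟩
    -- The distance to the complement is attained on the frontier.
    obtain ⟨y, hy, hyd⟩ := exists_mem_frontier_infDist_compl_eq_dist hx (hΩ.ne_univ hN)
    have hxt : x ∈ Metric.thickening δ (frontier Ω) :=
      Metric.mem_thickening_iff.2 ⟨y, hy, by rw [← hyd]; exact hd.trans h2.2⟩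
    obtain ⟨z, hz, hxz⟩ := Set.mem_iUnion₂.1 (hth hxt)
    exact Set.mem_iUnion.2 ⟨⟨z, hz⟩, ⟨hx, hd⟩, hxz⟩
  calc _ ≤ _ := lintegral_mono_set hsub
    _ ≤ ∑' z : t, ∫⁻ x in {x | x ∈ Ω ∧ Metric.infDist x Ωᶜ < ε} ∩ U z, ‖v x‖ₑ :=
        lintegral_iUnion_le _ _
    _ = ∑ z ∈ t, ∫⁻ x in {x | x ∈ Ω ∧ Metric.infDist x Ωᶜ < ε} ∩ U z, ‖v x‖ₑ := by
        rw [tsum_fintype, ← Finset.sum_coe_sort t]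
    _ ≤ ∑ z ∈ t, ENNReal.ofReal ((1 + K z) * ε) * (∫⁻ x, ‖v x‖ₑ ∂(surf Ω) + η) :=
        Finset.sum_le_sum h1
    _ = _ := by
        rw [← Finset.sum_mul]
        congr 1
        push_cast
        rw [Finset.sum_mul]
        refine Finset.sum_congr rfl fun z _ => ?_
        rw [ENNReal.ofReal_mul (by positivity), ENNReal.ofReal_add zero_le_one (K z).coe_nonneg]
        simp

end Layer

/-! ### Mollification, C¹ test functions and cutoffs -/

section Mollification

open scoped Convolution
open ContinuousLinearMap (lsmul)

variable {N : ℕ}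

/-- Averaging against a smooth bump of radius `δ`. -/
def mollify {δ : ℝ} (hδ : 0 < δ) (φ : E N → ℝ) : E N → ℝ :=
  ((⟨δ / 2, δ, half_pos hδ, half_lt_self hδ⟩ : ContDiffBump (0 : E N)).normed volume)
    ⋆[lsmul ℝ ℝ, volume] φ

variable {δ : ℝ} (hδ : 0 < δ)

theorem contDiff_mollify {φ : E N → ℝ} (hφ : Continuous φ) {n : ℕ∞} :
    ContDiff ℝ n (mollify hδ φ) :=
  (ContDiffBump.hasCompactSupport_normed _).contDiff_convolution_left _
    (ContDiffBump.contDiff_normed _) hφ.locallyIntegrable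

theorem abs_mollify_sub_le {φ : E N → ℝ} (hφ : Continuous φ) {x : E N} {η : ℝ}
    (h : ∀ y ∈ Metric.ball x δ, |φ y - φ x| ≤ η) : |mollify hδ φ x - φ x| ≤ η := by
  have := ContDiffBump.dist_normed_convolution_le (μ := (volume : Measure (E N)))
    (φ := (⟨δ / 2, δ, half_pos hδ, half_lt_self hδ⟩ : ContDiffBump (0 : E N)))
    (hφ.aestronglyMeasurable) (x₀ := x) (ε := η) (by simpa [Real.dist_eq] using h)
  rwa [Real.dist_eq] at this

theorem mollify_eq_of_ball {φ : E N → ℝ} {x : E N} (h : ∀ y ∈ Metric.ball x δ, φ y = φ x) :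
    mollify hδ φ x = φ x :=
  ContDiffBump.normed_convolution_eq_right (μ := (volume : Measure (E N)))
    (φ := (⟨δ / 2, δ, half_pos hδ, half_lt_self hδ⟩ : ContDiffBump (0 : E N))) h

theorem lipschitzWith_mollify {φ : E N → ℝ} {L : ℝ≥0} (hφ : LipschitzWith L φ) :
    LipschitzWith L (mollify hδ φ) := by
  set ρ : ContDiffBump (0 : E N) := ⟨δ / 2, δ, half_pos hδ, half_lt_self hδ⟩
  refine LipschitzWith.of_dist_le_mul fun x y => ?_
  have hint : ∀ x, Integrable (fun t => ρ.normed volume t * φ (x - t)) volume := by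
    intro x
    refine Continuous.integrable_of_hasCompactSupport ?_ ?_
    · exact (ρ.contDiff_normed (n := 0)).continuous.mul (hφ.continuous.comp (by fun_prop))
    · exact (ρ.hasCompactSupport_normed (μ := volume)).mul_right
  have e : ∀ x, mollify hδ φ x = ∫ t, ρ.normed volume t * φ (x - t) := fun x => rfl
  rw [e x, e y, dist_eq_norm, ← integral_sub (hint x) (hint y)]
  have hb : ∀ t, ‖ρ.normed volume t * φ (x - t) - ρ.normed volume t * φ (y - t)‖ ≤
      ρ.normed volume t * (L * dist x y) := by
    intro t
    rw [← mul_sub, norm_mul, Real.norm_of_nonneg (ρ.nonneg_normed t), ← dist_eq_norm]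
    refine mul_le_mul_of_nonneg_left ?_ (ρ.nonneg_normed t)
    simpa using hφ.dist_le_mul (x - t) (y - t)
  refine (norm_integral_le_of_norm_le (ρ.integrable_normed.mul_const _)
    (ae_of_all _ hb)).trans (le_of_eq ?_)
  rw [integral_mul_const, ρ.integral_normed, one_mul]

theorem support_mollify_subset (φ : E N → ℝ) :
    Function.support (mollify hδ φ) ⊆ Metric.thickening δ (Function.support φ) := by
  refine (support_convolution_subset _).trans ?_
  rw [ContDiffBump.support_normed_eq]
  rintro _ ⟨a, ha, b, hb, rfl⟩
  refine Metric.mem_thickening_iff.2 ⟨b, hb, ?_⟩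
  simpa [dist_eq_norm] using ha

theorem partialDeriv_mollify {φ : E N → ℝ} (hφ : ContDiff ℝ 1 φ) (hc : HasCompactSupport φ)
    (i : Fin N) : partialDeriv i (mollify hδ φ) = mollify hδ (partialDeriv i φ) := by
  set ρ : ContDiffBump (0 : E N) := ⟨δ / 2, δ, half_pos hδ, half_lt_self hδ⟩
  funext x
  have h1 : LocallyIntegrable (ρ.normed volume) volume :=
    ρ.integrable_normed.locallyIntegrable
  have h := hc.hasFDerivAt_convolution_right (lsmul ℝ ℝ) h1 hφ x
  rw [partialDeriv]
  change fderiv ℝ (ρ.normed volume ⋆[lsmul ℝ ℝ, volume] φ) x _ = _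
  rw [h.fderiv, convolution_precompR_apply _ h1 (hc.fderiv ℝ) (hφ.continuous_fderiv one_ne_zero)]
  rfl

theorem continuous_partialDeriv {φ : E N → ℝ} (hφ : ContDiff ℝ 1 φ) (i : Fin N) :
    Continuous (partialDeriv i φ) :=
  (hφ.continuous_fderiv one_ne_zero).clm_apply continuous_const

theorem hasCompactSupport_partialDeriv {φ : E N → ℝ} (hφ : HasCompactSupport φ) (i : Fin N) :
    HasCompactSupport (partialDeriv i φ) :=
  hφ.fderiv_apply (𝕜 := ℝ) _

theorem partialDeriv_mul {φ χ : E N → ℝ} (hφ : ContDiff ℝ 1 φ) (hχ : ContDiff ℝ 1 χ) (i : Fin N)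
    (x : E N) : partialDeriv i (fun y => φ y * χ y) x =
      φ x * partialDeriv i χ x + χ x * partialDeriv i φ x := by
  have h1 := (hφ.differentiable one_ne_zero x)
  have h2 := (hχ.differentiable one_ne_zero x)
  simp only [partialDeriv]
  rw [fderiv_fun_mul h1 h2]
  simp

/-- Smooth approximation of a `C¹` function with compact support in an open set. -/
theorem exists_smooth_approx {Ω : Set (E N)} (hΩ : IsOpen Ω) {φ : E N → ℝ} (hφ : ContDiff ℝ 1 φ)
    (hc : HasCompactSupport φ) (hs : tsupport φ ⊆ Ω) (i : Fin N) {η : ℝ} (hη : 0 < η) :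
    ∃ χ : E N → ℝ, ContDiff ℝ (⊤ : ℕ∞) χ ∧ HasCompactSupport χ ∧ tsupport χ ⊆ Ω ∧
      (∀ x, |χ x - φ x| ≤ η) ∧ ∀ x, |partialDeriv i χ x - partialDeriv i φ x| ≤ η := by
  obtain ⟨δ₀, hδ₀, hsub⟩ := hc.isCompact.exists_cthickening_subset_open hΩ hs
  have hd := continuous_partialDeriv hφ i
  have u1 := hc.uniformContinuous_of_continuous hφ.continuous
  have u2 := (hasCompactSupport_partialDeriv hc i).uniformContinuous_of_continuous hd
  obtain ⟨δ₁, hδ₁, h1⟩ := Metric.uniformContinuous_iff.1 u1 η hη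
  obtain ⟨δ₂, hδ₂, h2⟩ := Metric.uniformContinuous_iff.1 u2 η hη
  -- The three radii control, in order, the support, the values and the partial derivative of the
  -- mollification.
  have hδ : 0 < min δ₀ (min δ₁ δ₂) := by positivity
  have hts : tsupport (mollify hδ φ) ⊆ Metric.cthickening δ₀ (tsupport φ) := by
    refine closure_minimal ?_ Metric.isClosed_cthickening
    refine (support_mollify_subset hδ φ).trans ((Metric.thickening_subset_cthickening _ _).trans ?_)
    exact Metric.cthickening_mono (min_le_left _ _) _ |>.trans
      (Metric.cthickening_subset_of_subset _ (subset_tsupport φ))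
  refine ⟨mollify hδ φ, contDiff_mollify hδ hφ.continuous,
    HasCompactSupport.of_support_subset_isCompact (hc.isCompact.cthickening (r := δ₀))
      ((subset_tsupport _).trans hts), hts.trans hsub, fun x => ?_, fun x => ?_⟩
  · refine abs_mollify_sub_le hδ hφ.continuous fun y hy => ?_
    rw [← Real.dist_eq]
    exact (h1 (lt_of_lt_of_le hy ((min_le_right _ _).trans (min_le_left _ _)))).le
  · rw [partialDeriv_mollify hδ hφ hc]
    refine abs_mollify_sub_le hδ hd fun y hy => ?_
    rw [← Real.dist_eq]
    exact (h2 (lt_of_lt_of_le hy ((min_le_right _ _).trans (min_le_right _ _)))).le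

/-- Weak derivatives may be tested with `C¹` functions. -/
theorem HasWeakPartial.integral_mul_partialDeriv {Ω : Set (E N)} (hΩ : IsOpen Ω) {i : Fin N}
    {u g : E N → ℝ} (h : HasWeakPartial Ω i u g) (hu : Integrable u (vol Ω))
    (hg : Integrable g (vol Ω)) {φ : E N → ℝ} (hφ : ContDiff ℝ 1 φ) (hc : HasCompactSupport φ)
    (hs : tsupport φ ⊆ Ω) :
    ∫ x, u x * partialDeriv i φ x ∂(vol Ω) = -∫ x, g x * φ x ∂(vol Ω) := by
  have hmul : ∀ {w ζ : E N → ℝ}, Integrable w (vol Ω) → Continuous ζ → HasCompactSupport ζ →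
      Integrable (fun x => w x * ζ x) (vol Ω) := by
    intro w ζ hw hζ hζc
    obtain ⟨C, hC⟩ := hζ.bounded_above_of_compact_support hζc
    exact hw.mul_bdd hζ.aestronglyMeasurable (ae_of_all _ hC)
  have key : ∀ η : ℝ, 0 < η → |∫ x, u x * partialDeriv i φ x ∂(vol Ω) +
      ∫ x, g x * φ x ∂(vol Ω)| ≤ η * (∫ x, |u x| ∂(vol Ω) + ∫ x, |g x| ∂(vol Ω)) := by
    intro η hη
    obtain ⟨χ, h1, h2, h3, h4, h5⟩ := exists_smooth_approx hΩ hφ hc hs i hη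
    have hχ1 : ContDiff ℝ 1 χ := h1.of_le (by exact_mod_cast le_top)
    have h6 := h χ h1 h2 h3
    have a1 := hmul hu (continuous_partialDeriv hφ i) (hasCompactSupport_partialDeriv hc i)
    have a2 := hmul hu (continuous_partialDeriv hχ1 i) (hasCompactSupport_partialDeriv h2 i)
    have a3 := hmul hg hφ.continuous hc
    have a4 := hmul hg hχ1.continuous h2
    have e : ∫ x, u x * partialDeriv i φ x ∂(vol Ω) + ∫ x, g x * φ x ∂(vol Ω) =
        -(∫ x, u x * (partialDeriv i χ x - partialDeriv i φ x) ∂(vol Ω)) -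
        ∫ x, g x * (χ x - φ x) ∂(vol Ω) := by
      simp only [mul_sub]
      rw [integral_sub a2 a1, integral_sub a4 a3, h6]; ring
    have b1 : |∫ x, u x * (partialDeriv i χ x - partialDeriv i φ x) ∂(vol Ω)| ≤
        η * ∫ x, |u x| ∂(vol Ω) := by
      rw [← integral_const_mul, ← Real.norm_eq_abs]
      refine norm_integral_le_of_norm_le (hu.abs.const_mul η) (ae_of_all _ fun x => ?_)
      rw [norm_mul, mul_comm, Real.norm_eq_abs, Real.norm_eq_abs]
      gcongr; exact h5 x
    have b2 : |∫ x, g x * (χ x - φ x) ∂(vol Ω)| ≤ η * ∫ x, |g x| ∂(vol Ω) := by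
      rw [← integral_const_mul, ← Real.norm_eq_abs]
      refine norm_integral_le_of_norm_le (hg.abs.const_mul η) (ae_of_all _ fun x => ?_)
      rw [norm_mul, mul_comm, Real.norm_eq_abs, Real.norm_eq_abs]
      gcongr; exact h4 x
    rw [e, mul_add]
    refine (abs_sub _ _).trans ?_
    rw [abs_neg]
    exact add_le_add b1 b2
  rw [eq_neg_iff_add_eq_zero, ← abs_nonpos_iff]
  refine ge_of_tendsto (f := fun η : ℝ => η * (∫ x, |u x| ∂(vol Ω) + ∫ x, |g x| ∂(vol Ω)))
    (x := 𝓝[>] 0) ?_ (by filter_upwards [self_mem_nhdsWithin] with η hη using key η hη)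
  have : Continuous fun η : ℝ => η * (∫ x, |u x| ∂(vol Ω) + ∫ x, |g x| ∂(vol Ω)) := by fun_prop
  have h0 := this.tendsto 0
  rw [zero_mul] at h0
  exact h0.mono_left nhdsWithin_le_nhds

/-- A smooth cutoff function in `Ω` that is constant off the boundary layer of width `5ε`. -/
theorem exists_cutoff {Ω : Set (E N)} (hb : Bornology.IsBounded Ω) (hne : Ω ≠ Set.univ)
    {ε : ℝ} (hε : 0 < ε) : ∃ χ : E N → ℝ, ContDiff ℝ 1 χ ∧ HasCompactSupport χ ∧ tsupport χ ⊆ Ω ∧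
      (∀ x, |χ x| ≤ 2) ∧ (∀ x, 4 * ε < Metric.infDist x Ωᶜ → χ x = 1) ∧
      (∀ i x, |partialDeriv i χ x| ≤ ε⁻¹) ∧
      ∀ i x, ¬(x ∈ Ω ∧ Metric.infDist x Ωᶜ < 5 * ε) → partialDeriv i χ x = 0 := by
  have hne' : (Ωᶜ).Nonempty := Set.nonempty_compl.2 hne
  let ρ : E N → ℝ := fun x => Metric.infDist x Ωᶜ
  have hρ : LipschitzWith 1 ρ := Metric.lipschitz_infDist_pt _
  have hρc : Continuous ρ := hρ.continuous
  have hball : ∀ {x y : E N}, y ∈ Metric.ball x ε → |ρ y - ρ x| < ε := by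
    intro x y hy
    have := hρ.dist_le_mul y x
    rw [Real.dist_eq, NNReal.coe_one, one_mul] at this
    exact this.trans_lt hy
  -- The profile vanishes for ρ ≤ 2ε, equals 1 for ρ ≥ 3ε and has slope 1/ε. Mollifying at radius ε
  -- widens the transition to ε ≤ ρ ≤ 4ε and keeps the Lipschitz constant; the further margin up to
  -- 5ε makes the function locally constant where its derivative has to vanish.
  let h : E N → ℝ := fun x => min 1 (max 0 (ε⁻¹ * (ρ x - 2 * ε)))
  let L : ℝ≥0 := ⟨ε⁻¹, by positivity⟩
  have hL : LipschitzWith L h := by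
    have h1 : LipschitzWith L fun x => ε⁻¹ * (ρ x - 2 * ε) := by
      refine LipschitzWith.of_dist_le_mul fun x y => ?_
      have := hρ.dist_le_mul x y
      rw [Real.dist_eq, NNReal.coe_one, one_mul] at this
      rw [Real.dist_eq, ← mul_sub, abs_mul, abs_of_pos (inv_pos.2 hε)]
      change _ ≤ ε⁻¹ * _
      gcongr
      simpa using this
    exact (h1.const_max 0).const_min 1
  have hcont : Continuous h := hL.continuous
  have h0 : ∀ x, 0 ≤ h x := fun x => le_min zero_le_one (le_max_left _ _)
  have h1 : ∀ x, h x ≤ 1 := fun x => min_le_left _ _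
  have hzero : ∀ x, ρ x ≤ 2 * ε → h x = 0 := by
    intro x hx
    have : ε⁻¹ * (ρ x - 2 * ε) ≤ 0 := mul_nonpos_of_nonneg_of_nonpos (by positivity) (by linarith)
    simp [h, max_eq_left this]
  have hone : ∀ x, 3 * ε ≤ ρ x → h x = 1 := by
    intro x hx
    have : 1 ≤ ε⁻¹ * (ρ x - 2 * ε) := by
      rw [inv_mul_eq_div, le_div_iff₀ hε]; linarith
    simp only [h]
    rw [min_eq_left (this.trans (le_max_right _ _))]
  have hm0 : ∀ x, ρ x ≤ ε → mollify hε h x = 0 := by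
    intro x hx
    have hx0 := hzero x (by linarith)
    rw [← hx0]
    refine mollify_eq_of_ball hε fun y hy => ?_
    rw [hx0]
    have := abs_lt.1 (hball hy)
    exact hzero y (by linarith)
  have hm1 : ∀ x, 4 * ε < ρ x → mollify hε h x = 1 := by
    intro x hx
    have hx0 := hone x (by linarith)
    rw [← hx0]
    refine mollify_eq_of_ball hε fun y hy => ?_
    rw [hx0]
    have := abs_lt.1 (hball hy)
    exact hone y (by linarith)
  have hts : tsupport (mollify hε h) ⊆ {x | ε ≤ ρ x} := by
    refine closure_minimal ?_ (isClosed_le continuous_const hρc)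
    intro x hx
    by_contra hlt
    exact hx (hm0 x (not_le.1 hlt).le)
  have hsub : {x | ε ≤ ρ x} ⊆ Ω := by
    intro x hx
    by_contra hxΩ
    have : ρ x = 0 := Metric.infDist_zero_of_mem hxΩ
    simp only [Set.mem_ofPred_eq, this] at hx
    linarith
  refine ⟨mollify hε h, by exact_mod_cast contDiff_mollify hε hcont (n := 1), ?_, hts.trans hsub,
    fun x => ?_, hm1, fun i x => ?_, fun i x hx => ?_⟩
  · exact Metric.isCompact_of_isClosed_isBounded (isClosed_tsupport _)
      (hb.subset (hts.trans hsub))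
  · have := abs_mollify_sub_le hε hcont (x := x) (η := 1) fun y _ => by
      rw [abs_le]; constructor <;> linarith [h0 x, h1 x, h0 y, h1 y]
    rw [abs_le] at this ⊢
    constructor <;> linarith [h0 x, h1 x]
  · have h2 := norm_fderiv_le_of_lipschitz ℝ (lipschitzWith_mollify hε hL) (x₀ := x)
    have h3 := (fderiv ℝ (mollify hε h) x).le_of_opNorm_le h2 (EuclideanSpace.single i 1)
    rw [PiLp.norm_single, norm_one, mul_one] at h3
    exact h3
  · have hev : mollify hε h =ᶠ[𝓝 x] fun _ => mollify hε h x := by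
      by_cases hxΩ : x ∈ Ω
      · have hx2 : 5 * ε ≤ ρ x := not_lt.1 fun hlt => hx ⟨hxΩ, hlt⟩
        have hx3 : 4 * ε < ρ x := by linarith
        filter_upwards [(isOpen_lt continuous_const hρc).mem_nhds hx3] with y hy
        rw [hm1 y hy, hm1 x hx3]
      · have hx2 : ρ x < ε := by
          rw [show ρ x = 0 from Metric.infDist_zero_of_mem hxΩ]; exact hε
        filter_upwards [(isOpen_lt hρc continuous_const).mem_nhds hx2] with y hy
        rw [hm0 y (le_of_lt hy), hm0 x hx2.le]
    rw [partialDeriv, hev.fderiv_eq]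
    simp

end Mollification

/-! ### Moving a derivative onto a W^{1,∞} coefficient -/

section BoundaryEstimate

variable {N : ℕ} {Ω : Set (E N)}

theorem exists_ae_abs_le_of_memLp_top {α : Type*} [MeasurableSpace α] {μ : Measure α} {f : α → ℝ}
    (hf : MemLp f ∞ μ) : ∃ B : ℝ, 0 ≤ B ∧ ∀ᵐ x ∂μ, |f x| ≤ B := by
  refine ⟨(eLpNorm f ∞ μ).toReal, ENNReal.toReal_nonneg, ?_⟩
  have h := ae_le_eLpNormEssSup (f := f) (μ := μ)
  filter_upwards [h] with x hx
  rw [← eLpNorm_exponent_top] at hx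
  have := ENNReal.toReal_mono hf.eLpNorm_ne_top hx
  simpa using this

theorem IsLipschitzRegular.isCompact_closure (hΩ : IsLipschitzRegular Ω) : IsCompact (closure Ω) :=
  hΩ.2.1.isCompact_closure

theorem IsLipschitzRegular.memLp_vol (hΩ : IsLipschitzRegular Ω) {φ : E N → ℝ} (hφ : Continuous φ)
    (p : ℝ≥0∞) : MemLp φ p (vol Ω) := by
  have := hΩ.isFiniteMeasure_vol
  obtain ⟨C, hC⟩ := hΩ.isCompact_closure.exists_bound_of_continuousOn hφ.continuousOn
  exact MemLp.of_bound hφ.aestronglyMeasurable C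
    (ae_restrict_of_forall_mem hΩ.1.measurableSet fun x hx => hC x (subset_closure hx))

theorem IsLipschitzRegular.memLp_surf (hΩ : IsLipschitzRegular Ω) {φ : E N → ℝ}
    (hφ : Continuous φ) (p : ℝ≥0∞) : MemLp φ p (surf Ω) := by
  have := hΩ.isFiniteMeasure_surf
  obtain ⟨C, hC⟩ := hΩ.isCompact_closure.exists_bound_of_continuousOn hφ.continuousOn
  exact MemLp.of_bound hφ.aestronglyMeasurable C
    (ae_restrict_of_forall_mem isClosed_frontier.measurableSet
      fun x hx => hC x (frontier_subset_closure hx))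

theorem IsLipschitzRegular.integrable_vol (hΩ : IsLipschitzRegular Ω) {φ : E N → ℝ}
    (hφ : Continuous φ) : Integrable φ (vol Ω) :=
  memLp_one_iff_integrable.1 (hΩ.memLp_vol hφ 1)

theorem IsLipschitzRegular.integrable_surf (hΩ : IsLipschitzRegular Ω) {φ : E N → ℝ}
    (hφ : Continuous φ) : Integrable φ (surf Ω) :=
  memLp_one_iff_integrable.1 (hΩ.memLp_surf hφ 1)

theorem measurableSet_layer (hΩ : IsOpen Ω) (ε : ℝ) :
    MeasurableSet {x | x ∈ Ω ∧ Metric.infDist x Ωᶜ < ε} :=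
  (hΩ.inter (isOpen_lt (Metric.continuous_infDist_pt _) continuous_const)).measurableSet

theorem IsLipschitzRegular.exists_layer_integral_bound (hN : 2 ≤ N) (hΩ : IsLipschitzRegular Ω) :
    ∃ C : ℝ, 0 ≤ C ∧ ∀ v : E N → ℝ, Continuous v → ∀ η : ℝ, 0 < η → ∀ᶠ ε : ℝ in 𝓝[>] 0,
      ∫ x in {x | x ∈ Ω ∧ Metric.infDist x Ωᶜ < ε}, |v x| ≤
        C * ε * (∫ x, |v x| ∂(surf Ω) + η) := by
  obtain ⟨C, hC⟩ := hΩ.exists_layer_bound hN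
  refine ⟨C, C.2, fun v hv η hη => ?_⟩
  filter_upwards [hC v hv ⟨η, hη.le⟩ hη, self_mem_nhdsWithin] with ε h1 h2
  have hε : 0 < ε := h2
  have hi : Integrable v (volume.restrict {x | x ∈ Ω ∧ Metric.infDist x Ωᶜ < ε}) :=
    (hΩ.integrable_vol hv).mono_measure (Measure.restrict_mono (fun x hx => hx.1) le_rfl)
  have hs : 0 ≤ ∫ x, |v x| ∂(surf Ω) := integral_nonneg fun x => abs_nonneg _
  simp only [← Real.norm_eq_abs] at hs ⊢
  rw [← ENNReal.ofReal_le_ofReal_iff (by positivity), ofReal_integral_norm_eq_lintegral_enorm hi,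
    ENNReal.ofReal_mul (by positivity), ENNReal.ofReal_mul C.coe_nonneg, ENNReal.ofReal_add hs hη.le,
    ofReal_integral_norm_eq_lintegral_enorm (hΩ.integrable_surf hv)]
  convert! h1 using 4
  · exact ENNReal.ofReal_coe_nnreal
  · exact ENNReal.ofReal_eq_coe_nnreal hη.le

/-- A `W^{1,∞}` coefficient can be moved off a derivative at the cost of a boundary term. -/
theorem IsLipschitzRegular.exists_integral_mul_partialDeriv_le (hN : 2 ≤ N)
    (hΩ : IsLipschitzRegular Ω) {b : E N → ℝ} (hb : MemW1Infty Ω b) (j : Fin N) :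
    ∃ C : ℝ, 0 ≤ C ∧ ∀ v : E N → ℝ, ContDiff ℝ 1 v →
      |∫ x, b x * partialDeriv j v x ∂(vol Ω)| ≤
        C * (∫ x, |v x| ∂(vol Ω) + ∫ x, |v x| ∂(surf Ω)) := by
  have := hΩ.isFiniteMeasure_vol
  obtain ⟨g, hg, hbg⟩ := hb.2 j
  have hbi : Integrable b (vol Ω) := hb.1.integrable le_top
  have hgi : Integrable g (vol Ω) := hg.integrable le_top
  obtain ⟨B, hB0, hB⟩ := exists_ae_abs_le_of_memLp_top hb.1
  obtain ⟨D, hD0, hD⟩ := exists_ae_abs_le_of_memLp_top hg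
  obtain ⟨C, hC0, hC⟩ := hΩ.exists_layer_integral_bound hN
  -- The factor 2 is the bound of the cutoffs; 5 is the layer width 5ε times their derivative bound
  -- 1/ε. B, D and C bound the coefficient, its weak derivative and the layer integrals.
  refine ⟨2 * D + 5 * B * C, by positivity, fun v hv => ?_⟩
  set I := ∫ x, |v x| ∂(vol Ω) with hI
  set S := ∫ x, |v x| ∂(surf Ω) with hS
  have hI0 : 0 ≤ I := integral_nonneg fun x => abs_nonneg _
  have hS0 : 0 ≤ S := integral_nonneg fun x => abs_nonneg _
  have hvi := hΩ.integrable_vol hv.continuous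
  have hdc := continuous_partialDeriv hv j
  suffices key : ∀ η : ℝ, 0 < η →
      |∫ x, b x * partialDeriv j v x ∂(vol Ω)| ≤ 2 * D * I + 5 * B * C * (S + η) by
    have hlim : Tendsto (fun η : ℝ => 2 * D * I + 5 * B * C * (S + η)) (𝓝[>] 0)
        (𝓝 (2 * D * I + 5 * B * C * (S + 0))) := by
      have : Continuous fun η : ℝ => 2 * D * I + 5 * B * C * (S + η) := by fun_prop
      exact (this.tendsto 0).mono_left nhdsWithin_le_nhds
    have h1 := ge_of_tendsto hlim (by filter_upwards [self_mem_nhdsWithin] with η hη using key η hη)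
    have h2 : 0 ≤ D * S := by positivity
    have h3 : 0 ≤ B * C * I := by positivity
    nlinarith
  intro η hη
  let ε : ℕ → ℝ := fun n => 1 / ((n : ℝ) + 1)
  have hε : ∀ n, 0 < ε n := fun n => by positivity
  have hεlim : Tendsto ε atTop (𝓝 0) := tendsto_one_div_add_atTop_nhds_zero_nat
  have hεlim5 : Tendsto (fun n => 5 * ε n) atTop (𝓝[>] 0) := by
    refine tendsto_nhdsWithin_iff.2 ⟨by simpa using hεlim.const_mul 5, ?_⟩
    exact Eventually.of_forall fun n => by have := hε n; simp only [Set.mem_Ioi]; positivity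
  choose χ c1 c2 c3 c4 c5 c6 c7 using fun n => exists_cutoff hΩ.2.1 (hΩ.ne_univ hN) (hε n)
  have hbd : ∀ {w : E N → ℝ}, Continuous w → Integrable (fun x => b x * w x) (vol Ω) := by
    intro w hw
    obtain ⟨M, hM⟩ := hΩ.isCompact_closure.exists_bound_of_continuousOn hw.continuousOn
    exact hbi.mul_bdd hw.aestronglyMeasurable
      (ae_restrict_of_forall_mem hΩ.1.measurableSet fun x hx => hM x (subset_closure hx))
  -- The cutoffs tend to 1 at every point of Ω, so dominated convergence removes them in the limit.
  have hlim : Tendsto (fun n => |∫ x, b x * (χ n x * partialDeriv j v x) ∂(vol Ω)|) atTop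
      (𝓝 |∫ x, b x * partialDeriv j v x ∂(vol Ω)|) := by
    refine (tendsto_integral_of_dominated_convergence
      (fun x => 2 * ‖b x * partialDeriv j v x‖) (fun n => ?_) ((hbd hdc).norm.const_mul 2)
      (fun n => ae_of_all _ fun x => ?_) ?_).abs
    · exact (hbd ((c1 n).continuous.mul hdc)).aestronglyMeasurable
    · rw [show b x * (χ n x * partialDeriv j v x) = χ n x * (b x * partialDeriv j v x) by ring,
        norm_mul]
      gcongr
      exact c4 n x
    · refine ae_restrict_of_forall_mem hΩ.1.measurableSet fun x hx => ?_
      have hpos : 0 < Metric.infDist x Ωᶜ :=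
        (hΩ.1.isClosed_compl.notMem_iff_infDist_pos
          (Set.nonempty_compl.2 (hΩ.ne_univ hN))).1 (by simpa using hx)
      refine tendsto_const_nhds.congr' ?_
      have h4 : Tendsto (fun n => 4 * ε n) atTop (𝓝 0) := by simpa using hεlim.const_mul 4
      filter_upwards [h4.eventually (gt_mem_nhds hpos)] with n hn
      rw [c5 n x hn, one_mul]
  refine le_of_tendsto hlim ?_
  filter_upwards [hεlim5.eventually (hC v hv.continuous η hη)] with n hn
  set Λ := {x | x ∈ Ω ∧ Metric.infDist x Ωᶜ < 5 * ε n} with hΛ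
  have hΛm : MeasurableSet Λ := measurableSet_layer hΩ.1 _
  have hprod : ContDiff ℝ 1 fun x => χ n x * v x := (c1 n).mul hv
  -- With the compactly supported test function χ_n v the product rule leaves one error term,
  -- carried by the derivative of χ_n and hence by the boundary layer.
  have htest := hbg.integral_mul_partialDeriv hΩ.1 hbi hgi hprod (c2 n).mul_right
    ((tsupport_mul_subset_left).trans (c3 n))
  have hχd := continuous_partialDeriv (c1 n) j
  simp only [partialDeriv_mul (c1 n) hv, mul_add] at htest
  rw [integral_add (hbd (w := fun x => χ n x * partialDeriv j v x) ((c1 n).continuous.mul hdc))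
    (hbd (w := fun x => v x * partialDeriv j (χ n) x) (hv.continuous.mul hχd))] at htest
  have e : ∫ x, b x * (χ n x * partialDeriv j v x) ∂(vol Ω) =
      -(∫ x, g x * (χ n x * v x) ∂(vol Ω)) - ∫ x, b x * (v x * partialDeriv j (χ n) x) ∂(vol Ω) := by
    linarith
  have b1 : |∫ x, g x * (χ n x * v x) ∂(vol Ω)| ≤ 2 * D * I := by
    rw [hI, ← integral_const_mul, ← Real.norm_eq_abs]
    refine norm_integral_le_of_norm_le (hvi.abs.const_mul _) ?_
    filter_upwards [hD] with x hx
    rw [norm_mul, norm_mul, Real.norm_eq_abs, Real.norm_eq_abs, Real.norm_eq_abs]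
    calc |g x| * (|χ n x| * |v x|) ≤ D * (2 * |v x|) := by gcongr; exact c4 n x
      _ = 2 * D * |v x| := by ring
  have b2 : |∫ x, b x * (v x * partialDeriv j (χ n) x) ∂(vol Ω)| ≤ 5 * B * C * (S + η) := by
    have hind : Integrable (Λ.indicator fun x => |v x|) (vol Ω) := hvi.abs.indicator hΛm
    have h1 : |∫ x, b x * (v x * partialDeriv j (χ n) x) ∂(vol Ω)| ≤
        B * (ε n)⁻¹ * ∫ x, Λ.indicator (fun x => |v x|) x ∂(vol Ω) := by
      rw [← integral_const_mul, ← Real.norm_eq_abs]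
      refine norm_integral_le_of_norm_le (hind.const_mul _) ?_
      filter_upwards [hB] with x hx
      by_cases hxΛ : x ∈ Λ
      · rw [Set.indicator_of_mem hxΛ, norm_mul, norm_mul, Real.norm_eq_abs, Real.norm_eq_abs,
          Real.norm_eq_abs]
        calc |b x| * (|v x| * |partialDeriv j (χ n) x|) ≤ B * (|v x| * (ε n)⁻¹) := by
              gcongr; exact c6 n j x
          _ = B * (ε n)⁻¹ * |v x| := by ring
      · rw [c7 n j x hxΛ]; simp [hxΛ]
    have h2 : ∫ x, Λ.indicator (fun x => |v x|) x ∂(vol Ω) = ∫ x in Λ, |v x| := by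
      rw [integral_indicator hΛm, Measure.restrict_restrict hΛm,
        Set.inter_eq_left.2 (fun x hx => hx.1)]
    rw [h2] at h1
    refine h1.trans ?_
    have hεn := hε n
    calc B * (ε n)⁻¹ * ∫ x in Λ, |v x| ≤ B * (ε n)⁻¹ * (C * (5 * ε n) * (S + η)) := by gcongr
      _ = 5 * B * C * (S + η) := by field_simp
  rw [e]
  refine (abs_sub _ _).trans ?_
  rw [abs_neg]
  exact add_le_add b1 b2

end BoundaryEstimate

/-! ### Bounded bilinear forms on L² given by L^∞ weights -/

section WeightedForm

variable {α : Type*} [MeasurableSpace α] {μ : Measure α}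

theorem integrable_mul_of_memLp_two {f g : α → ℝ} (hf : MemLp f 2 μ) (hg : MemLp g 2 μ) :
    Integrable (fun x => f x * g x) μ :=
  hf.integrable_mul hg

theorem integrable_weight_mul_mul {k f g : α → ℝ} (hk : MemLp k ∞ μ) (hf : MemLp f 2 μ)
    (hg : MemLp g 2 μ) : Integrable (fun x => k x * f x * g x) μ := by
  obtain ⟨B, _, hB⟩ := exists_ae_abs_le_of_memLp_top hk
  simp only [mul_assoc]
  exact (integrable_mul_of_memLp_two hf hg).bdd_mul hk.1 hB

theorem inner_eq_integral_mul (f g : Lp ℝ 2 μ) : inner ℝ f g = ∫ x, f x * g x ∂μ := by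
  rw [L2.inner_def]
  simp [mul_comm]

theorem integral_abs_mul_abs_le (f g : Lp ℝ 2 μ) : ∫ x, |f x| * |g x| ∂μ ≤ ‖f‖ * ‖g‖ := by
  have h := real_inner_le_norm |f| |g|
  rw [norm_abs_eq_norm, norm_abs_eq_norm, inner_eq_integral_mul] at h
  refine le_of_eq_of_le (integral_congr_ae ?_) h
  filter_upwards [Lp.coeFn_abs f, Lp.coeFn_abs g] with x h1 h2
  rw [h1, h2]

theorem abs_integral_weight_le {k : α → ℝ} {B : ℝ} (hB0 : 0 ≤ B) (hB : ∀ᵐ x ∂μ, |k x| ≤ B)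
    (f g : Lp ℝ 2 μ) : |∫ x, k x * f x * g x ∂μ| ≤ B * ‖f‖ * ‖g‖ := by
  have h1 : |∫ x, k x * f x * g x ∂μ| ≤ ∫ x, B * (|f x| * |g x|) ∂μ := by
    rw [← Real.norm_eq_abs]
    refine norm_integral_le_of_norm_le
      ((integrable_mul_of_memLp_two (Lp.memLp f).abs (Lp.memLp g).abs).const_mul B) ?_
    filter_upwards [hB] with x hx
    rw [norm_mul, norm_mul, Real.norm_eq_abs, Real.norm_eq_abs, Real.norm_eq_abs, mul_assoc]
    gcongr
  rw [integral_const_mul] at h1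
  refine h1.trans ?_
  rw [mul_assoc]
  gcongr
  exact integral_abs_mul_abs_le f g

/-- The bounded bilinear form `(f, g) ↦ ∫ k f g` on `L²`. -/
def weightedForm {k : α → ℝ} (hk : MemLp k ∞ μ) : Lp ℝ 2 μ →L[ℝ] Lp ℝ 2 μ →L[ℝ] ℝ :=
  LinearMap.mkContinuous₂
    (LinearMap.mk₂ ℝ (fun f g : Lp ℝ 2 μ => ∫ x, k x * f x * g x ∂μ)
      (fun f f' g => by
        rw [← integral_add (integrable_weight_mul_mul hk (Lp.memLp f) (Lp.memLp g))
          (integrable_weight_mul_mul hk (Lp.memLp f') (Lp.memLp g))]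
        refine integral_congr_ae ?_
        filter_upwards [Lp.coeFn_add f f'] with x hx
        rw [hx, Pi.add_apply]; ring)
      (fun c f g => by
        rw [smul_eq_mul, ← integral_const_mul]
        refine integral_congr_ae ?_
        filter_upwards [Lp.coeFn_smul c f] with x hx
        rw [hx, Pi.smul_apply, smul_eq_mul]; ring)
      (fun f g g' => by
        rw [← integral_add (integrable_weight_mul_mul hk (Lp.memLp f) (Lp.memLp g))
          (integrable_weight_mul_mul hk (Lp.memLp f) (Lp.memLp g'))]
        refine integral_congr_ae ?_
        filter_upwards [Lp.coeFn_add g g'] with x hx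
        rw [hx, Pi.add_apply]; ring)
      (fun c f g => by
        rw [smul_eq_mul, ← integral_const_mul]
        refine integral_congr_ae ?_
        filter_upwards [Lp.coeFn_smul c g] with x hx
        rw [hx, Pi.smul_apply, smul_eq_mul]; ring))
    (exists_ae_abs_le_of_memLp_top hk).choose
    (fun f g => by
      have h := (exists_ae_abs_le_of_memLp_top hk).choose_spec
      simpa using abs_integral_weight_le h.1 h.2 f g)

theorem weightedForm_apply {k : α → ℝ} (hk : MemLp k ∞ μ) (f g : Lp ℝ 2 μ) :
    weightedForm hk f g = ∫ x, k x * f x * g x ∂μ := rfl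

end WeightedForm

/-! ### The Hilbert space of triples and the form domain -/

section GraphSpace

variable {N : ℕ}

/-- The space `L²(Ω) ⊕ L²(∂Ω) ⊕ L²(Ω)ᴺ`. -/
abbrev W (Ω : Set (E N)) : Type := WithLp 2 (H Ω × PiLp 2 fun _ : Fin N => L2Int Ω)

/-- The triples `(φ|_Ω, φ|_∂Ω, ∇φ)` with `φ` of class `C¹`. -/
def smoothTriples (Ω : Set (E N)) : Submodule ℝ (W Ω) where
  carrier := {ξ | ∃ φ : E N → ℝ, ContDiff ℝ 1 φ ∧ ξ.fst.fst =ᵐ[vol Ω] φ ∧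
    ξ.fst.snd =ᵐ[surf Ω] φ ∧ ∀ i, ξ.snd i =ᵐ[vol Ω] partialDeriv i φ}
  add_mem' := by
    rintro ξ ζ ⟨φ, h1, h2, h3, h4⟩ ⟨χ, k1, k2, k3, k4⟩
    refine ⟨φ + χ, h1.add k1, ?_, ?_, fun i => ?_⟩
    · exact (Lp.coeFn_add _ _).trans (h2.add k2)
    · exact (Lp.coeFn_add _ _).trans (h3.add k3)
    · refine (Lp.coeFn_add _ _).trans (((h4 i).add (k4 i)).trans (ae_of_all _ fun x => ?_))
      simp only [partialDeriv, Pi.add_apply]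
      rw [fderiv_add (h1.differentiable one_ne_zero x) (k1.differentiable one_ne_zero x)]
      rfl
  zero_mem' := by
    refine ⟨0, contDiff_const, Lp.coeFn_zero _ _ _, Lp.coeFn_zero _ _ _, fun i => ?_⟩
    refine (Lp.coeFn_zero _ _ _).trans (ae_of_all _ fun x => ?_)
    simp only [partialDeriv]
    rw [fderiv_zero]; rfl
  smul_mem' := by
    rintro c ξ ⟨φ, h1, h2, h3, h4⟩
    refine ⟨c • φ, h1.const_smul c, ?_, ?_, fun i => ?_⟩
    · exact (Lp.coeFn_smul _ _).trans (h2.const_smul c)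
    · exact (Lp.coeFn_smul _ _).trans (h3.const_smul c)
    · refine (Lp.coeFn_smul _ _).trans (((h4 i).const_smul c).trans (ae_of_all _ fun x => ?_))
      simp only [partialDeriv, Pi.smul_apply]
      rw [fderiv_const_smul (h1.differentiable one_ne_zero x)]
      rfl

/-- The Hilbert space of all `(u, u|_∂Ω, ∇u)` with `u ∈ H¹(Ω)`. -/
def graphSpace (Ω : Set (E N)) : Submodule ℝ (W Ω) := (smoothTriples Ω).topologicalClosure

variable {Ω : Set (E N)}

/-- The component maps. -/
def comp₁ (Ω : Set (E N)) : W Ω →L[ℝ] H Ω := WithLp.fstL 2 ℝ _ _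

def compInt (Ω : Set (E N)) : W Ω →L[ℝ] L2Int Ω := (WithLp.fstL 2 ℝ _ _).comp (comp₁ Ω)

def compBdry (Ω : Set (E N)) : W Ω →L[ℝ] L2Bdry Ω := (WithLp.sndL 2 ℝ _ _).comp (comp₁ Ω)

def compGrad (Ω : Set (E N)) (i : Fin N) : W Ω →L[ℝ] L2Int Ω :=
  (PiLp.proj 2 (fun _ : Fin N => L2Int Ω) i).comp (WithLp.sndL 2 ℝ _ _)

@[simp] theorem compInt_apply (ξ : W Ω) : compInt Ω ξ = ξ.fst.fst := rfl
@[simp] theorem compBdry_apply (ξ : W Ω) : compBdry Ω ξ = ξ.fst.snd := rfl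
@[simp] theorem compGrad_apply (i : Fin N) (ξ : W Ω) : compGrad Ω i ξ = ξ.snd i := rfl

/-- Assemble an element of `W Ω`. -/
def mkW (u : L2Int Ω) (g : L2Bdry Ω) (p : Fin N → L2Int Ω) : W Ω :=
  WithLp.toLp 2 (WithLp.toLp 2 (u, g), WithLp.toLp 2 p)

theorem continuous_mkW :
    Continuous fun q : L2Int Ω × L2Bdry Ω × (Fin N → L2Int Ω) => mkW q.1 q.2.1 q.2.2 := by
  have h1 : Continuous fun q : L2Int Ω × L2Bdry Ω × (Fin N → L2Int Ω) =>
      (WithLp.toLp 2 (q.1, q.2.1) : H Ω) :=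
    (WithLp.prod_continuous_toLp 2 _ _).comp (by fun_prop)
  have h2 : Continuous fun q : L2Int Ω × L2Bdry Ω × (Fin N → L2Int Ω) =>
      (WithLp.toLp 2 q.2.2 : PiLp 2 fun _ : Fin N => L2Int Ω) :=
    (PiLp.continuous_toLp 2 _).comp (by fun_prop)
  exact (WithLp.prod_continuous_toLp 2 _ _).comp (h1.prodMk h2)

theorem tendsto_Lp_iff_of_ae_eq {α : Type*} [MeasurableSpace α] {μ : Measure α} {f : ℕ → Lp ℝ 2 μ}
    {φ : ℕ → α → ℝ} (hf : ∀ n, f n =ᵐ[μ] φ n) (g : Lp ℝ 2 μ) :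
    Tendsto f atTop (𝓝 g) ↔ Tendsto (fun n => eLpNorm (fun x => φ n x - g x) 2 μ) atTop (𝓝 0) := by
  rw [Lp.tendsto_Lp_iff_tendsto_eLpNorm']
  refine tendsto_congr fun n => eLpNorm_congr_ae ?_
  filter_upwards [hf n] with x hx
  simp [hx]

/-- Closure in a metric space is sequential closure, and convergence in `W Ω` is convergence of
components. This is the approximation in `IsTrace`, with an arbitrary vector in the place of the
gradient. -/
theorem mem_graphSpace_iff (hΩ : IsLipschitzRegular Ω) {ξ : W Ω} : ξ ∈ graphSpace Ω ↔
    ∃ φ : ℕ → E N → ℝ, (∀ n, ContDiff ℝ 1 (φ n)) ∧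
      Tendsto (fun n => eLpNorm (fun x => φ n x - ξ.fst.fst x) 2 (vol Ω)) atTop (𝓝 0) ∧
      (∀ i, Tendsto (fun n => eLpNorm (fun x => partialDeriv i (φ n) x - ξ.snd i x) 2 (vol Ω))
        atTop (𝓝 0)) ∧
      Tendsto (fun n => eLpNorm (fun x => φ n x - ξ.fst.snd x) 2 (surf Ω)) atTop (𝓝 0) := by
  rw [graphSpace, ← SetLike.mem_coe, Submodule.topologicalClosure_coe, mem_closure_iff_seq_limit]
  constructor
  · rintro ⟨s, hs, hlim⟩
    choose φ h1 h2 h3 h4 using hs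
    refine ⟨φ, h1, ?_, fun i => ?_, ?_⟩
    · exact (tendsto_Lp_iff_of_ae_eq h2 _).1 (((compInt Ω).continuous.tendsto ξ).comp hlim)
    · exact (tendsto_Lp_iff_of_ae_eq (fun n => h4 n i) _).1
        (((compGrad Ω i).continuous.tendsto ξ).comp hlim)
    · exact (tendsto_Lp_iff_of_ae_eq h3 _).1 (((compBdry Ω).continuous.tendsto ξ).comp hlim)
  · rintro ⟨φ, h1, h2, h3, h4⟩
    have m1 := fun n => hΩ.memLp_vol (h1 n).continuous 2
    have m2 := fun n => hΩ.memLp_surf (h1 n).continuous 2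
    have m3 := fun n i => hΩ.memLp_vol (continuous_partialDeriv (h1 n) i) 2
    refine ⟨fun n => mkW (m1 n).toLp (m2 n).toLp fun i => (m3 n i).toLp, fun n =>
      ⟨φ n, h1 n, (m1 n).coeFn_toLp, (m2 n).coeFn_toLp, fun i => (m3 n i).coeFn_toLp⟩, ?_⟩
    have t1 := (tendsto_Lp_iff_of_ae_eq (fun n => (m1 n).coeFn_toLp) ξ.fst.fst).2 h2
    have t2 := (tendsto_Lp_iff_of_ae_eq (fun n => (m2 n).coeFn_toLp) ξ.fst.snd).2 h4
    have t3 := fun i => (tendsto_Lp_iff_of_ae_eq (fun n => (m3 n i).coeFn_toLp) (ξ.snd i)).2 (h3 i)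
    exact (continuous_mkW.tendsto (ξ.fst.fst, ξ.fst.snd, fun i => ξ.snd i)).comp
      (t1.prodMk_nhds (t2.prodMk_nhds (tendsto_pi_nhds.2 t3)))

theorem hasWeakPartial_of_contDiff {φ : E N → ℝ} (hφ : ContDiff ℝ 1 φ)
    (i : Fin N) : HasWeakPartial Ω i φ (partialDeriv i φ) := by
  intro θ h1 h2 h3
  have hθ : ContDiff ℝ 1 θ := h1.of_le (by exact_mod_cast le_top)
  have hz : ∀ x, x ∉ Ω → θ x = 0 := fun x hx => image_eq_zero_of_notMem_tsupport fun h => hx (h3 h)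
  have hz' : ∀ x, x ∉ Ω → partialDeriv i θ x = 0 := fun x hx => by
    have : x ∉ tsupport (fderiv ℝ θ) := fun h => hx (h3 (tsupport_fderiv_subset ℝ h))
    rw [partialDeriv, image_eq_zero_of_notMem_tsupport this]; rfl
  rw [setIntegral_eq_integral_of_forall_compl_eq_zero (fun x hx => by rw [hz' x hx, mul_zero]),
    setIntegral_eq_integral_of_forall_compl_eq_zero (fun x hx => by rw [hz x hx, mul_zero])]
  have hint : ∀ {f g : E N → ℝ}, Continuous f → Continuous g → HasCompactSupport g →
      Integrable (fun x => f x * g x) (volume : Measure (E N)) := fun hf hg hc =>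
    (hf.mul hg).integrable_of_hasCompactSupport hc.mul_left
  exact integral_mul_fderiv_eq_neg_fderiv_mul_of_integrable
    (hint (continuous_partialDeriv hφ i) hθ.continuous h2)
    (hint hφ.continuous (continuous_partialDeriv hθ i) (hasCompactSupport_partialDeriv h2 i))
    (hint hφ.continuous hθ.continuous h2) (fun x _ => hφ.differentiable one_ne_zero x)
    (fun x _ => hθ.differentiable one_ne_zero x)

theorem hasWeakPartial_congr {u u' g g' : E N → ℝ} {i : Fin N} (hu : u =ᵐ[vol Ω] u')
    (hg : g =ᵐ[vol Ω] g') (h : HasWeakPartial Ω i u g) : HasWeakPartial Ω i u' g' := by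
  intro θ h1 h2 h3
  have e1 : ∫ x, u' x * partialDeriv i θ x ∂(vol Ω) = ∫ x, u x * partialDeriv i θ x ∂(vol Ω) :=
    integral_congr_ae (by filter_upwards [hu] with x hx; rw [hx])
  have e2 : ∫ x, g' x * θ x ∂(vol Ω) = ∫ x, g x * θ x ∂(vol Ω) :=
    integral_congr_ae (by filter_upwards [hg] with x hx; rw [hx])
  rw [e1, e2]
  exact h θ h1 h2 h3

/-- For a fixed test function the defining identity is an equality of inner products, hence a closed
condition; on smooth triples it is integration by parts. -/
theorem hasWeakPartial_of_mem_graphSpace (hΩ : IsLipschitzRegular Ω) {ξ : W Ω}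
    (hξ : ξ ∈ graphSpace Ω) (i : Fin N) : HasWeakPartial Ω i ξ.fst.fst (ξ.snd i) := by
  intro θ h1 h2 h3
  have hθ : ContDiff ℝ 1 θ := h1.of_le (by exact_mod_cast le_top)
  have m1 := hΩ.memLp_vol (continuous_partialDeriv hθ i) 2
  have m2 := hΩ.memLp_vol hθ.continuous 2
  have e1 : ∀ u : L2Int Ω, ∫ x, u x * partialDeriv i θ x ∂(vol Ω) = inner ℝ u m1.toLp := by
    intro u
    rw [inner_eq_integral_mul]
    exact integral_congr_ae (by filter_upwards [m1.coeFn_toLp] with x hx; rw [hx])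
  have e2 : ∀ u : L2Int Ω, ∫ x, u x * θ x ∂(vol Ω) = inner ℝ u m2.toLp := by
    intro u
    rw [inner_eq_integral_mul]
    exact integral_congr_ae (by filter_upwards [m2.coeFn_toLp] with x hx; rw [hx])
  rw [e1, e2]
  have hclosed : IsClosed {ξ : W Ω | inner ℝ (compInt Ω ξ) m1.toLp =
      -inner ℝ (compGrad Ω i ξ) m2.toLp} :=
    isClosed_eq (by fun_prop) (by fun_prop)
  refine closure_minimal ?_ hclosed hξ
  rintro ζ ⟨φ, k1, k2, -, k4⟩
  have := hasWeakPartial_congr k2.symm (k4 i).symm (hasWeakPartial_of_contDiff k1 i) θ h1 h2 h3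
  rw [e1, e2] at this
  exact this

theorem HasWeakPartial.unique (hΩ : IsLipschitzRegular Ω) {i : Fin N} {u : E N → ℝ} {g g' : L2Int Ω}
    (h : HasWeakPartial Ω i u g) (h' : HasWeakPartial Ω i u g') : g = g' := by
  have := hΩ.isFiniteMeasure_vol
  have i1 : Integrable g (vol Ω) := (Lp.memLp g).integrable one_le_two
  have i2 : Integrable g' (vol Ω) := (Lp.memLp g').integrable one_le_two
  have hz : ∀ᵐ x ∂(volume : Measure (E N)), x ∈ Ω → (g x - g' x) = 0 := by
    refine hΩ.1.ae_eq_zero_of_integral_contDiff_smul_eq_zero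
      (IntegrableOn.locallyIntegrableOn (i1.sub i2)) fun θ h1 h2 h3 => ?_
    have hθz : ∀ x, x ∉ Ω → θ x = 0 := fun x hx =>
      image_eq_zero_of_notMem_tsupport fun h => hx (h3 h)
    rw [← setIntegral_eq_integral_of_forall_compl_eq_zero (s := Ω)
      (fun x hx => by rw [hθz x hx, zero_smul])]
    have e := (h θ h1 h2 h3).symm.trans (h' θ h1 h2 h3)
    obtain ⟨C, hC⟩ := h1.continuous.bounded_above_of_compact_support h2
    have j1 := i1.mul_bdd h1.continuous.aestronglyMeasurable (ae_of_all _ hC)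
    have j2 := i2.mul_bdd h1.continuous.aestronglyMeasurable (ae_of_all _ hC)
    have e3 : ∫ x, θ x • (g x - g' x) ∂(vol Ω) =
        ∫ x, g x * θ x ∂(vol Ω) - ∫ x, g' x * θ x ∂(vol Ω) := by
      rw [← integral_sub j1 j2]
      exact integral_congr_ae (ae_of_all _ fun x => by simp only [smul_eq_mul]; ring)
    rw [e3, neg_inj.1 e, sub_self]
  refine Lp.ext ?_
  filter_upwards [(ae_restrict_iff' hΩ.1.measurableSet).2 hz] with x hx
  exact sub_eq_zero.1 hx

theorem weakPartial_eq (hΩ : IsLipschitzRegular Ω) {i : Fin N} {u g : L2Int Ω}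
    (h : HasWeakPartial Ω i u g) : weakPartial Ω i u = g := by
  have hex : ∃ g : L2Int Ω, HasWeakPartial Ω i u g := ⟨g, h⟩
  rw [weakPartial, dif_pos hex]
  exact hex.choose_spec.unique hΩ h

theorem weakPartial_of_mem_graphSpace (hΩ : IsLipschitzRegular Ω) {ξ : W Ω}
    (hξ : ξ ∈ graphSpace Ω) (i : Fin N) : weakPartial Ω i ξ.fst.fst = ξ.snd i :=
  weakPartial_eq hΩ (hasWeakPartial_of_mem_graphSpace hΩ hξ i)

/-- The third component of an element of the closure must be the weak gradient of the first, so the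
space of triples carries no more information than H¹ with approximated traces. -/
theorem mem_formDomain_iff (hΩ : IsLipschitzRegular Ω) {x : H Ω} :
    x ∈ formDomain Ω ↔ ∃ ξ ∈ graphSpace Ω, ξ.fst = x := by
  constructor
  · rintro ⟨-, φ, h1, h2, h3, h4⟩
    exact ⟨WithLp.toLp 2 (x, WithLp.toLp 2 fun i => weakPartial Ω i x.fst),
      (mem_graphSpace_iff hΩ).2 ⟨φ, h1, h2, h3, h4⟩, rfl⟩
  · rintro ⟨ξ, hξ, rfl⟩
    refine ⟨fun i => ⟨_, hasWeakPartial_of_mem_graphSpace hΩ hξ i⟩, ?_⟩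
    obtain ⟨φ, h1, h2, h3, h4⟩ := (mem_graphSpace_iff hΩ).1 hξ
    refine ⟨φ, h1, h2, fun i => ?_, h4⟩
    rw [weakPartial_of_mem_graphSpace hΩ hξ i]
    exact h3 i

end GraphSpace

/-! ### A C¹ truncation and its algebraic inequalities -/

section Truncation

/-- A `C¹` substitute for the positive part. -/
def trunc (s : ℝ) : ℝ := max s 0 ^ 2 / (1 + max s 0)

/-- The derivative of `trunc`. -/
def truncDeriv (s : ℝ) : ℝ := 1 - 1 / (1 + max s 0) ^ 2

theorem continuous_truncDeriv : Continuous truncDeriv := by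
  unfold truncDeriv
  refine continuous_const.sub (continuous_const.div (by fun_prop) fun s => ?_)
  have : 0 ≤ max s 0 := le_max_right _ _
  positivity

theorem trunc_of_nonpos {s : ℝ} (hs : s ≤ 0) : trunc s = 0 := by simp [trunc, max_eq_right hs]

theorem truncDeriv_of_nonpos {s : ℝ} (hs : s ≤ 0) : truncDeriv s = 0 := by
  simp [truncDeriv, max_eq_right hs]

theorem trunc_of_nonneg {s : ℝ} (hs : 0 ≤ s) : trunc s = s ^ 2 / (1 + s) := by
  simp [trunc, max_eq_left hs]

theorem truncDeriv_of_nonneg {s : ℝ} (hs : 0 ≤ s) : truncDeriv s = 1 - 1 / (1 + s) ^ 2 := by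
  simp [truncDeriv, max_eq_left hs]

theorem hasDerivAt_trunc (s : ℝ) : HasDerivAt trunc (truncDeriv s) s := by
  have hcont : Continuous trunc := by
    unfold trunc
    refine Continuous.div (by fun_prop) (by fun_prop) fun s => ?_
    have : 0 ≤ max s 0 := le_max_right _ _
    positivity
  have hne : ∀ y ≠ (0 : ℝ), HasDerivAt trunc (truncDeriv y) y := by
    intro y hy
    rcases lt_or_gt_of_ne hy with h | h
    · rw [truncDeriv_of_nonpos h.le]
      refine (hasDerivAt_const y (0 : ℝ)).congr_of_eventuallyEq ?_
      filter_upwards [gt_mem_nhds h] with t ht using trunc_of_nonpos ht.le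
    · have h1 : (1 : ℝ) + y ≠ 0 := by positivity
      have hd : HasDerivAt (fun t : ℝ => t ^ 2 / (1 + t)) (truncDeriv y) y := by
        have := ((hasDerivAt_id y).pow 2).div ((hasDerivAt_id y).const_add 1) h1
        convert! this using 1
        rw [truncDeriv_of_nonneg h.le]
        simp only [id, Pi.pow_apply]
        field_simp
        push_cast
        ring
      refine hd.congr_of_eventuallyEq ?_
      filter_upwards [lt_mem_nhds h] with t ht using trunc_of_nonneg ht.le
  rcases eq_or_ne s 0 with rfl | hs
  -- At the junction point the derivative is obtained as the limit of the derivatives on either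
  -- side.
  · exact hasDerivAt_of_hasDerivAt_of_ne hne hcont.continuousAt continuous_truncDeriv.continuousAt
  · exact hne s hs

theorem truncDeriv_nonneg (s : ℝ) : 0 ≤ truncDeriv s := by
  have h : 0 ≤ max s 0 := le_max_right _ _
  rw [truncDeriv, sub_nonneg, div_le_one (by positivity)]
  nlinarith

theorem truncDeriv_le_one (s : ℝ) : truncDeriv s ≤ 1 := by
  have h : 0 ≤ max s 0 := le_max_right _ _
  rw [truncDeriv, sub_le_self_iff]
  positivity

theorem trunc_nonneg (s : ℝ) : 0 ≤ trunc s := by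
  have h : 0 ≤ max s 0 := le_max_right _ _
  rw [trunc]; positivity

theorem mul_trunc_nonneg (s : ℝ) : 0 ≤ s * trunc s := by
  rcases le_total s 0 with h | h
  · rw [trunc_of_nonpos h, mul_zero]
  · exact mul_nonneg h (trunc_nonneg s)

/-- For s > 0 the ratio of s² G'(s) to s G(s) is (s + 2)/(s + 1) ≤ 2. Together with `trunc_sq_le`
this is what the choice of G is made for: drift terms containing s G'(s) or G(s) can be split by
Young's inequality into a multiple of G'(s)|p|² and a multiple of s G(s). -/
theorem sq_mul_truncDeriv_le (s : ℝ) : s ^ 2 * truncDeriv s ≤ 2 * (s * trunc s) := by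
  rcases le_total s 0 with h | h
  · simp [trunc_of_nonpos h, truncDeriv_of_nonpos h]
  · rw [trunc_of_nonneg h, truncDeriv_of_nonneg h]
    have h1 : 0 < 1 + s := by positivity
    have e : 2 * (s * (s ^ 2 / (1 + s))) - s ^ 2 * (1 - 1 / (1 + s) ^ 2) = s ^ 4 / (1 + s) ^ 2 := by
      field_simp; ring
    have : 0 ≤ s ^ 4 / (1 + s) ^ 2 := by positivity
    linarith

theorem trunc_sq_le (s : ℝ) : trunc s ^ 2 ≤ truncDeriv s * (s * trunc s) := by
  rcases le_total s 0 with h | h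
  · simp [trunc_of_nonpos h]
  · rw [trunc_of_nonneg h, truncDeriv_of_nonneg h]
    have h1 : 0 < 1 + s := by positivity
    have e : (1 - 1 / (1 + s) ^ 2) * (s * (s ^ 2 / (1 + s))) - (s ^ 2 / (1 + s)) ^ 2 =
        s ^ 4 / (1 + s) ^ 3 := by
      field_simp; ring
    have : 0 ≤ s ^ 4 / (1 + s) ^ 3 := by positivity
    linarith

theorem nonpos_of_mul_trunc_eq_zero {s : ℝ} (h : s * trunc s = 0) : s ≤ 0 := by
  by_contra! hs
  rw [trunc_of_nonneg hs.le] at h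
  have : 0 < s * (s ^ 2 / (1 + s)) := by positivity
  linarith

end Truncation

/-! ### The chain rule in the space of triples -/

section ChainRule

variable {N : ℕ} {Ω : Set (E N)}

/-- Dominated convergence in `L²` for multipliers. -/
theorem tendsto_eLpNorm_mul_of_ae {α : Type*} [MeasurableSpace α] {μ : Measure α} {m : ℕ → α → ℝ}
    {p : α → ℝ} (hm : ∀ n, AEStronglyMeasurable (m n) μ) (hp : MemLp p 2 μ) {C : ℝ}
    (hC : ∀ n x, |m n x| ≤ C) (hlim : ∀ᵐ x ∂μ, Tendsto (fun n => m n x) atTop (𝓝 0)) :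
    Tendsto (fun n => eLpNorm (fun x => m n x * p x) 2 μ) atTop (𝓝 0) := by
  have key : Tendsto (fun n => ∫⁻ x, ‖m n x * p x‖ₑ ^ (2 : ℝ) ∂μ) atTop (𝓝 (∫⁻ _, 0 ∂μ)) := by
    have hbd : MemLp (fun x => C * p x) 2 μ := hp.const_mul C
    refine tendsto_lintegral_of_dominated_convergence' (fun x => ‖C * p x‖ₑ ^ (2 : ℝ))
      (fun n => ((hm n).mul hp.1).enorm.pow_const _) (fun n => ae_of_all _ fun x => ?_) ?_ ?_
    · refine ENNReal.rpow_le_rpow ?_ zero_le_two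
      rw [enorm_le_iff_norm_le, norm_mul, norm_mul]
      gcongr
      exact (hC n x).trans (le_abs_self C)
    · have := lintegral_rpow_enorm_lt_top_of_eLpNorm_lt_top two_ne_zero ENNReal.ofNat_ne_top
        hbd.eLpNorm_lt_top
      simpa using this.ne
    · filter_upwards [hlim] with x hx
      have h1 : Tendsto (fun n => m n x * p x) atTop (𝓝 (0 * p x)) := hx.mul_const _
      have h2 := (ENNReal.continuous_rpow_const (y := 2)).tendsto _ |>.comp h1.enorm
      simpa [Function.comp_def] using h2
  simp only [lintegral_zero] at key
  have h3 := ((ENNReal.continuous_rpow_const (y := 1 / 2)).tendsto 0).comp key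
  rw [ENNReal.zero_rpow_of_pos (by norm_num)] at h3
  refine h3.congr fun n => ?_
  rw [eLpNorm_eq_lintegral_rpow_enorm_toReal two_ne_zero ENNReal.ofNat_ne_top]
  simp

/-- The chain rule in the graph space. -/
theorem exists_comp_mem_graphSpace (hΩ : IsLipschitzRegular Ω) {F F' : ℝ → ℝ}
    (hF : ∀ s, HasDerivAt F (F' s) s) (hF' : Continuous F') (hb : ∀ s, |F' s| ≤ 1) (h0 : F 0 = 0)
    {ξ : W Ω} (hξ : ξ ∈ graphSpace Ω) : ∃ ζ ∈ graphSpace Ω,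
      (ζ.fst.fst =ᵐ[vol Ω] fun x => F (ξ.fst.fst x)) ∧
      (ζ.fst.snd =ᵐ[surf Ω] fun x => F (ξ.fst.snd x)) ∧
      ∀ i, ζ.snd i =ᵐ[vol Ω] fun x => F' (ξ.fst.fst x) * ξ.snd i x := by
  have hlip : LipschitzWith 1 F := by
    refine lipschitzWith_of_nnnorm_deriv_le (fun s => (hF s).differentiableAt) fun s => ?_
    rw [(hF s).deriv, ← NNReal.coe_le_coe]
    simpa using hb s
  have hF1 : ContDiff ℝ 1 F := by
    rw [contDiff_one_iff_deriv]
    refine ⟨fun s => (hF s).differentiableAt, ?_⟩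
    rwa [show deriv F = F' from funext fun s => (hF s).deriv]
  obtain ⟨φ, h1, h2, h3, h4⟩ := (mem_graphSpace_iff hΩ).1 hξ
  have hmeas : TendstoInMeasure (vol Ω) φ atTop ξ.fst.fst :=
    tendstoInMeasure_of_tendsto_eLpNorm two_ne_zero
      (fun n => (h1 n).continuous.aestronglyMeasurable) (Lp.aestronglyMeasurable _) h2
  -- Continuity of F' is only useful along pointwise convergence, so a subsequence converging almost
  -- everywhere is taken.
  obtain ⟨ns, hns, hae⟩ := hmeas.exists_seq_tendsto_ae
  have m1 : MemLp (fun x => F (ξ.fst.fst x)) 2 (vol Ω) := hlip.comp_memLp h0 (Lp.memLp ξ.fst.fst)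
  have m2 : MemLp (fun x => F (ξ.fst.snd x)) 2 (surf Ω) := hlip.comp_memLp h0 (Lp.memLp ξ.fst.snd)
  have hFm : AEStronglyMeasurable (fun x => F' (ξ.fst.fst x)) (vol Ω) :=
    hF'.comp_aestronglyMeasurable (Lp.aestronglyMeasurable ξ.fst.fst)
  have m3 : ∀ i, MemLp (fun x => F' (ξ.fst.fst x) * ξ.snd i x) 2 (vol Ω) := fun i => by
    refine (Lp.memLp (ξ.snd i)).of_le (hFm.mul (Lp.aestronglyMeasurable _))
      (ae_of_all _ fun x => ?_)
    rw [norm_mul]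
    exact mul_le_of_le_one_left (norm_nonneg _) (hb _)
  refine ⟨mkW m1.toLp m2.toLp fun i => (m3 i).toLp, (mem_graphSpace_iff hΩ).2
    ⟨fun n x => F (φ (ns n) x), fun n => hF1.comp (h1 _), ?_, fun i => ?_, ?_⟩,
    m1.coeFn_toLp, m2.coeFn_toLp, fun i => (m3 i).coeFn_toLp⟩
  · refine tendsto_of_tendsto_of_tendsto_of_le_of_le tendsto_const_nhds
      (h2.comp hns.tendsto_atTop) (fun _ => zero_le) fun n => ?_
    refine eLpNorm_mono_ae ?_
    filter_upwards [m1.coeFn_toLp] with x hx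
    change ‖F (φ (ns n) x) - m1.toLp _ x‖ ≤ _
    rw [hx]
    simpa [Real.dist_eq] using hlip.dist_le_mul (φ (ns n) x) (ξ.fst.fst x)
  · have t1 : Tendsto (fun n => eLpNorm (fun x => partialDeriv i (φ (ns n)) x - ξ.snd i x) 2 (vol Ω))
        atTop (𝓝 0) := (h3 i).comp hns.tendsto_atTop
    have t2 : Tendsto (fun n => eLpNorm (fun x =>
        (F' (φ (ns n) x) - F' (ξ.fst.fst x)) * ξ.snd i x) 2 (vol Ω)) atTop (𝓝 0) := by
      refine tendsto_eLpNorm_mul_of_ae (C := 2) (fun n => ?_) (Lp.memLp _) (fun n x => ?_) ?_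
      · exact (hF'.comp (h1 _).continuous).aestronglyMeasurable.sub hFm
      · refine (abs_sub _ _).trans ?_
        linarith [hb (φ (ns n) x), hb (ξ.fst.fst x)]
      · filter_upwards [hae] with x hx
        simpa using ((hF'.tendsto _).comp hx).sub_const (F' (ξ.fst.fst x))
    have t3 := t1.add t2
    rw [add_zero] at t3
    refine tendsto_of_tendsto_of_tendsto_of_le_of_le tendsto_const_nhds t3 (fun _ => zero_le)
      fun n => ?_
    have hd : ∀ x, partialDeriv i (fun y => F (φ (ns n) y)) x =
        F' (φ (ns n) x) * partialDeriv i (φ (ns n)) x := by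
      intro x
      have hφd := ((h1 (ns n)).differentiable one_ne_zero x).hasFDerivAt
      have := (hF (φ (ns n) x)).comp_hasFDerivAt x hφd
      rw [partialDeriv, show (fun y => F (φ (ns n) y)) = F ∘ φ (ns n) from rfl, this.fderiv]
      simp [partialDeriv]
    -- The error splits into F'(φ_n)(D_i φ_n - p), controlled by |F'| ≤ 1, and (F'(φ_n) - F'(u)) p,
    -- controlled by dominated convergence.
    have e : eLpNorm (fun x => partialDeriv i (fun y => F (φ (ns n) y)) x -
        (mkW m1.toLp m2.toLp fun i => (m3 i).toLp).snd i x) 2 (vol Ω) =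
        eLpNorm ((fun x => F' (φ (ns n) x) * (partialDeriv i (φ (ns n)) x - ξ.snd i x)) +
          fun x => (F' (φ (ns n) x) - F' (ξ.fst.fst x)) * ξ.snd i x) 2 (vol Ω) := by
      refine eLpNorm_congr_ae ?_
      filter_upwards [(m3 i).coeFn_toLp] with x hx
      change _ - (m3 i).toLp _ x = _
      rw [hx, hd, Pi.add_apply]
      ring
    have hc : AEStronglyMeasurable (fun x => F' (φ (ns n) x)) (vol Ω) :=
      (hF'.comp (h1 _).continuous).aestronglyMeasurable
    rw [e]
    refine (eLpNorm_add_le (hc.mul ((continuous_partialDeriv (h1 _) i).aestronglyMeasurable.sub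
      (Lp.aestronglyMeasurable _))) ((hc.sub hFm).mul (Lp.aestronglyMeasurable _))
      one_le_two).trans ?_
    refine add_le_add ?_ le_rfl
    refine eLpNorm_mono fun x => ?_
    change ‖F' (φ (ns n) x) * (partialDeriv i (φ (ns n)) x - ξ.snd i x)‖ ≤ _
    rw [norm_mul]
    exact mul_le_of_le_one_left (norm_nonneg _) (hb _)
  · refine tendsto_of_tendsto_of_tendsto_of_le_of_le tendsto_const_nhds
      (h4.comp hns.tendsto_atTop) (fun _ => zero_le) fun n => ?_
    refine eLpNorm_mono_ae ?_
    filter_upwards [m2.coeFn_toLp] with x hx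
    change ‖F (φ (ns n) x) - m2.toLp _ x‖ ≤ _
    rw [hx]
    simpa [Real.dist_eq] using hlip.dist_le_mul (φ (ns n) x) (ξ.fst.snd x)

end ChainRule

/-! ### Density in 𝓗 and the drift estimate on the closure -/

section GraphSpaceProperties

variable {N : ℕ} {Ω : Set (E N)}

theorem smoothTriple_mem (hΩ : IsLipschitzRegular Ω) {φ : E N → ℝ} (hφ : ContDiff ℝ 1 φ) :
    ∃ ξ ∈ graphSpace Ω, ξ.fst.fst =ᵐ[vol Ω] φ ∧ ξ.fst.snd =ᵐ[surf Ω] φ := by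
  have m1 := hΩ.memLp_vol hφ.continuous 2
  have m2 := hΩ.memLp_surf hφ.continuous 2
  have m3 := fun i => hΩ.memLp_vol (continuous_partialDeriv hφ i) 2
  exact ⟨mkW m1.toLp m2.toLp fun i => (m3 i).toLp, Submodule.le_topologicalClosure _
    ⟨φ, hφ, m1.coeFn_toLp, m2.coeFn_toLp, fun i => (m3 i).coeFn_toLp⟩,
    m1.coeFn_toLp, m2.coeFn_toLp⟩

/-- The embedding of the graph space into `L²(Ω) ⊕ L²(∂Ω)`. -/
def graphEmb (Ω : Set (E N)) : graphSpace Ω →L[ℝ] H Ω := (comp₁ Ω).comp (graphSpace Ω).subtypeL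

/-- Let `h` be orthogonal to the range. Test functions supported in Ω do not see the boundary and
force its interior component to vanish; then arbitrary compactly supported smooth functions on ℝᴺ
force the boundary component to vanish. -/
theorem denseRange_graphEmb (hΩ : IsLipschitzRegular Ω) : DenseRange (graphEmb Ω) := by
  have f1 := hΩ.isFiniteMeasure_vol
  have f2 := hΩ.isFiniteMeasure_surf
  have h1 : (graphEmb Ω : graphSpace Ω →ₗ[ℝ] H Ω).range.topologicalClosure = ⊤ := by
    rw [Submodule.topologicalClosure_eq_top_iff, Submodule.eq_bot_iff]
    intro h hh
    rw [Submodule.mem_orthogonal] at hh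
    have key : ∀ φ : E N → ℝ, ContDiff ℝ 1 φ →
        ∫ x, φ x * h.fst x ∂(vol Ω) + ∫ x, φ x * h.snd x ∂(surf Ω) = 0 := by
      intro φ hφ
      obtain ⟨ξ, hξ, e1, e2⟩ := smoothTriple_mem hΩ hφ
      have h2 : inner ℝ ξ.fst h = 0 := hh _ ⟨⟨ξ, hξ⟩, rfl⟩
      rw [WithLp.prod_inner_apply] at h2
      have e3 : ∫ x, φ x * h.fst x ∂(vol Ω) = inner ℝ ξ.fst.fst h.fst := by
        rw [inner_eq_integral_mul]
        exact integral_congr_ae (by filter_upwards [e1] with x hx; rw [hx])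
      have e4 : ∫ x, φ x * h.snd x ∂(surf Ω) = inner ℝ ξ.fst.snd h.snd := by
        rw [inner_eq_integral_mul]
        exact integral_congr_ae (by filter_upwards [e2] with x hx; rw [hx])
      rw [e3, e4]
      exact h2
    have i1 : Integrable h.fst (vol Ω) := (Lp.memLp h.fst).integrable one_le_two
    have i2 : Integrable h.snd (surf Ω) := (Lp.memLp h.snd).integrable one_le_two
    have z1 : h.fst = 0 := by
      have hz : ∀ᵐ x ∂(volume : Measure (E N)), x ∈ Ω → h.fst x = 0 := by
        refine hΩ.1.ae_eq_zero_of_integral_contDiff_smul_eq_zero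
          (IntegrableOn.locallyIntegrableOn i1) fun θ k1 k2 k3 => ?_
        have hθz : ∀ x, x ∉ Ω → θ x = 0 := fun x hx =>
          image_eq_zero_of_notMem_tsupport fun h => hx (k3 h)
        have := key θ (k1.of_le (by exact_mod_cast le_top))
        have hs : ∫ x, θ x * h.snd x ∂(surf Ω) = 0 := by
          refine setIntegral_eq_zero_of_forall_eq_zero fun x hx => ?_
          rw [hΩ.1.frontier_eq] at hx
          rw [hθz x hx.2, zero_mul]
        rw [hs, add_zero] at this
        rw [← setIntegral_eq_integral_of_forall_compl_eq_zero (s := Ω)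
          (fun x hx => by rw [hθz x hx, zero_smul])]
        exact this
      refine Lp.ext ?_
      filter_upwards [(ae_restrict_iff' hΩ.1.measurableSet).2 hz, Lp.coeFn_zero ℝ 2 (vol Ω)]
        with x hx hx0
      rw [hx, hx0]; rfl
    have z2 : h.snd = 0 := by
      have hz : ∀ᵐ x ∂(surf Ω), h.snd x = 0 := by
        refine ae_eq_zero_of_integral_contDiff_smul_eq_zero i2.locallyIntegrable
          fun θ k1 k2 => ?_
        have := key θ (k1.of_le (by exact_mod_cast le_top))
        have hs : ∫ x, θ x * h.fst x ∂(vol Ω) = 0 := by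
          rw [z1]
          refine integral_eq_zero_of_ae ?_
          filter_upwards [Lp.coeFn_zero ℝ 2 (vol Ω)] with x hx
          rw [hx]; simp
        rw [hs, zero_add] at this
        exact this
      refine Lp.ext ?_
      filter_upwards [hz, Lp.coeFn_zero ℝ 2 (surf Ω)] with x hx hx0
      rw [hx, hx0]; rfl
    exact (WithLp.ofLp_injective 2) (Prod.ext z1 z2)
  rw [DenseRange, dense_iff_closure_eq]
  have := congrArg (fun s : Submodule ℝ (H Ω) => (s : Set (H Ω))) h1
  simp only [Submodule.topologicalClosure_coe, Submodule.top_coe] at this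
  exact this

theorem continuous_integral_abs {α : Type*} [MeasurableSpace α] {μ : Measure α}
    [IsFiniteMeasure μ] : Continuous fun f : Lp ℝ 2 μ => ∫ x, |f x| ∂μ := by
  have h1 : MemLp (fun _ : α => (1 : ℝ)) 2 μ := memLp_const 1
  have e : (fun f : Lp ℝ 2 μ => ∫ x, |f x| ∂μ) = fun f => inner ℝ (f ⊔ -f) h1.toLp := by
    funext f
    rw [inner_eq_integral_mul]
    refine integral_congr_ae ?_
    filter_upwards [Lp.coeFn_abs f, h1.coeFn_toLp] with x hx hx1
    change _ = |f| x * _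
    rw [hx, hx1, mul_one]
  rw [e]
  have : Continuous fun f : Lp ℝ 2 μ => f ⊔ -f := continuous_id.sup continuous_neg
  exact this.inner continuous_const

/-- Both sides are continuous on `W Ω`, because the measures are finite, so the inequality for C¹
functions passes to the closure. -/
theorem exists_integral_grad_le (hN : 2 ≤ N) (hΩ : IsLipschitzRegular Ω) {b : E N → ℝ}
    (hb : MemW1Infty Ω b) (j : Fin N) : ∃ C : ℝ, 0 ≤ C ∧ ∀ ξ ∈ graphSpace Ω,
      |∫ x, b x * ξ.snd j x ∂(vol Ω)| ≤
        C * (∫ x, |ξ.fst.fst x| ∂(vol Ω) + ∫ x, |ξ.fst.snd x| ∂(surf Ω)) := by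
  have f1 := hΩ.isFiniteMeasure_vol
  have f2 := hΩ.isFiniteMeasure_surf
  obtain ⟨C, hC0, hC⟩ := hΩ.exists_integral_mul_partialDeriv_le hN hb j
  refine ⟨C, hC0, fun ξ hξ => ?_⟩
  have hb2 : MemLp b 2 (vol Ω) := hb.1.mono_exponent le_top
  have e : ∀ g : L2Int Ω, ∫ x, b x * g x ∂(vol Ω) = inner ℝ hb2.toLp g := by
    intro g
    rw [inner_eq_integral_mul]
    exact integral_congr_ae (by filter_upwards [hb2.coeFn_toLp] with x hx; rw [hx])
  have hclosed : IsClosed {ξ : W Ω | |inner ℝ hb2.toLp (compGrad Ω j ξ)| ≤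
      C * (∫ x, |compInt Ω ξ x| ∂(vol Ω) + ∫ x, |compBdry Ω ξ x| ∂(surf Ω))} := by
    have c1 := (continuous_integral_abs (μ := vol Ω)).comp (compInt Ω).continuous
    have c2 := (continuous_integral_abs (μ := surf Ω)).comp (compBdry Ω).continuous
    exact isClosed_le (by fun_prop) (continuous_const.mul (c1.add c2))
  rw [e]
  refine closure_minimal ?_ hclosed hξ
  rintro ζ ⟨φ, k1, k2, k3, k4⟩
  have h := hC φ k1
  have e1 : ∫ x, b x * partialDeriv j φ x ∂(vol Ω) = inner ℝ hb2.toLp (compGrad Ω j ζ) := by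
    rw [← e]
    exact integral_congr_ae (by filter_upwards [k4 j] with x hx; rw [compGrad_apply, hx])
  have e2 : ∫ x, |φ x| ∂(vol Ω) = ∫ x, |compInt Ω ζ x| ∂(vol Ω) :=
    integral_congr_ae (by filter_upwards [k2] with x hx; rw [compInt_apply, hx])
  have e3 : ∫ x, |φ x| ∂(surf Ω) = ∫ x, |compBdry Ω ζ x| ∂(surf Ω) :=
    integral_congr_ae (by filter_upwards [k3] with x hx; rw [compBdry_apply, hx])
  rw [e1, e2, e3] at h
  exact h

end GraphSpaceProperties

/-! ### Pointwise estimates for the integrand of the form -/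

section Density

variable {N : ℕ}

/-- The integrand of the interior part of the form at a point, as a function of the values
`u`, `v` and the gradients `p`, `q`. -/
def density (a : Fin N → Fin N → ℝ) (b c : Fin N → ℝ) (d u : ℝ) (p : Fin N → ℝ) (v : ℝ)
    (q : Fin N → ℝ) : ℝ :=
  (∑ i, ∑ j, a i j * p i * q j) + (∑ j, b j * u * q j) + (∑ i, c i * p i * v) + d * u * v

/-- Young's inequality with weight α/4: the b and c terms together use up α/2 of the ellipticity and
leave α/2 for coercivity. -/
theorem neg_le_mul_mul_of_abs_le {α B b u p : ℝ} (hα : 0 < α) (hb : |b| ≤ B) :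
    -(α / 4 * p ^ 2 + B ^ 2 / α * u ^ 2) ≤ b * u * p := by
  have h1 : b ^ 2 ≤ B ^ 2 := sq_le_sq' (abs_le.1 hb).1 (abs_le.1 hb).2
  have h2 : 0 ≤ α * (p / 2 + b * u / α) ^ 2 := by positivity
  have e : α * (p / 2 + b * u / α) ^ 2 = α / 4 * p ^ 2 + b * u * p + b ^ 2 / α * u ^ 2 := by
    field_simp; ring
  have h3 : b ^ 2 / α * u ^ 2 ≤ B ^ 2 / α * u ^ 2 := by gcongr
  linarith

theorem density_self_ge {a : Fin N → Fin N → ℝ} {b c : Fin N → ℝ} {d α B D ω u : ℝ}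
    {p : Fin N → ℝ} (hα : 0 < α) (ha : α * ∑ i, p i ^ 2 ≤ ∑ i, ∑ j, a i j * p i * p j)
    (hb : ∀ j, |b j| ≤ B) (hc : ∀ i, |c i| ≤ B) (hd : |d| ≤ D)
    (hω : N * (2 * B ^ 2 / α) + D + α / 2 ≤ ω) :
    α / 2 * (∑ i, p i ^ 2) + α / 2 * u ^ 2 ≤ density a b c d u p u p + ω * (u * u) := by
  have h1 : ∑ j, -(α / 4 * p j ^ 2 + B ^ 2 / α * u ^ 2) ≤ ∑ j, b j * u * p j :=
    Finset.sum_le_sum fun j _ => neg_le_mul_mul_of_abs_le hα (hb j)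
  have h2 : ∑ j, -(α / 4 * p j ^ 2 + B ^ 2 / α * u ^ 2) ≤ ∑ j, c j * p j * u :=
    Finset.sum_le_sum fun j _ => by
      rw [mul_right_comm]; exact neg_le_mul_mul_of_abs_le hα (hc j)
  simp only [Finset.sum_neg_distrib, Finset.sum_add_distrib, ← Finset.mul_sum, Finset.sum_const,
    Finset.card_univ, Fintype.card_fin, nsmul_eq_mul] at h1 h2
  have h3 : (N * (2 * B ^ 2 / α) + D + α / 2) * u ^ 2 ≤ ω * u ^ 2 := by gcongr
  have h4 : -D * u ^ 2 ≤ d * u ^ 2 := by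
    gcongr; exact (abs_le.1 hd).1
  have e : (N : ℝ) * (2 * B ^ 2 / α) * u ^ 2 = 2 * (N * (B ^ 2 / α * u ^ 2)) := by ring
  unfold density
  nlinarith

/-- A Young inequality adapted to the degenerate weight `t`: the gradient is controlled only through
t p², so `V` has to carry a factor √t, which the last hypothesis expresses. -/
theorem neg_le_mul_mul_of_sq_le {α B c p t s V : ℝ} (hα : 0 < α) (hc : |c| ≤ B) (ht : 0 ≤ t)
    (hs : 0 ≤ s) (h : V ^ 2 ≤ t * s) :
    -(α / 2 * (t * p ^ 2) + B ^ 2 / (2 * α) * s) ≤ c * p * V := by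
  have h1 : c ^ 2 ≤ B ^ 2 := sq_le_sq' (abs_le.1 hc).1 (abs_le.1 hc).2
  have h0 : 0 ≤ α / 2 * (t * p ^ 2) + B ^ 2 / (2 * α) * s := by positivity
  refine (abs_le.1 (abs_le_of_sq_le_sq ?_ h0)).1
  have h2 : (c * p * V) ^ 2 ≤ B ^ 2 * p ^ 2 * (t * s) := by
    rw [mul_pow, mul_pow]; gcongr
  have e : (α / 2 * (t * p ^ 2) + B ^ 2 / (2 * α) * s) ^ 2 =
      (α / 2 * (t * p ^ 2) - B ^ 2 / (2 * α) * s) ^ 2 + B ^ 2 * p ^ 2 * (t * s) := by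
    field_simp; ring
  have h3 := sq_nonneg (α / 2 * (t * p ^ 2) - B ^ 2 / (2 * α) * s)
  linarith

/-- The pointwise estimate behind the invariance of `{u ≤ M}`: the test function has value
`V = G(w)` and gradient `t p` with `t = G'(w)`, where `w = u - M`. -/
theorem density_trunc_ge {a : Fin N → Fin N → ℝ} {b c : Fin N → ℝ} {d α B D K ω l f w M V t : ℝ}
    {p : Fin N → ℝ} (hα : 0 < α) (ha : α * ∑ i, p i ^ 2 ≤ ∑ i, ∑ j, a i j * p i * p j)
    (hb : ∀ j, |b j| ≤ B) (hc : ∀ i, |c i| ≤ B) (hd : |d| ≤ D)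
    (hω : N * (2 * B ^ 2 / α) + D + α / 2 ≤ ω) (hK : D + K ≤ ω) (hl : 0 < l) (hf : f ≤ M)
    (hM : 0 ≤ M) (ht : 0 ≤ t) (hV : 0 ≤ V) (hs : 0 ≤ w * V) (h1 : w ^ 2 * t ≤ 2 * (w * V))
    (h2 : V ^ 2 ≤ t * (w * V)) :
    M * (∑ j, b j * (t * p j)) + K * M * V + l * (w * V) ≤
      density a b c d (w + M) p V (fun j => t * p j) + (ω + l) * ((w + M) * V) - l * (f * V) := by
  have k1 : t * (α * ∑ i, p i ^ 2) ≤ ∑ i, ∑ j, a i j * p i * (t * p j) := by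
    refine (mul_le_mul_of_nonneg_left ha ht).trans (le_of_eq ?_)
    simp only [Finset.mul_sum]
    exact Finset.sum_congr rfl fun i _ => Finset.sum_congr rfl fun j _ => by ring
  -- Only the part of w + M with factor w is estimated, using (w t)² ≤ t · 2 w V. The part with
  -- factor M is kept exactly, since it is to be integrated by parts. Here and for the c term α/2 is
  -- spent each, which exhausts the ellipticity.
  have k2 : ∑ j, (M * (b j * (t * p j)) - (α / 2 * (t * p j ^ 2) + B ^ 2 / α * (w * V))) ≤
      ∑ j, b j * (w + M) * (t * p j) := by
    refine Finset.sum_le_sum fun j _ => ?_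
    have := neg_le_mul_mul_of_sq_le (V := w * t) (s := 2 * (w * V)) (p := p j) hα (hb j) ht
      (by positivity) (by nlinarith)
    have e : B ^ 2 / (2 * α) * (2 * (w * V)) = B ^ 2 / α * (w * V) := by field_simp
    rw [e] at this
    linarith
  have k3 : ∑ i, -(α / 2 * (t * p i ^ 2) + B ^ 2 / (2 * α) * (w * V)) ≤ ∑ i, c i * p i * V :=
    Finset.sum_le_sum fun i _ => neg_le_mul_mul_of_sq_le hα (hc i) ht hs h2
  simp only [Finset.sum_neg_distrib, Finset.sum_sub_distrib, Finset.sum_add_distrib,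
    ← Finset.mul_sum, Finset.sum_const, Finset.card_univ, Fintype.card_fin, nsmul_eq_mul] at k2 k3
  have hMV : 0 ≤ M * V := by positivity
  have k4 : -D * ((w + M) * V) ≤ d * ((w + M) * V) :=
    mul_le_mul_of_nonneg_right (abs_le.1 hd).1 (by linarith)
  have k5 : (D + K) * (M * V) ≤ ω * (M * V) := by gcongr
  have k6 : (N * (2 * B ^ 2 / α) + D + α / 2) * (w * V) ≤ ω * (w * V) := by gcongr
  have k7 : l * (f * V) ≤ l * (M * V) := by gcongr
  have k8 : 0 ≤ α / 2 * (w * V) := by positivity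
  have k9 : 0 ≤ (N : ℝ) * (B ^ 2 / (2 * α) * (w * V)) := by positivity
  have e1 : (N : ℝ) * (2 * B ^ 2 / α) * (w * V) = N * (B ^ 2 / α * (w * V)) +
      2 * (N * (B ^ 2 / (2 * α) * (w * V))) := by field_simp; ring
  unfold density
  linarith

end Density

/-! ### The form on triples: representation and coercivity -/

section Form

variable {N : ℕ} {Ω : Set (E N)} {a : Fin N → Fin N → E N → ℝ} {b c : Fin N → E N → ℝ}
  {d β : E N → ℝ}

theorem integrable_density (ha : ∀ i j, MemLp (a i j) ∞ (vol Ω)) (hb : ∀ j, MemLp (b j) ∞ (vol Ω))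
    (hc : ∀ i, MemLp (c i) ∞ (vol Ω)) (hd : MemLp d ∞ (vol Ω)) (u v : L2Int Ω)
    (p q : Fin N → L2Int Ω) :
    Integrable (fun x => density (fun i j => a i j x) (fun j => b j x) (fun i => c i x) (d x) (u x)
      (fun i => p i x) (v x) (fun j => q j x)) (vol Ω) := by
  unfold density
  refine (((integrable_finsetSum _ fun i _ => integrable_finsetSum _ fun j _ => ?_).add
    (integrable_finsetSum _ fun j _ => ?_)).add (integrable_finsetSum _ fun i _ => ?_)).add ?_
  · exact integrable_weight_mul_mul (ha i j) (Lp.memLp _) (Lp.memLp _)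
  · exact integrable_weight_mul_mul (hb j) (Lp.memLp _) (Lp.memLp _)
  · exact integrable_weight_mul_mul (hc i) (Lp.memLp _) (Lp.memLp _)
  · exact integrable_weight_mul_mul hd (Lp.memLp _) (Lp.memLp _)

theorem integral_density (ha : ∀ i j, MemLp (a i j) ∞ (vol Ω)) (hb : ∀ j, MemLp (b j) ∞ (vol Ω))
    (hc : ∀ i, MemLp (c i) ∞ (vol Ω)) (hd : MemLp d ∞ (vol Ω)) (u v : L2Int Ω)
    (p q : Fin N → L2Int Ω) :
    ∫ x, density (fun i j => a i j x) (fun j => b j x) (fun i => c i x) (d x) (u x)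
      (fun i => p i x) (v x) (fun j => q j x) ∂(vol Ω) =
    (∑ i, ∑ j, ∫ x, a i j x * p i x * q j x ∂(vol Ω)) + (∑ j, ∫ x, b j x * u x * q j x ∂(vol Ω)) +
      (∑ i, ∫ x, c i x * p i x * v x ∂(vol Ω)) + ∫ x, d x * u x * v x ∂(vol Ω) := by
  have i1 : ∀ i j, Integrable (fun x => a i j x * p i x * q j x) (vol Ω) := fun i j =>
    integrable_weight_mul_mul (ha i j) (Lp.memLp _) (Lp.memLp _)
  have i2 : ∀ j, Integrable (fun x => b j x * u x * q j x) (vol Ω) := fun j =>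
    integrable_weight_mul_mul (hb j) (Lp.memLp _) (Lp.memLp _)
  have i3 : ∀ i, Integrable (fun x => c i x * p i x * v x) (vol Ω) := fun i =>
    integrable_weight_mul_mul (hc i) (Lp.memLp _) (Lp.memLp _)
  have i4 : Integrable (fun x => d x * u x * v x) (vol Ω) :=
    integrable_weight_mul_mul hd (Lp.memLp _) (Lp.memLp _)
  have j1 : Integrable (fun x => ∑ i, ∑ j, a i j x * p i x * q j x) (vol Ω) :=
    integrable_finsetSum _ fun i _ => integrable_finsetSum _ fun j _ => i1 i j
  have j2 : Integrable (fun x => ∑ j, b j x * u x * q j x) (vol Ω) :=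
    integrable_finsetSum _ fun j _ => i2 j
  have j3 : Integrable (fun x => ∑ i, c i x * p i x * v x) (vol Ω) :=
    integrable_finsetSum _ fun j _ => i3 j
  have j12 : Integrable (fun x => (∑ i, ∑ j, a i j x * p i x * q j x) +
      ∑ j, b j x * u x * q j x) (vol Ω) := j1.add j2
  have j123 : Integrable (fun x => (∑ i, ∑ j, a i j x * p i x * q j x) +
      (∑ j, b j x * u x * q j x) + ∑ i, c i x * p i x * v x) (vol Ω) := j12.add j3
  simp only [density]
  rw [integral_add j123 i4, integral_add j12 j3, integral_add j1 j2,
    integral_finsetSum _ fun i _ => integrable_finsetSum _ fun j _ => i1 i j,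
    integral_finsetSum _ fun j _ => i2 j, integral_finsetSum _ fun i _ => i3 i]
  simp only [integral_finsetSum _ fun j _ => i1 _ j]

/-- The form as a bounded bilinear form on `L²(Ω) ⊕ L²(∂Ω) ⊕ L²(Ω)ᴺ`. -/
def formW (ha : ∀ i j, MemLp (a i j) ∞ (vol Ω)) (hb : ∀ j, MemLp (b j) ∞ (vol Ω))
    (hc : ∀ i, MemLp (c i) ∞ (vol Ω)) (hd : MemLp d ∞ (vol Ω)) (hβ : MemLp β ∞ (surf Ω)) :
    W Ω →L[ℝ] W Ω →L[ℝ] ℝ :=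
  (∑ i, ∑ j, (weightedForm (ha i j)).bilinearComp (compGrad Ω i) (compGrad Ω j)) +
    (∑ j, (weightedForm (hb j)).bilinearComp (compInt Ω) (compGrad Ω j)) +
    (∑ i, (weightedForm (hc i)).bilinearComp (compGrad Ω i) (compInt Ω)) +
    (weightedForm hd).bilinearComp (compInt Ω) (compInt Ω) +
    (weightedForm hβ).bilinearComp (compBdry Ω) (compBdry Ω)

variable (ha : ∀ i j, MemLp (a i j) ∞ (vol Ω)) (hb : ∀ j, MemLp (b j) ∞ (vol Ω))
  (hc : ∀ i, MemLp (c i) ∞ (vol Ω)) (hd : MemLp d ∞ (vol Ω)) (hβ : MemLp β ∞ (surf Ω))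

theorem formW_apply (ξ ζ : W Ω) : formW ha hb hc hd hβ ξ ζ =
    (∑ i, ∑ j, ∫ x, a i j x * ξ.snd i x * ζ.snd j x ∂(vol Ω)) +
      (∑ j, ∫ x, b j x * ξ.fst.fst x * ζ.snd j x ∂(vol Ω)) +
      (∑ i, ∫ x, c i x * ξ.snd i x * ζ.fst.fst x ∂(vol Ω)) +
      (∫ x, d x * ξ.fst.fst x * ζ.fst.fst x ∂(vol Ω)) +
      ∫ x, β x * ξ.fst.snd x * ζ.fst.snd x ∂(surf Ω) := by
  simp [formW, weightedForm_apply]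

theorem formW_eq_integral_density (ξ ζ : W Ω) : formW ha hb hc hd hβ ξ ζ =
    ∫ x, density (fun i j => a i j x) (fun j => b j x) (fun i => c i x) (d x) (ξ.fst.fst x)
      (fun i => ξ.snd i x) (ζ.fst.fst x) (fun j => ζ.snd j x) ∂(vol Ω) +
    ∫ x, β x * ξ.fst.snd x * ζ.fst.snd x ∂(surf Ω) := by
  rw [formW_apply, integral_density ha hb hc hd]

theorem form_eq_formW (hΩ : IsLipschitzRegular Ω) {ξ ζ : W Ω} (hξ : ξ ∈ graphSpace Ω)
    (hζ : ζ ∈ graphSpace Ω) : form Ω a b c d β ξ.fst ζ.fst = formW ha hb hc hd hβ ξ ζ := by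
  rw [formW_apply, form]
  simp only [weakPartial_of_mem_graphSpace hΩ hξ, weakPartial_of_mem_graphSpace hΩ hζ]

/-- Uniform bounds for the coefficients. -/
structure CoefficientBounds (Ω : Set (E N)) (a : Fin N → Fin N → E N → ℝ) (b c : Fin N → E N → ℝ)
    (d β : E N → ℝ) (α B D : ℝ) : Prop where
  pos : 0 < α
  nonneg : 0 ≤ D
  elliptic : ∀ᵐ x ∂(vol Ω), ∀ p : Fin N → ℝ, α * ∑ i, p i ^ 2 ≤ ∑ i, ∑ j, a i j x * p i * p j
  drift : ∀ᵐ x ∂(vol Ω), ∀ j, |b j x| ≤ B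
  drift' : ∀ᵐ x ∂(vol Ω), ∀ i, |c i x| ≤ B
  potential : ∀ᵐ x ∂(vol Ω), |d x| ≤ D
  boundary : ∀ᵐ x ∂(surf Ω), |β x| ≤ D

theorem exists_ae_abs_le_forall {α : Type*} [MeasurableSpace α] {μ : Measure α}
    {f : Fin N → α → ℝ} (hf : ∀ i, MemLp (f i) ∞ μ) :
    ∃ B : ℝ, 0 ≤ B ∧ ∀ᵐ x ∂μ, ∀ i, |f i x| ≤ B := by
  choose B h0 hB using fun i => exists_ae_abs_le_of_memLp_top (hf i)
  refine ⟨∑ i, B i, Finset.sum_nonneg fun i _ => h0 i, ?_⟩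
  filter_upwards [ae_all_iff.2 hB] with x hx i
  exact (hx i).trans (Finset.single_le_sum (fun i _ => h0 i) (Finset.mem_univ i))

theorem exists_coefficientBounds (hb : ∀ j, MemLp (b j) ∞ (vol Ω))
    (hc : ∀ i, MemLp (c i) ∞ (vol Ω)) (hd : MemLp d ∞ (vol Ω)) (hβ : MemLp β ∞ (surf Ω))
    (hell : ∃ α : ℝ, 0 < α ∧ ∀ᵐ x ∂(vol Ω), ∀ ξ : E N,
      α * ‖ξ‖ ^ 2 ≤ ∑ i, ∑ j, a i j x * ξ i * ξ j) :
    ∃ α B D, CoefficientBounds Ω a b c d β α B D := by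
  obtain ⟨α, hα, hell⟩ := hell
  obtain ⟨B₁, h1, hB₁⟩ := exists_ae_abs_le_forall hb
  obtain ⟨B₂, h2, hB₂⟩ := exists_ae_abs_le_forall hc
  obtain ⟨D₁, h3, hD₁⟩ := exists_ae_abs_le_of_memLp_top hd
  obtain ⟨D₂, h4, hD₂⟩ := exists_ae_abs_le_of_memLp_top hβ
  refine ⟨α, B₁ + B₂, D₁ + D₂, hα, by positivity, ?_, ?_, ?_, ?_, ?_⟩
  · filter_upwards [hell] with x hx p
    have := hx (WithLp.toLp 2 p)
    rw [EuclideanSpace.real_norm_sq_eq] at this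
    exact this
  · filter_upwards [hB₁] with x hx j using (hx j).trans (by linarith)
  · filter_upwards [hB₂] with x hx j using (hx j).trans (by linarith)
  · filter_upwards [hD₁] with x hx using hx.trans (by linarith)
  · filter_upwards [hD₂] with x hx using hx.trans (by linarith)

theorem norm_sq_eq_integral {α : Type*} [MeasurableSpace α] {μ : Measure α} (f : Lp ℝ 2 μ) :
    ‖f‖ ^ 2 = ∫ x, f x * f x ∂μ := by
  rw [← real_inner_self_eq_norm_sq, inner_eq_integral_mul]

/-- The interior part integrates `density_self_ge`; on the boundary β + ω ≥ α/2 suffices, as the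
hypothesis on ω contains D + α/2. -/
theorem formW_coercive {α B D ω : ℝ} (h : CoefficientBounds Ω a b c d β α B D)
    (hω : N * (2 * B ^ 2 / α) + D + α / 2 ≤ ω) (ξ : W Ω) :
    α / 2 * ‖ξ‖ ^ 2 ≤ formW ha hb hc hd hβ ξ ξ + ω * ‖ξ.fst‖ ^ 2 := by
  have iu : ∀ f : L2Int Ω, Integrable (fun x => f x * f x) (vol Ω) := fun f =>
    integrable_mul_of_memLp_two (Lp.memLp _) (Lp.memLp _)
  have ig : Integrable (fun x => ξ.fst.snd x * ξ.fst.snd x) (surf Ω) :=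
    integrable_mul_of_memLp_two (Lp.memLp _) (Lp.memLp _)
  have ip : Integrable (fun x => ∑ i, ξ.snd i x * ξ.snd i x) (vol Ω) :=
    integrable_finsetSum _ fun i _ => iu _
  have idn := integrable_density ha hb hc hd ξ.fst.fst ξ.fst.fst (fun i => ξ.snd i)
    fun i => ξ.snd i
  have ib : Integrable (fun x => β x * ξ.fst.snd x * ξ.fst.snd x) (surf Ω) :=
    integrable_weight_mul_mul hβ (Lp.memLp _) (Lp.memLp _)
  have h1 : ∫ x, (α / 2 * (∑ i, ξ.snd i x * ξ.snd i x) +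
      α / 2 * (ξ.fst.fst x * ξ.fst.fst x)) ∂(vol Ω) ≤
      ∫ x, (density (fun i j => a i j x) (fun j => b j x) (fun i => c i x) (d x) (ξ.fst.fst x)
      (fun i => ξ.snd i x) (ξ.fst.fst x) (fun j => ξ.snd j x) +
        ω * (ξ.fst.fst x * ξ.fst.fst x)) ∂(vol Ω) := by
    refine integral_mono_ae ((ip.const_mul _).add ((iu _).const_mul _))
      (idn.add ((iu _).const_mul _)) ?_
    filter_upwards [h.elliptic, h.drift, h.drift', h.potential] with x k1 k2 k3 k4
    have := density_self_ge (u := ξ.fst.fst x) h.pos (k1 fun i => ξ.snd i x) k2 k3 k4 hω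
    simp only [pow_two] at this ⊢
    exact this
  have h2 : ∫ x, α / 2 * (ξ.fst.snd x * ξ.fst.snd x) ∂(surf Ω) ≤
      ∫ x, (β x * ξ.fst.snd x * ξ.fst.snd x + ω * (ξ.fst.snd x * ξ.fst.snd x)) ∂(surf Ω) := by
    refine integral_mono_ae (ig.const_mul _) (ib.add (ig.const_mul _)) ?_
    filter_upwards [h.boundary] with x k1
    have h3 := (abs_le.1 k1).1
    have h4 : 0 ≤ (N : ℝ) * (2 * B ^ 2 / α) := by have := h.pos; positivity
    have h5 : 0 ≤ (β x + ω - α / 2) * (ξ.fst.snd x * ξ.fst.snd x) :=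
      mul_nonneg (by linarith) (mul_self_nonneg _)
    linarith
  rw [integral_add (ip.const_mul _) ((iu _).const_mul _), integral_add idn ((iu _).const_mul _),
    integral_const_mul, integral_const_mul, integral_const_mul,
    integral_finsetSum _ fun i _ => iu _] at h1
  rw [integral_add ib (ig.const_mul _), integral_const_mul, integral_const_mul] at h2
  rw [formW_eq_integral_density, WithLp.prod_norm_sq_eq_of_L2 ξ,
    WithLp.prod_norm_sq_eq_of_L2 ξ.fst, PiLp.norm_sq_eq_of_L2]
  simp only [norm_sq_eq_integral]
  linarith

end Form

/-! ### Invariance of {x ≤ M} under the resolvent -/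

section Invariance

variable {N : ℕ} {Ω : Set (E N)} {a : Fin N → Fin N → E N → ℝ} {b c : Fin N → E N → ℝ}
  {d β : E N → ℝ}

/-- The elements of `L²(Ω) ⊕ L²(∂Ω)` with both components bounded above by `M`. -/
def boundedAbove (Ω : Set (E N)) (M : ℝ) : Set (H Ω) :=
  {x | (∀ᵐ p ∂(vol Ω), x.fst p ≤ M) ∧ ∀ᵐ p ∂(surf Ω), x.snd p ≤ M}

theorem convex_boundedAbove (M : ℝ) : Convex ℝ (boundedAbove Ω M) := by
  have key : ∀ {μ : Measure (E N)} {f g : Lp ℝ 2 μ} {s t : ℝ}, (∀ᵐ p ∂μ, f p ≤ M) →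
      (∀ᵐ p ∂μ, g p ≤ M) → 0 ≤ s → 0 ≤ t → s + t = 1 → ∀ᵐ p ∂μ, (s • f + t • g) p ≤ M := by
    intro μ f g s t hf hg hs ht hst
    filter_upwards [hf, hg, Lp.coeFn_add (s • f) (t • g), Lp.coeFn_smul s f, Lp.coeFn_smul t g]
      with p h1 h2 h3 h4 h5
    rw [h3, Pi.add_apply, h4, h5, Pi.smul_apply, Pi.smul_apply, smul_eq_mul, smul_eq_mul]
    calc s * f p + t * g p ≤ s * M + t * M := by gcongr
      _ = M := by rw [← add_mul, hst, one_mul]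
  intro x hx y hy s t hs ht hst
  exact ⟨key hx.1 hy.1 hs ht hst, key hx.2 hy.2 hs ht hst⟩

theorem isClosed_boundedAbove (hΩ : IsLipschitzRegular Ω) (M : ℝ) :
    IsClosed (boundedAbove Ω M) := by
  have f1 := hΩ.isFiniteMeasure_vol
  have f2 := hΩ.isFiniteMeasure_surf
  have key : ∀ {μ : Measure (E N)} [IsFiniteMeasure μ],
      IsClosed {f : Lp ℝ 2 μ | ∀ᵐ p ∂μ, f p ≤ M} := by
    intro μ _
    have hM : MemLp (fun _ : E N => M) 2 μ := memLp_const M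
    have e : {f : Lp ℝ 2 μ | ∀ᵐ p ∂μ, f p ≤ M} = Set.Iic hM.toLp := by
      ext f
      rw [Set.mem_Iic, ← Lp.coeFn_le, Set.mem_ofPred_eq]
      refine eventually_congr ?_
      filter_upwards [hM.coeFn_toLp] with p hp
      rw [hp]
    rw [e]
    exact isClosed_Iic
  exact (key.preimage (WithLp.fstL 2 ℝ (L2Int Ω) (L2Bdry Ω)).continuous).inter
    (key.preimage (WithLp.sndL 2 ℝ (L2Int Ω) (L2Bdry Ω)).continuous)

/-- Since s G(s) ≥ 0 with equality only for s ≤ 0, an integrand of this form with nonpositive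
integral vanishes almost everywhere. -/
theorem ae_le_of_integral_mul_trunc_nonpos {μ : Measure (E N)} [IsFiniteMeasure μ]
    {u v : Lp ℝ 2 μ} {M : ℝ} (hv : ∀ᵐ x ∂μ, v x = trunc (u x - M))
    (h : ∫ x, (u x - M) * v x ∂μ ≤ 0) : ∀ᵐ x ∂μ, u x ≤ M := by
  have hi : Integrable (fun x => (u x - M) * v x) μ :=
    integrable_mul_of_memLp_two ((Lp.memLp u).sub (memLp_const M)) (Lp.memLp v)
  have h0 : 0 ≤ᵐ[μ] fun x => (u x - M) * v x := by
    filter_upwards [hv] with x hx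
    rw [hx]; exact mul_trunc_nonneg _
  have hz := (integral_eq_zero_iff_of_nonneg_ae h0 hi).1 (h.antisymm (integral_nonneg_of_ae h0))
  filter_upwards [hz, hv] with x h1 h2
  simp only [h2, Pi.zero_apply] at h1
  linarith [nonpos_of_mul_trunc_eq_zero h1]

theorem exists_sum_integral_grad_le (hN : 2 ≤ N) (hΩ : IsLipschitzRegular Ω)
    (hb : ∀ j, MemW1Infty Ω (b j)) : ∃ K : ℝ, 0 ≤ K ∧ ∀ ξ ∈ graphSpace Ω,
      |∑ j, ∫ x, b j x * ξ.snd j x ∂(vol Ω)| ≤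
        K * (∫ x, |ξ.fst.fst x| ∂(vol Ω) + ∫ x, |ξ.fst.snd x| ∂(surf Ω)) := by
  choose K h0 hK using fun j => exists_integral_grad_le hN hΩ (hb j) j
  refine ⟨∑ j, K j, Finset.sum_nonneg fun j _ => h0 j, fun ξ hξ => ?_⟩
  rw [Finset.sum_mul]
  exact (Finset.abs_sum_le_sum_abs _ _).trans (Finset.sum_le_sum fun j _ => hK j ξ hξ)

/-- The solution of the resolvent equation inherits upper bounds `M ≥ 0` from the right-hand
side. -/
theorem mem_boundedAbove_of_formW_eq (hΩ : IsLipschitzRegular Ω)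
    (ha : ∀ i j, MemLp (a i j) ∞ (vol Ω)) (hb : ∀ j, MemLp (b j) ∞ (vol Ω))
    (hc : ∀ i, MemLp (c i) ∞ (vol Ω)) (hd : MemLp d ∞ (vol Ω)) (hβ : MemLp β ∞ (surf Ω))
    {α B D ω K l M : ℝ} (h : CoefficientBounds Ω a b c d β α B D)
    (hω : N * (2 * B ^ 2 / α) + D + α / 2 ≤ ω) (hKω : D + K ≤ ω)
    (hK : ∀ ξ ∈ graphSpace Ω, |∑ j, ∫ x, b j x * ξ.snd j x ∂(vol Ω)| ≤
        K * (∫ x, |ξ.fst.fst x| ∂(vol Ω) + ∫ x, |ξ.fst.snd x| ∂(surf Ω)))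
    (hl : 0 < l) (hM : 0 ≤ M) {f : H Ω} (hf : f ∈ boundedAbove Ω M) {ξ : W Ω}
    (hξ : ξ ∈ graphSpace Ω)
    (heq : ∀ ζ ∈ graphSpace Ω, formW ha hb hc hd hβ ξ ζ + (ω + l) * inner ℝ ξ.fst ζ.fst =
      l * inner ℝ f ζ.fst) : ξ.fst ∈ boundedAbove Ω M := by
  have f1 := hΩ.isFiniteMeasure_vol
  have f2 := hΩ.isFiniteMeasure_surf
  -- The test function is G(u - M). The condition M ≥ 0 makes it vanish at u = 0, as the chain rule
  -- requires, and subtraction of M does not change the gradient.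
  obtain ⟨ζ, hζ, z1, z2, z3⟩ := exists_comp_mem_graphSpace hΩ (F := fun s => trunc (s - M))
    (F' := fun s => truncDeriv (s - M))
    (fun s => by simpa using (hasDerivAt_trunc (s - M)).comp_sub_const s M)
    (continuous_truncDeriv.comp (by fun_prop))
    (fun s => by rw [abs_of_nonneg (truncDeriv_nonneg _)]; exact truncDeriv_le_one _)
    (trunc_of_nonpos (by linarith)) hξ
  have hE := heq ζ hζ
  have G := hK ζ hζ
  rw [formW_eq_integral_density, WithLp.prod_inner_apply, WithLp.prod_inner_apply] at hE
  change _ + (ω + l) * (inner ℝ ξ.fst.fst ζ.fst.fst + inner ℝ ξ.fst.snd ζ.fst.snd) =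
    l * (inner ℝ f.fst ζ.fst.fst + inner ℝ f.snd ζ.fst.snd) at hE
  simp only [inner_eq_integral_mul] at hE
  have imul : ∀ {μ : Measure (E N)} (g k : Lp ℝ 2 μ), Integrable (fun x => g x * k x) μ :=
    fun g k => integrable_mul_of_memLp_two (Lp.memLp g) (Lp.memLp k)
  have isub : ∀ {μ : Measure (E N)} [IsFiniteMeasure μ] (g k : Lp ℝ 2 μ),
      Integrable (fun x => (g x - M) * k x) μ := fun g k =>
    integrable_mul_of_memLp_two ((Lp.memLp g).sub (memLp_const M)) (Lp.memLp k)
  have iL : ∀ {μ : Measure (E N)} [IsFiniteMeasure μ] (g : Lp ℝ 2 μ), Integrable g μ :=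
    fun g => (Lp.memLp g).integrable one_le_two
  have ibq : ∀ j, Integrable (fun x => b j x * ζ.snd j x) (vol Ω) := fun j => by
    obtain ⟨B, _, hB⟩ := exists_ae_abs_le_of_memLp_top (hb j)
    exact (iL (ζ.snd j)).bdd_mul (hb j).1 hB
  have ibs : Integrable (fun x => ∑ j, b j x * ζ.snd j x) (vol Ω) :=
    integrable_finsetSum _ fun j _ => ibq j
  have idn := integrable_density ha hb hc hd ξ.fst.fst ζ.fst.fst (fun i => ξ.snd i)
    fun i => ζ.snd i
  have ibd : Integrable (fun x => β x * ξ.fst.snd x * ζ.fst.snd x) (surf Ω) :=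
    integrable_weight_mul_mul hβ (Lp.memLp _) (Lp.memLp _)
  have l1 : Integrable (fun x => M * (∑ j, b j x * ζ.snd j x) + K * M * ζ.fst.fst x) (vol Ω) :=
    (ibs.const_mul M).add ((iL ζ.fst.fst).const_mul (K * M))
  have r1 : Integrable (fun x => density (fun i j => a i j x) (fun j => b j x) (fun i => c i x)
      (d x) (ξ.fst.fst x) (fun i => ξ.snd i x) (ζ.fst.fst x) (fun j => ζ.snd j x) +
      (ω + l) * (ξ.fst.fst x * ζ.fst.fst x)) (vol Ω) := idn.add ((imul _ _).const_mul _)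
  have r2 : Integrable (fun x => β x * ξ.fst.snd x * ζ.fst.snd x +
      (ω + l) * (ξ.fst.snd x * ζ.fst.snd x)) (surf Ω) := ibd.add ((imul _ _).const_mul _)
  have h1 : ∫ x, (M * (∑ j, b j x * ζ.snd j x) + K * M * ζ.fst.fst x +
      l * ((ξ.fst.fst x - M) * ζ.fst.fst x)) ∂(vol Ω) ≤
      ∫ x, (density (fun i j => a i j x) (fun j => b j x) (fun i => c i x)
      (d x) (ξ.fst.fst x) (fun i => ξ.snd i x) (ζ.fst.fst x) (fun j => ζ.snd j x) +
      (ω + l) * (ξ.fst.fst x * ζ.fst.fst x) - l * (f.fst x * ζ.fst.fst x)) ∂(vol Ω) := by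
    refine integral_mono_ae (l1.add ((isub _ _).const_mul _)) (r1.sub ((imul _ _).const_mul _)) ?_
    filter_upwards [h.elliptic, h.drift, h.drift', h.potential, hf.1, z1, ae_all_iff.2 z3]
      with x k1 k2 k3 k4 k5 k6 k7
    have := density_trunc_ge (w := ξ.fst.fst x - M) (V := trunc (ξ.fst.fst x - M))
      (t := truncDeriv (ξ.fst.fst x - M)) h.pos (k1 fun i => ξ.snd i x) k2 k3 k4 hω hKω hl k5 hM
      (truncDeriv_nonneg _) (trunc_nonneg _) (mul_trunc_nonneg _) (sq_mul_truncDeriv_le _)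
      (trunc_sq_le _)
    rw [sub_add_cancel] at this
    simp only [k6, k7]
    exact this
  have h2 : ∫ x, (K * M * ζ.fst.snd x + l * ((ξ.fst.snd x - M) * ζ.fst.snd x)) ∂(surf Ω) ≤
      ∫ x, (β x * ξ.fst.snd x * ζ.fst.snd x + (ω + l) * (ξ.fst.snd x * ζ.fst.snd x) -
        l * (f.snd x * ζ.fst.snd x)) ∂(surf Ω) := by
    refine integral_mono_ae (((iL _).const_mul _).add ((isub _ _).const_mul _))
      (r2.sub ((imul _ _).const_mul _)) ?_
    filter_upwards [h.boundary, hf.2, z2] with x k1 k2 k3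
    have h3 := (abs_le.1 k1).1
    have h4 : 0 ≤ (N : ℝ) * (2 * B ^ 2 / α) := by have := h.pos; positivity
    simp only [k3]
    have s1 := trunc_nonneg (ξ.fst.snd x - M)
    have s2 := mul_trunc_nonneg (ξ.fst.snd x - M)
    have hp := h.pos
    generalize trunc (ξ.fst.snd x - M) = V at *
    have s3 : 0 ≤ M * V := by positivity
    have t1 : 0 ≤ (β x + ω) * ((ξ.fst.snd x - M) * V) := mul_nonneg (by linarith) s2
    have t2 : 0 ≤ (β x + ω - K) * (M * V) := mul_nonneg (by linarith) s3
    have t3 : 0 ≤ l * ((M - f.snd x) * V) := mul_nonneg hl.le (mul_nonneg (by linarith) s1)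
    nlinarith
  rw [integral_add l1 ((isub _ _).const_mul _), integral_add (ibs.const_mul M)
    ((iL ζ.fst.fst).const_mul (K * M)), integral_sub r1 ((imul _ _).const_mul _),
    integral_add idn ((imul _ _).const_mul _), integral_const_mul, integral_const_mul,
    integral_const_mul, integral_const_mul, integral_const_mul,
    integral_finsetSum _ fun j _ => ibq j] at h1
  rw [integral_add ((iL _).const_mul _) ((isub _ _).const_mul _),
    integral_sub r2 ((imul _ _).const_mul _), integral_add ibd ((imul _ _).const_mul _),
    integral_const_mul, integral_const_mul, integral_const_mul, integral_const_mul] at h2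
  have a1 : ∫ x, |ζ.fst.fst x| ∂(vol Ω) = ∫ x, ζ.fst.fst x ∂(vol Ω) := integral_congr_ae <| by
    filter_upwards [z1] with x hx
    rw [hx]; exact abs_of_nonneg (trunc_nonneg _)
  have a2 : ∫ x, |ζ.fst.snd x| ∂(surf Ω) = ∫ x, ζ.fst.snd x ∂(surf Ω) := integral_congr_ae <| by
    filter_upwards [z2] with x hx
    rw [hx]; exact abs_of_nonneg (trunc_nonneg _)
  rw [a1, a2] at G
  -- The drift term M ∫ b·∇v is at least -K M times the interior and boundary integrals of v.
  -- Exactly these multiples were reserved in `h1` and `h2`, so after cancellation only l times the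
  -- two integrals of (u - M) G(u - M) remains, and it is at most zero.
  have G' := mul_le_mul_of_nonneg_left (abs_le.1 G).1 hM
  have n1 : 0 ≤ ∫ x, (ξ.fst.fst x - M) * ζ.fst.fst x ∂(vol Ω) := integral_nonneg_of_ae <| by
    filter_upwards [z1] with x hx
    rw [hx]; exact mul_trunc_nonneg _
  have n2 : 0 ≤ ∫ x, (ξ.fst.snd x - M) * ζ.fst.snd x ∂(surf Ω) := integral_nonneg_of_ae <| by
    filter_upwards [z2] with x hx
    rw [hx]; exact mul_trunc_nonneg _
  have hsum : l * (∫ x, (ξ.fst.fst x - M) * ζ.fst.fst x ∂(vol Ω) +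
      ∫ x, (ξ.fst.snd x - M) * ζ.fst.snd x ∂(surf Ω)) ≤ 0 := by linarith
  have hsum' := nonpos_of_mul_nonpos_right hsum hl
  exact ⟨ae_le_of_integral_mul_trunc_nonpos z1 (by linarith),
    ae_le_of_integral_mul_trunc_nonpos z2 (by linarith)⟩

end Invariance

/-! ### Elliptic forms restricted to a closed subspace -/

section Submodule

variable {Y K : Type*} [NormedAddCommGroup Y] [InnerProductSpace ℝ Y] [CompleteSpace Y]
  [NormedAddCommGroup K] [InnerProductSpace ℝ K] [CompleteSpace K]

/-- A closed subspace is itself a Hilbert space; the form and the map to `K` may thus be given on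
the ambient space, while ellipticity is needed only on `G`. -/
theorem exists_resolvent_of_elliptic_submodule (G : Submodule ℝ Y) (hG : IsClosed (G : Set Y))
    (j : Y →L[ℝ] K) (hj : Dense (j '' G)) (B : Y →L[ℝ] Y →L[ℝ] ℝ) {ω α : ℝ} (hα : 0 < α)
    (hB : ∀ ξ ∈ G, α * ‖ξ‖ ^ 2 ≤ B ξ ξ + ω * ‖j ξ‖ ^ 2) :
    ∃ R : ℝ → K →L[ℝ] K, IsContractiveResolvent
      {q : K × K | ∃ ξ ∈ G, j ξ = q.1 ∧
        ∀ ζ ∈ G, B ξ ζ + ω * inner ℝ q.1 (j ζ) = -inner ℝ q.2 (j ζ)} R ∧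
      ∀ l : ℝ, 0 < l → ∀ f, ∃ ξ ∈ G, j ξ = R l f ∧
        ∀ ζ ∈ G, B ξ ζ + (ω + l) * inner ℝ (j ξ) (j ζ) = inner ℝ f (j ζ) := by
  have : CompleteSpace G := hG.completeSpace_coe
  have hd : DenseRange (j.comp G.subtypeL) := by
    rw [DenseRange, ContinuousLinearMap.coe_comp, Set.range_comp]
    simpa using hj
  obtain ⟨R, hR, hsol⟩ := exists_resolvent_of_elliptic (j.comp G.subtypeL) hd
    (B.bilinearComp G.subtypeL G.subtypeL) hα fun v => hB v v.2
  refine ⟨R, ?_, fun l hl f => ?_⟩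
  · convert! hR using 1
    ext q
    constructor
    · rintro ⟨ξ, hξ, h1, h2⟩
      exact ⟨⟨ξ, hξ⟩, h1, fun w => h2 w w.2⟩
    · rintro ⟨v, h1, h2⟩
      exact ⟨v, v.2, h1, fun ζ hζ => h2 ⟨ζ, hζ⟩⟩
  · obtain ⟨v, h1, h2⟩ := hsol l hl f
    exact ⟨v, v.2, h1, fun ζ hζ => h2 ⟨ζ, hζ⟩⟩

end Submodule

/-! ### Construction of the semigroup and the submarkovian property -/

section Semigroup

variable {N : ℕ} {Ω : Set (E N)} {a : Fin N → Fin N → E N → ℝ} {b c : Fin N → E N → ℝ}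
  {d β : E N → ℝ}

theorem mem_operatorGraph_iff (hΩ : IsLipschitzRegular Ω) (ha : ∀ i j, MemLp (a i j) ∞ (vol Ω))
    (hb : ∀ j, MemLp (b j) ∞ (vol Ω)) (hc : ∀ i, MemLp (c i) ∞ (vol Ω)) (hd : MemLp d ∞ (vol Ω))
    (hβ : MemLp β ∞ (surf Ω)) {x f : H Ω} : (x, f) ∈ operatorGraph Ω a b c d β ↔
      ∃ ξ ∈ graphSpace Ω, ξ.fst = x ∧
        ∀ ζ ∈ graphSpace Ω, formW ha hb hc hd hβ ξ ζ = inner ℝ f ζ.fst := by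
  constructor
  · rintro ⟨hx, h⟩
    obtain ⟨ξ, hξ, rfl⟩ := (mem_formDomain_iff hΩ).1 hx
    refine ⟨ξ, hξ, rfl, fun ζ hζ => ?_⟩
    rw [← form_eq_formW ha hb hc hd hβ hΩ hξ hζ]
    exact h _ ((mem_formDomain_iff hΩ).2 ⟨ζ, hζ, rfl⟩)
  · rintro ⟨ξ, hξ, rfl, h⟩
    refine ⟨(mem_formDomain_iff hΩ).2 ⟨ξ, hξ, rfl⟩, fun y hy => ?_⟩
    obtain ⟨ζ, hζ, rfl⟩ := (mem_formDomain_iff hΩ).1 hy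
    rw [← h ζ hζ]
    exact form_eq_formW ha hb hc hd hβ hΩ hξ hζ

theorem eLpNorm_top_le_of_ae_le {μ : Measure (E N)} {f : Lp ℝ 2 μ} {M : ℝ}
    (h1 : ∀ᵐ p ∂μ, f p ≤ M) (h2 : ∀ᵐ p ∂μ, -f p ≤ M) : eLpNorm f ∞ μ ≤ ENNReal.ofReal M := by
  rw [eLpNorm_exponent_top]
  refine eLpNormEssSup_le_of_ae_bound ?_
  filter_upwards [h1, h2] with p k1 k2
  exact abs_le'.2 ⟨k1, k2⟩

theorem ae_abs_le_of_eLpNorm_top_le {μ : Measure (E N)} {f : Lp ℝ 2 μ} {M : ℝ≥0∞} (hM : M ≠ ∞)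
    (h : eLpNorm f ∞ μ ≤ M) : ∀ᵐ p ∂μ, |f p| ≤ M.toReal := by
  rw [eLpNorm_exponent_top] at h
  filter_upwards [ae_le_eLpNormEssSup (f := f) (μ := μ)] with p hp
  have := ENNReal.toReal_mono hM (hp.trans h)
  simpa using this

theorem neg_mem_boundedAbove_iff {x : H Ω} {M : ℝ} : -x ∈ boundedAbove Ω M ↔
    (∀ᵐ p ∂(vol Ω), -x.fst p ≤ M) ∧ ∀ᵐ p ∂(surf Ω), -x.snd p ≤ M := by
  refine and_congr (eventually_congr ?_) (eventually_congr ?_)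
  · filter_upwards [Lp.coeFn_neg x.fst] with p hp
    rw [WithLp.neg_fst, hp, Pi.neg_apply]
  · filter_upwards [Lp.coeFn_neg x.snd] with p hp
    rw [WithLp.neg_snd, hp, Pi.neg_apply]

theorem isNonneg_iff_neg_mem_boundedAbove {x : H Ω} : IsNonneg x ↔ -x ∈ boundedAbove Ω 0 := by
  rw [neg_mem_boundedAbove_iff, IsNonneg, ← Lp.coeFn_nonneg, ← Lp.coeFn_nonneg]
  simp only [neg_nonpos]
  rfl

theorem isPositiveOp_of_mapsTo {S : H Ω →L[ℝ] H Ω}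
    (h : ∀ x ∈ boundedAbove Ω 0, S x ∈ boundedAbove Ω 0) : IsPositiveOp S := by
  intro x hx
  rw [isNonneg_iff_neg_mem_boundedAbove] at hx ⊢
  rw [← map_neg]
  exact h _ hx

/-- A bound |x| ≤ M consists of the upper bounds M for x and for -x, and linearity carries both
over; an infinite norm on the right leaves nothing to prove. -/
theorem isLinftyContractive_of_mapsTo {S : H Ω →L[ℝ] H Ω}
    (h : ∀ M : ℝ, 0 ≤ M → ∀ x ∈ boundedAbove Ω M, S x ∈ boundedAbove Ω M) :
    IsLinftyContractive S := by
  intro x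
  rcases eq_or_ne (linftyNorm x) ∞ with hx | hx
  · rw [hx]; exact le_top
  have h1 := ae_abs_le_of_eLpNorm_top_le hx (le_max_left _ _)
  have h2 := ae_abs_le_of_eLpNorm_top_le hx (le_max_right _ _)
  have k1 := h (linftyNorm x).toReal ENNReal.toReal_nonneg x
    ⟨h1.mono fun p hp => (le_abs_self _).trans hp, h2.mono fun p hp => (le_abs_self _).trans hp⟩
  have k2 := h (linftyNorm x).toReal ENNReal.toReal_nonneg (-x) (neg_mem_boundedAbove_iff.2
    ⟨h1.mono fun p hp => (neg_le_abs _).trans hp, h2.mono fun p hp => (neg_le_abs _).trans hp⟩)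
  rw [map_neg, neg_mem_boundedAbove_iff] at k2
  rw [← ENNReal.ofReal_toReal hx]
  exact max_le (eLpNorm_top_le_of_ae_le k1.1 k2.1) (eLpNorm_top_le_of_ae_le k1.2 k2.2)

theorem exists_resolvent_formW (hΩ : IsLipschitzRegular Ω)
    (ha : ∀ i j, MemLp (a i j) ∞ (vol Ω)) (hb : ∀ j, MemLp (b j) ∞ (vol Ω))
    (hc : ∀ i, MemLp (c i) ∞ (vol Ω)) (hd : MemLp d ∞ (vol Ω)) (hβ : MemLp β ∞ (surf Ω))
    {α B D ω : ℝ} (h : CoefficientBounds Ω a b c d β α B D)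
    (hω : N * (2 * B ^ 2 / α) + D + α / 2 ≤ ω) :
    ∃ R : ℝ → H Ω →L[ℝ] H Ω, IsContractiveResolvent
      {q : H Ω × H Ω | ∃ ξ ∈ graphSpace Ω, ξ.fst = q.1 ∧ ∀ ζ ∈ graphSpace Ω,
        formW ha hb hc hd hβ ξ ζ + ω * inner ℝ q.1 ζ.fst = -inner ℝ q.2 ζ.fst} R ∧
      ∀ l : ℝ, 0 < l → ∀ f, ∃ ξ ∈ graphSpace Ω, ξ.fst = R l f ∧ ∀ ζ ∈ graphSpace Ω,
        formW ha hb hc hd hβ ξ ζ + (ω + l) * inner ℝ ξ.fst ζ.fst = inner ℝ f ζ.fst := by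
  have hdense : Dense (comp₁ Ω '' graphSpace Ω) := by
    have := denseRange_graphEmb hΩ
    rw [DenseRange, graphEmb, ContinuousLinearMap.coe_comp, Set.range_comp] at this
    simpa using this
  exact exists_resolvent_of_elliptic_submodule (graphSpace Ω)
    (Submodule.isClosed_topologicalClosure _) (comp₁ Ω) hdense (formW ha hb hc hd hβ)
    (half_pos h.pos) fun ξ _ => formW_coercive ha hb hc hd hβ h hω ξ

/-- Existence of the Wentzell–Robin semigroup, with the density of the domain of its generator and the
invariance of the sets `{x ≤ M}`, `M ≥ 0`, after rescaling. -/
theorem exists_wentzellRobinSemigroup (hN : 2 ≤ N) (hΩ : IsLipschitzRegular Ω)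
    (ha : ∀ i j, MemLp (a i j) ∞ (vol Ω)) (hb : ∀ j, MemW1Infty Ω (b j))
    (hc : ∀ i, MemLp (c i) ∞ (vol Ω)) (hd : MemLp d ∞ (vol Ω)) (hβ : MemLp β ∞ (surf Ω))
    (hell : ∃ α : ℝ, 0 < α ∧ ∀ᵐ x ∂(vol Ω), ∀ ξ : E N,
      α * ‖ξ‖ ^ 2 ≤ ∑ i, ∑ j, a i j x * ξ i * ξ j) :
    ∃ T : ℝ≥0 → H Ω →L[ℝ] H Ω, IsWentzellRobinSemigroup Ω a b c d β T ∧
      Dense {x | ∃ y, (x, y) ∈ generatorGraph T} ∧ IsQuasiSubmarkovian T := by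
  have hb' := fun j => (hb j).1
  obtain ⟨α, B, D, h⟩ := exists_coefficientBounds hb' hc hd hβ hell
  obtain ⟨K, hK0, hK⟩ := exists_sum_integral_grad_le hN hΩ hb
  have hα := h.pos
  have hD := h.nonneg
  -- One ω serves all purposes: the first three terms give coercivity and absorb the Young
  -- remainders, and the additional K absorbs the drift term in the truncation argument.
  have hω : N * (2 * B ^ 2 / α) + D + α / 2 ≤ N * (2 * B ^ 2 / α) + D + α / 2 + K := by linarith
  have hKω : D + K ≤ N * (2 * B ^ 2 / α) + D + α / 2 + K := by
    have : 0 ≤ (N : ℝ) * (2 * B ^ 2 / α) + α / 2 := by positivity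
    linarith
  generalize (N : ℝ) * (2 * B ^ 2 / α) + D + α / 2 + K = ω at hω hKω
  obtain ⟨R, hR, hsol⟩ := exists_resolvent_formW hΩ ha hb' hc hd hβ h hω
  obtain ⟨S, hS, hgen, -, hinv⟩ := hR.exists_semigroup
  -- The contraction semigroup is generated by -(A + ω); the factor e^{ωt} removes the shift.
  have hmem : ∀ x f : H Ω, (x, -f) ∈ generatorGraph (rescale ω S) ↔
      (x, f) ∈ operatorGraph Ω a b c d β := by
    intro x f
    rw [mem_generatorGraph_rescale, hgen, mem_operatorGraph_iff hΩ ha hb' hc hd hβ]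
    have e : ∀ y : H Ω, -inner ℝ (-f - ω • x) y = inner ℝ f y + ω * inner ℝ x y := by
      intro y
      rw [inner_sub_left, inner_neg_left, real_inner_smul_left]; ring
    constructor
    · rintro ⟨ξ, hξ, hx, hv⟩
      refine ⟨ξ, hξ, hx, fun ζ hζ => ?_⟩
      have := hv ζ hζ
      rw [e] at this
      exact add_right_cancel this
    · rintro ⟨ξ, hξ, hx, hv⟩
      refine ⟨ξ, hξ, hx, fun ζ hζ => ?_⟩
      rw [e, hv ζ hζ]
  have hpres : ∀ M : ℝ, 0 ≤ M → ∀ t, ∀ x ∈ boundedAbove Ω M, S t x ∈ boundedAbove Ω M := by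
    intro M hM
    refine hinv _ (convex_boundedAbove M) (isClosed_boundedAbove hΩ M) fun l hl x hx => ?_
    obtain ⟨ξ, hξ, hv, hvw⟩ := hsol l hl (l • x)
    have e : (l • R l) x = ξ.fst := by rw [hv, map_smul]; rfl
    rw [e]
    refine mem_boundedAbove_of_formW_eq hΩ ha hb' hc hd hβ h hω hKω hK hl hM hx hξ fun ζ hζ => ?_
    rw [hvw ζ hζ, real_inner_smul_left]
  refine ⟨rescale ω S, ⟨hS.rescale ω, hmem⟩, ?_, ω, fun t => ?_⟩
  · refine hR.dense.mono ?_
    rintro x ⟨y, hxy⟩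
    rw [← hgen] at hxy
    exact ⟨_, mem_generatorGraph_rescale_of_mem ω hxy⟩
  · have e : Real.exp (-ω * t) • rescale ω S t = S t := congrFun (rescale_neg_rescale ω S) t
    rw [e]
    exact ⟨isPositiveOp_of_mapsTo (hpres 0 le_rfl t),
      isLinftyContractive_of_mapsTo fun M hM => hpres M hM t⟩

end Semigroup

end WentzellRobin

end

/-! ### Existence, uniqueness and the submarkovian property -/

theorem mainTheorem6 (N : ℕ) (hN : 2 ≤ N) (Ω : Set (WentzellRobin.E N))
    (hΩ : WentzellRobin.IsLipschitzRegular Ω)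
    (a : Fin N → Fin N → WentzellRobin.E N → ℝ) (b c : Fin N → WentzellRobin.E N → ℝ)
    (d β : WentzellRobin.E N → ℝ)
    (ha : ∀ i j, MemLp (a i j) ∞ (WentzellRobin.vol Ω))
    (hc : ∀ i, MemLp (c i) ∞ (WentzellRobin.vol Ω))
    (hd : MemLp d ∞ (WentzellRobin.vol Ω))
    (hβ : MemLp β ∞ (WentzellRobin.surf Ω))
    (hell : ∃ α : ℝ, 0 < α ∧ ∀ᵐ x ∂(WentzellRobin.vol Ω), ∀ ξ : WentzellRobin.E N,
      α * ‖ξ‖ ^ 2 ≤ ∑ i, ∑ j, a i j x * ξ i * ξ j)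
    (hb : ∀ j, WentzellRobin.MemW1Infty Ω (b j)) :
    (∃! T : NNReal → WentzellRobin.H Ω →L[ℝ] WentzellRobin.H Ω,
      WentzellRobin.IsWentzellRobinSemigroup Ω a b c d β T) ∧
    ∀ T : NNReal → WentzellRobin.H Ω →L[ℝ] WentzellRobin.H Ω,
      WentzellRobin.IsWentzellRobinSemigroup Ω a b c d β T →
        WentzellRobin.IsQuasiSubmarkovian T := by
  obtain ⟨T, hT, hdense, hsub⟩ :=
    WentzellRobin.exists_wentzellRobinSemigroup hN hΩ ha hb hc hd hβ hell
  have huniq : ∀ S : NNReal → WentzellRobin.H Ω →L[ℝ] WentzellRobin.H Ω,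
      WentzellRobin.IsWentzellRobinSemigroup Ω a b c d β S → S = T := by
    intro S hS
    -- Both generators have the graph of -A. Density of the domain is known from the construction of
    -- `T`, so nothing has to be shown about `S`.
    refine (hT.1.eq_of_generatorGraph_eq hS.1 ?_ hdense).symm
    ext ⟨x, y⟩
    rw [← neg_neg y, hT.2, hS.2]
  exact ⟨⟨T, hT, huniq⟩, fun S hS => huniq S hS ▸ hsub⟩
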